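/- For a finite simple graph $G$ with vertex set $\{v_1,\dots,v_m\}$ and a field $K$, let $R_G=K[v_1,\dots,v_m]$ and let the cover ideal $J_G\subseteq R_G$ be the ideal generated by the monomials $\prod_{v\in A}v$, where $A$ runs over the vertex covers of $G$ (sets of vertices that meet every edge). Let $H_1$ be the graph with vertices $x_1,\dots,x_5,y_1$ in which $x_1,\dots,x_5$ (in this order) form an induced $5$-cycle and the neighbours of $y_1$ are precisely $x_1,x_2,x_3$. For $t>1$ let $H_t$ be the graph with vertices $x_1,\dots,x_{4t-1},y_1,\dots,y_t$ in which $x_1,\dots,x_{4t-1}$ (in this order) form an induced $(4t-1)$-cycle, the neighbours of $y_1$ are precisely $x_1,x_2,x_3$, and for $1<i\le t$ the neighbours of $y_i$ are precisely $x_{4i-4},x_{4i-3},x_{4i-2},x_{4i-1}$. Write $R_t=R_{H_t}$ and $J_t=J_{H_t}$. Theorem. Let $K$ be any field and let $t\ge 1$ be an integer. Then $H_t$ has chromatic number $\chi(H_t)=3$. The associated primes of the powers of $J_t$ stabilize exactly at $(\chi(H_t)-1)+t=2+t$: the number $s=2+t$ is the least positive integer such that $\operatorname{Ass}(R_t/(J_t)^n)=\operatorname{Ass}(R_t/(J_t)^s)$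 for all $n\ge s$. Moreover, for every integer $n\ge 0$, the ideal of $R_t$ generated by all the variables belongs to $\operatorname{Ass}(R_t/(J_t)^n)$ if and only if $n\ge t+2$. -/

import Mathlib

/-- The cover ideal of a graph `G` on a finite vertex set `V`, in the polynomial ring over `K` whose
variables are the vertices: it is generated by the products of the variables over the vertex covers
of `G`. -/
noncomputable def SimpleGraph.coverIdeal {V : Type*} (G : SimpleGraph V) (K : Type*) [Field K] :
    Ideal (MvPolynomial V K) :=
  Ideal.span {f | ∃ A : Finset V, G.IsVertexCover (A : Set V) ∧ f = ∏ v ∈ A, MvPolynomial.X v}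

/-- The number of `x`-vertices of `H_t`: `5` if `t = 1`, and `4 * t - 1` otherwise. -/
def hCycleLength (t : ℕ) : ℕ := if t = 1 then 5 else 4 * t - 1

/-- `HJoined i j` says that `y_i` is joined to `x_j` (indices count from `1`): the neighbours of
`y_1` are `x_1, x_2, x_3`, those of `y_i` for `i > 1` are `x_{4i-4}, x_{4i-3}, x_{4i-2}, x_{4i-1}`. -/
def HJoined (i j : ℕ) : Prop :=
  (i = 1 ∧ 1 ≤ j ∧ j ≤ 3) ∨ (1 < i ∧ 4 * i - 4 ≤ j ∧ j ≤ 4 * i - 1)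

/-- The graph `H_t`. The vertex `Sum.inl a` is `x_{a+1}` and `Sum.inr b` is `y_{b+1}`. The
`x`-vertices form a cycle in their natural order, and no two `y`-vertices are adjacent. -/
def graphH (t : ℕ) : SimpleGraph (Fin (hCycleLength t) ⊕ Fin t) where
  Adj
    | Sum.inl a, Sum.inl a' => (SimpleGraph.cycleGraph (hCycleLength t)).Adj a a'
    | Sum.inl a, Sum.inr b => HJoined (b.val + 1) (a.val + 1)
    | Sum.inr b, Sum.inl a => HJoined (b.val + 1) (a.val + 1)
    | Sum.inr _, Sum.inr _ => False
  symm := ⟨by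
    rintro (a | b) (a' | b') h
    · exact SimpleGraph.Adj.symm h
    · exact h
    · exact h
    · exact h⟩
  loopless := ⟨by
    rintro (a | b) h
    · exact SimpleGraph.irrefl _ h
    · exact h⟩

/-- The set of associated primes of `R / I ^ n`, for an ideal `I` of a commutative ring `R`. -/
def assPower {R : Type*} [CommRing R] (I : Ideal R) (n : ℕ) : Set (Ideal R) :=
  associatedPrimes R (R ⧸ I ^ n)

/-- The associated primes of the powers of `I` stabilize at `s`: `s` is the least positive integer
with `Ass (R / I ^ n) = Ass (R / I ^ s)` for all `n ≥ s`. -/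
def AssStabilizesAt {R : Type*} [CommRing R] (I : Ideal R) (s : ℕ) : Prop :=
  IsLeast {s : ℕ | 1 ≤ s ∧ ∀ n : ℕ, s ≤ n → assPower I n = assPower I s} s

/-!
Let `J` be the cover ideal of a graph. Complements of vertex covers are independent sets, so a
monomial `x ^ b` lies in `J ^ n` if and only if the vertices can be given sets of colours, out of
`n` colours, with at least `n - b v` colours at `v` and disjoint sets at adjacent vertices. Hence
the associated primes of `R / J ^ n` are generated by the supports of the weights that are
critical for `n` colours, that is, are not colourable and become so when any positive value is
lowered by one (`SimpleGraph.mem_assPower_coverIdeal_iff`). It remains to find these supports for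
`H_t`.

If the support of a critical weight on `H_t` is not a clique, then it goes round the cycle:
otherwise it has a perfect elimination order, and its first vertex is simplicial
(`ringSupport_of_criticalWeight`). So `H_t` is treated as a closed ring of fans, each a path with
vertices `l, a, b, r` and an apex `y` joined to all of them. The inner vertices `a, b` are both in
the support, or they are both absent and then `y` is present. In the first fan the vertices `x_2`
and `y_1` have the same closed neighbourhood and act as one; for `t = 1` two auxiliary vertices on
the edge `x_4 x_5` turn it into a second fan. The main point is that a critical weight violates
the odd cycle inequality: if `N` is the length of the cycle through the paths of the fans that
have their inner vertices, then `N` is odd and the total weight, apices included, exceeds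
`(N - 1) / 2 * n` (`odd_and_lt_ringTotal`). Two facts give this.
* Whether a colouring of the two ends of a fan extends to the fan depends only on the number of
  common colours, which has to lie in an interval. Such convex relations between subsets of the
  set of colours are closed under composition (`ConvexRel.comp`), so all the rest of the ring
  imposes a convex condition on the ends of a fan. By interpolation between a colouring with `a`
  lowered and a colouring in which the apex has moved its weight to `a`, the latter weight is not
  colourable either (`FanWeight.ringColorable_of_flatten_of_lower`). This turns the ring into a
  cycle.
* A weighted cycle is coloured by arcs of `n` colours arranged in a circle, whenever a multiple of
  `n` lies between the total weight `W` and `N * n - W` (`FanWeight.ringColorable_of_arcs`).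

For a critical weight of full support, adding up the triangle inequalities against the odd cycle
inequality yields `t + 2 ≤ n` (`add_two_le_of_full`). Conversely, for `n ≥ t + 2` every odd ring
carries a weight with all clique inequalities valid and with an excess of exactly one over
`(N - 1) / 2 * n` (`exists_tightWeight`). Counting shows that a critical weight below it is the weight
itself (`TightWeight.criticalWeight`). So for `n ≥ t + 2` the supports of critical weights are the
cliques with at least two vertices and the odd rings, independently of `n`
(`exists_criticalWeight_iff`); the set of all vertices is one of them, and it occurs for no
smaller `n`.
-/

open MvPolynomial

/-! ### Associated primes of monomial ideals and of powers of cover ideals -/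

/-- An ideal of a polynomial ring is monomial if it contains, with each of its elements, all the
monomials occurring in that element. -/
def IsMonomialIdeal {σ K : Type*} [CommSemiring K] (I : Ideal (MvPolynomial σ K)) : Prop :=
  ∀ f, f ∈ I ↔ ∀ d ∈ f.support, monomial d (1 : K) ∈ I

section Monomial

variable {σ K : Type*} [Field K] {I : Ideal (MvPolynomial σ K)}

theorem isMonomialIdeal_span (S : Set (σ →₀ ℕ)) :
    IsMonomialIdeal (Ideal.span ((fun d => monomial d (1 : K)) '' S)) := by
  intro f
  rw [mem_ideal_span_monomial_image]
  refine forall₂_congr fun d _ => ?_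
  rw [mem_ideal_span_monomial_image]
  classical
  simp [support_monomial]

theorem support_sub_monomial_coeff (f : MvPolynomial σ K) (d : σ →₀ ℕ) [DecidableEq σ] :
    (f - monomial d (coeff d f)).support = f.support.erase d := by
  ext e
  by_cases h : e = d
  · subst h; simp
  · simp [h, coeff_monomial, Ne.symm h]

theorem IsMonomialIdeal.monomial_mem_iff (hI : IsMonomialIdeal I) {d : σ →₀ ℕ} {c : K}
    (hc : c ≠ 0) : monomial d c ∈ I ↔ monomial d (1 : K) ∈ I := by
  classical
  rw [hI, support_monomial, if_neg hc]; simp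

/-- If `g * f` lies in a monomial ideal, so does the product of `f` with some power of the leading
monomial of `g`. -/
theorem IsMonomialIdeal.exists_pow_leading_mul_mem (hI : IsMonomialIdeal I)
    (m : MonomialOrder σ) {g : MvPolynomial σ K} (hg : g ≠ 0) (f : MvPolynomial σ K)
    (h : g * f ∈ I) : ∃ N : ℕ, monomial (m.degree g) (1 : K) ^ N * f ∈ I := by
  classical
  induction hn : f.support.card using Nat.strong_induction_on generalizing f with
  | _ n ih =>
    by_cases hf : f = 0
    · exact ⟨0, by simp [hf]⟩
    -- The product of the leading terms cannot cancel, so it lies in `I`.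
    have hlead : monomial (m.degree g + m.degree f) (1 : K) ∈ I := by
      refine (hI _).1 h _ ?_
      rw [mem_support_iff, m.coeff_mul_of_degree_add]
      exact mul_ne_zero (m.leadingCoeff_ne_zero_iff.2 hg) (m.leadingCoeff_ne_zero_iff.2 hf)
    have hlead' :
        monomial (m.degree g) (1 : K) * monomial (m.degree f) (coeff (m.degree f) f) ∈ I := by
      rw [monomial_mul, one_mul]
      exact (hI.monomial_mem_iff (m.leadingCoeff_ne_zero_iff.2 hf)).2 hlead
    set f₁ := f - monomial (m.degree f) (coeff (m.degree f) f) with hf₁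
    set u := monomial (m.degree g) (1 : K) with hu
    have hcard : (u * f₁).support.card < n := by
      have h1 : (u * f₁).support.card ≤ f₁.support.card := by
        have := support_mul u f₁
        refine (Finset.card_le_card this).trans ?_
        rw [hu, support_monomial, if_neg one_ne_zero, Finset.singleton_add]
        exact Finset.card_image_le
      refine h1.trans_lt ?_
      rw [hf₁, support_sub_monomial_coeff, ← hn]
      exact Finset.card_erase_lt_of_mem (m.degree_mem_support hf)
    obtain ⟨N, hN⟩ := ih _ hcard (u * f₁) (by
      have : g * (u * f₁) =
          u * (g * f) - g * (u * monomial (m.degree f) (coeff (m.degree f) f)) := by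
        rw [hf₁]; ring
      rw [this]
      exact I.sub_mem (I.mul_mem_left _ h) (I.mul_mem_left _ hlead')) rfl
    refine ⟨N + 1, ?_⟩
    have : u ^ (N + 1) * f = u ^ N * (u * f₁)
        + u ^ N * (u * monomial (m.degree f) (coeff (m.degree f) f)) := by
      rw [hf₁]; ring
    rw [this]
    exact I.add_mem hN (I.mul_mem_left _ hlead')

/-- A prime ideal which is the annihilator of an element modulo a monomial ideal is monomial. -/
theorem IsMonomialIdeal.isMonomialIdeal_of_prime (hI : IsMonomialIdeal I) (m : MonomialOrder σ)
    {P : Ideal (MvPolynomial σ K)} [hP : P.IsPrime] (f : MvPolynomial σ K)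
    (h : ∀ g, g ∈ P ↔ g * f ∈ I) : IsMonomialIdeal P := by
  classical
  intro g
  constructor
  · intro hg
    induction hn : g.support.card using Nat.strong_induction_on generalizing g with
    | _ n ih =>
      by_cases hg0 : g = 0
      · simp [hg0]
      obtain ⟨N, hN⟩ := hI.exists_pow_leading_mul_mem m hg0 f ((h g).1 hg)
      have hlm : monomial (m.degree g) (1 : K) ∈ P := hP.mem_of_pow_mem N ((h _).2 hN)
      intro d hd
      by_cases hdg : d = m.degree g
      · rwa [hdg]
      refine ih _ ?_ (g - monomial (m.degree g) (coeff (m.degree g) g)) ?_ rfl d ?_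
      · rw [support_sub_monomial_coeff, ← hn]
        exact Finset.card_erase_lt_of_mem (m.degree_mem_support hg0)
      · refine P.sub_mem hg ?_
        have : monomial (m.degree g) (coeff (m.degree g) g)
            = C (coeff (m.degree g) g) * monomial (m.degree g) (1 : K) := by
          rw [C_mul_monomial, mul_one]
        rw [this]
        exact P.mul_mem_left _ hlm
      · rw [support_sub_monomial_coeff]
        exact Finset.mem_erase.2 ⟨hdg, hd⟩
  · intro hg
    rw [g.as_sum]
    refine P.sum_mem fun d hd => ?_
    have : monomial d (coeff d g) = C (coeff d g) * monomial d (1 : K) := by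
      rw [C_mul_monomial, mul_one]
    rw [this]
    exact P.mul_mem_left _ (hg d hd)

/-- The ideal generated by a set of variables is prime. -/
theorem isPrime_span_X_image (W : Set σ) :
    (Ideal.span ((X : σ → MvPolynomial σ K) '' W)).IsPrime := by
  classical
  -- It is the kernel of the evaluation that sends the variables in `W` to `0`.
  let φ : MvPolynomial σ K →ₐ[K] MvPolynomial σ K := aeval fun v => if v ∈ W then 0 else X v
  have hφ : ∀ g, g - φ g ∈ Ideal.span ((X : σ → MvPolynomial σ K) '' W) := by
    intro g
    rw [← Ideal.Quotient.eq]
    have : (Ideal.Quotient.mkₐ K (Ideal.span ((X : σ → MvPolynomial σ K) '' W)))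
        = (Ideal.Quotient.mkₐ K (Ideal.span ((X : σ → MvPolynomial σ K) '' W))).comp φ := by
      refine MvPolynomial.algHom_ext fun v => ?_
      by_cases hv : v ∈ W
      · simp only [AlgHom.comp_apply, φ, aeval_X, if_pos hv, map_zero]
        exact Ideal.Quotient.eq_zero_iff_mem.2 (Ideal.subset_span ⟨v, hv, rfl⟩)
      · simp [φ, hv]
    exact DFunLike.congr_fun this g
  have : Ideal.span ((X : σ → MvPolynomial σ K) '' W) = RingHom.ker φ.toRingHom := by
    apply le_antisymm
    · rw [Ideal.span_le]
      rintro _ ⟨v, hv, rfl⟩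
      simp [RingHom.mem_ker, φ, hv]
    · intro g hg
      have h0 : φ g = 0 := hg
      simpa [h0] using hφ g
  rw [this]
  exact RingHom.ker_isPrime _

/-- A monomial prime ideal is generated by the variables it contains. -/
theorem IsMonomialIdeal.eq_span_X_image {P : Ideal (MvPolynomial σ K)} (hP : P.IsPrime)
    (hm : IsMonomialIdeal P) : P = Ideal.span (X '' {v | X v ∈ P}) := by
  apply le_antisymm
  · intro g hg
    rw [mem_ideal_span_X_image]
    intro d hd
    have hdP := (hm g).1 hg d hd
    rw [monomial_eq, map_one, one_mul, Finsupp.prod, hP.prod_mem_iff] at hdP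
    obtain ⟨v, hv, hvP⟩ := hdP
    exact ⟨v, hP.mem_of_pow_mem _ hvP, Finsupp.mem_support_iff.1 hv⟩
  · rw [Ideal.span_le]
    rintro _ ⟨v, hv, rfl⟩
    exact hv

/-- The associated primes of a monomial ideal are generated by variables, and are the annihilators
of monomials. -/
theorem IsMonomialIdeal.mem_associatedPrimes_iff [Finite σ] (hI : IsMonomialIdeal I)
    (P : Ideal (MvPolynomial σ K)) :
    P ∈ associatedPrimes (MvPolynomial σ K) (MvPolynomial σ K ⧸ I) ↔
      ∃ W : Set σ, P = Ideal.span (X '' W) ∧ ∃ b : σ →₀ ℕ,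
        (∀ v ∈ W, monomial (Finsupp.single v 1 + b) (1 : K) ∈ I) ∧
        ∀ c : σ →₀ ℕ, (∀ v ∈ W, c v = 0) → monomial (c + b) (1 : K) ∉ I := by
  classical
  have key : P ∈ associatedPrimes (MvPolynomial σ K) (MvPolynomial σ K ⧸ I) ↔
      P.IsPrime ∧ ∃ f, ∀ g, g ∈ P ↔ g * f ∈ I := by
    have hsmul : ∀ g f : MvPolynomial σ K,
        g • Ideal.Quotient.mk I f = Ideal.Quotient.mk I (g * f) := fun _ _ => rfl
    rw [AssociatedPrimes.mem_iff, isAssociatedPrime_iff]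
    refine and_congr_right fun _ => ?_
    constructor
    · rintro ⟨x, hx⟩
      obtain ⟨f, rfl⟩ := Ideal.Quotient.mk_surjective x
      refine ⟨f, fun g => ?_⟩
      rw [hx, Submodule.mem_colon_singleton, Submodule.mem_bot, hsmul,
        Ideal.Quotient.eq_zero_iff_mem]
    · rintro ⟨f, hf⟩
      refine ⟨Ideal.Quotient.mk I f, ?_⟩
      ext g
      rw [hf, Submodule.mem_colon_singleton, Submodule.mem_bot, hsmul,
        Ideal.Quotient.eq_zero_iff_mem]
  rw [key]
  constructor
  · rintro ⟨hP, f, hf⟩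
    let _ : LinearOrder σ := IsWellOrder.linearOrder (WellOrderingRel (α := σ))
    have hm := hI.isMonomialIdeal_of_prime (MonomialOrder.lex (σ := σ)) f hf
    -- The ideals `I : x ^ d`, for `d` in the support of `f`, have intersection inside `P`.
    have hd : ∃ d ∈ f.support, ∀ g, g * monomial d (1 : K) ∈ I → g ∈ P := by
      by_contra! hcon
      choose! G hG1 hG2 using hcon
      have hprod : ∏ d ∈ f.support, G d ∈ P := by
        rw [hf]
        have hsum : (∏ d ∈ f.support, G d) * f
            = ∑ d ∈ f.support, (∏ d ∈ f.support, G d) * monomial d (coeff d f) := by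
          conv_lhs => arg 2; rw [f.as_sum]
          rw [Finset.mul_sum]
        rw [hsum]
        refine I.sum_mem fun d hd => ?_
        have : (∏ d ∈ f.support, G d) * monomial d (coeff d f)
            = ((∏ d ∈ f.support.erase d, G d) * C (coeff d f)) * (G d * monomial d (1 : K)) := by
          rw [← Finset.mul_prod_erase _ _ hd, ← mul_one (coeff d f), ← C_mul_monomial]
          simp only [mul_one]
          ring
        rw [this]
        exact I.mul_mem_left _ (hG1 d hd)
      rw [hP.prod_mem_iff] at hprod
      obtain ⟨d, hd, hd'⟩ := hprod
      exact hG2 d hd hd'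
    obtain ⟨b, hb, hbP⟩ := hd
    refine ⟨{v | X v ∈ P}, IsMonomialIdeal.eq_span_X_image hP hm, b, ?_, ?_⟩
    · intro v hv
      have := (hf _).1 hv
      refine (hI _).1 this _ ?_
      rw [mem_support_iff, coeff_X_mul]
      exact mem_support_iff.1 hb
    · intro c hc hcb
      have : monomial c (1 : K) ∈ P := hbP _ (by rwa [monomial_mul, one_mul])
      rw [IsMonomialIdeal.eq_span_X_image hP hm, mem_ideal_span_X_image] at this
      obtain ⟨v, hv, hv'⟩ := this c (by simp [support_monomial])
      exact hv' (hc v hv)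
  · rintro ⟨W, rfl, b, hW, hc⟩
    refine ⟨isPrime_span_X_image W, monomial b 1, fun g => ?_⟩
    rw [mem_ideal_span_X_image, hI]
    constructor
    · intro hg d hd
      rw [mem_support_iff, mul_comm, coeff_monomial_mul'] at hd
      have hbd : b ≤ d := by
        by_contra hcon
        simp [hcon] at hd
      rw [if_pos hbd, one_mul] at hd
      obtain ⟨v, hv, hv'⟩ := hg _ (mem_support_iff.2 hd)
      have hdecomp : d = (d - b - Finsupp.single v 1) + (Finsupp.single v 1 + b) := by
        ext w
        have h1 := hbd w
        by_cases hw : v = w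
        · subst hw
          simp only [Finsupp.coe_tsub, Pi.sub_apply] at hv'
          simp; omega
        · simp [hw]; omega
      rw [hdecomp, ← one_mul (1 : K), ← monomial_mul]
      exact I.mul_mem_left _ (hW v hv)
    · intro hg d hd
      by_contra! hcon
      refine hc d hcon (hg _ ?_)
      rw [mem_support_iff, coeff_mul_monomial, mul_one]
      exact mem_support_iff.1 hd

end Monomial

namespace SimpleGraph

variable {V : Type*} (G : SimpleGraph V)

/-- Weighted (multi)colourability: each vertex `v` can be given at least `w v` of the `s` colours
so that adjacent vertices have no colour in common. -/
def WeightColorable (s : ℕ) (w : V → ℕ) : Prop :=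
  ∃ c : V → Finset (Fin s), (∀ v, w v ≤ (c v).card) ∧ ∀ u v, G.Adj u v → Disjoint (c u) (c v)

/-- A weight is critical for `s` colours if it takes values at most `s`, is not colourable, and
becomes colourable when the weight of any vertex of its support is lowered by one. -/
structure CriticalWeight [DecidableEq V] (s : ℕ) (w : V → ℕ) : Prop where
  le : ∀ v, w v ≤ s
  not_colorable : ¬ G.WeightColorable s w
  lower : ∀ v, 0 < w v → G.WeightColorable s (Function.update w v (w v - 1))

variable {G}

theorem WeightColorable.mono {s : ℕ} {w w' : V → ℕ} (h : G.WeightColorable s w) (hw : w' ≤ w) :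
    G.WeightColorable s w' := by
  obtain ⟨c, hc, hd⟩ := h
  exact ⟨c, fun v => (hw v).trans (hc v), hd⟩

/-- A weighted colouring can be trimmed so that every vertex has exactly its number of colours. -/
theorem WeightColorable.exists_card_eq {s : ℕ} {w : V → ℕ} (h : G.WeightColorable s w) :
    ∃ c : V → Finset (Fin s), (∀ v, (c v).card = w v) ∧
      ∀ u v, G.Adj u v → Disjoint (c u) (c v) := by
  obtain ⟨c, hc, hd⟩ := h
  choose c' h1 h2 using fun v => Finset.exists_subset_card_eq (hc v)
  exact ⟨c', h2, fun u v huv => (hd u v huv).mono (h1 u) (h1 v)⟩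

variable (G)

/-- The exponents of the products of `n` monomials attached to vertex covers. -/
def coverExponents (n : ℕ) : Set (V →₀ ℕ) :=
  {d | ∃ A : Fin n → Finset V, (∀ k, G.IsVertexCover (A k : Set V)) ∧
    d = ∑ k, ∑ v ∈ A k, Finsupp.single v 1}

variable (K : Type*) [Field K]

theorem coverIdeal_eq_span : G.coverIdeal K =
    Ideal.span ((fun d => monomial d (1 : K)) '' G.coverExponents 1) := by
  unfold coverIdeal
  congr 1
  ext f
  constructor
  · rintro ⟨A, hA, rfl⟩
    refine ⟨_, ⟨fun _ => A, fun _ => hA, rfl⟩, ?_⟩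
    simp [monomial_sum_one, X]
  · rintro ⟨_, ⟨A, hA, rfl⟩, rfl⟩
    refine ⟨A 0, hA 0, ?_⟩
    simp [monomial_sum_one, X]

theorem coverIdeal_pow_eq_span (n : ℕ) : G.coverIdeal K ^ n =
    Ideal.span ((fun d => monomial d (1 : K)) '' G.coverExponents n) := by
  induction n with
  | zero =>
    rw [pow_zero, Ideal.one_eq_top, eq_comm, Ideal.eq_top_iff_one]
    exact Ideal.subset_span ⟨0, ⟨Fin.elim0, fun k => k.elim0, by simp⟩, rfl⟩
  | succ n ih =>
    rw [pow_succ, ih, coverIdeal_eq_span, Ideal.span_mul_span']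
    congr 1
    ext f
    rw [Set.mem_mul]
    constructor
    · rintro ⟨_, ⟨_, ⟨A, hA, rfl⟩, rfl⟩, _, ⟨_, ⟨B, hB, rfl⟩, rfl⟩, rfl⟩
      refine ⟨_, ⟨Fin.snoc A (B 0), fun k => ?_, rfl⟩, ?_⟩
      · refine Fin.lastCases ?_ (fun k => ?_) k
        · simpa using hB 0
        · simpa using hA k
      · simp [Fin.sum_univ_castSucc, monomial_mul]
    · rintro ⟨_, ⟨A, hA, rfl⟩, rfl⟩
      refine ⟨_, ⟨_, ⟨fun k => A k.castSucc, fun k => hA _, rfl⟩, rfl⟩, _,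
        ⟨_, ⟨fun _ => A (Fin.last n), fun k => hA _, rfl⟩, rfl⟩, ?_⟩
      simp [Fin.sum_univ_castSucc, monomial_mul]

theorem isMonomialIdeal_coverIdeal_pow (n : ℕ) : IsMonomialIdeal (G.coverIdeal K ^ n) := by
  rw [coverIdeal_pow_eq_span]
  exact isMonomialIdeal_span _

/-- Complements of vertex covers are independent sets, so `x ^ b` is a multiple of a product of `n`
cover monomials exactly when the weight `n - b` can be coloured with `n` colours. -/
theorem monomial_mem_coverIdeal_pow_iff [Fintype V] (n : ℕ) (b : V →₀ ℕ) :
    monomial b (1 : K) ∈ G.coverIdeal K ^ n ↔ G.WeightColorable n fun v => n - b v := by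
  classical
  rw [coverIdeal_pow_eq_span, mem_ideal_span_monomial_image]
  have hcount : ∀ (A : Fin n → Finset V) (v : V),
      (∑ k, ∑ u ∈ A k, Finsupp.single u 1 : V →₀ ℕ) v
        = (Finset.univ.filter fun k => v ∈ A k).card := by
    intro A v
    simp [Finsupp.finsetSum_apply, Finsupp.single_apply]
  have hcompl : ∀ (p : Fin n → Prop) [DecidablePred p],
      (Finset.univ.filter p).card + (Finset.univ.filter fun k => ¬ p k).card = n := by
    intro p _
    rw [Finset.card_filter_add_card_filter_not, Finset.card_univ, Fintype.card_fin]
  simp only [support_monomial, if_neg (one_ne_zero (α := K)), Finset.mem_singleton, forall_eq]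
  constructor
  · rintro ⟨_, ⟨A, hA, rfl⟩, hb⟩
    refine ⟨fun v => Finset.univ.filter fun k => v ∉ A k, fun v => ?_, fun u v huv => ?_⟩
    · have h1 := hb v
      rw [hcount] at h1
      have h2 := hcompl fun k => v ∈ A k
      dsimp only
      omega
    · rw [Finset.disjoint_filter]
      intro k _ hu hv
      exact (hA k huv).elim hu hv
  · rintro ⟨c, hc, hd⟩
    refine ⟨_, ⟨fun k => Finset.univ.filter fun v => k ∉ c v, fun k u v huv => ?_, rfl⟩, ?_⟩
    · by_contra! h
      simp only [Finset.coe_filter, Finset.mem_univ, true_and, Set.mem_ofPred_eq, not_not] at h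
      exact Finset.disjoint_left.1 (hd u v huv) h.1 h.2
    · intro v
      rw [hcount]
      have h1 : n - b v ≤ (c v).card := hc v
      have h2 := hcompl fun k => k ∈ c v
      simp only [Finset.mem_filter, Finset.mem_univ, true_and]
      rw [Finset.filter_univ_mem] at h2
      omega

/-- The associated primes of the `n`-th power of a cover ideal are the ideals generated by the
supports of the weights that are critical for `n` colours. -/
theorem mem_assPower_coverIdeal_iff [Fintype V] [DecidableEq V] (n : ℕ)
    (P : Ideal (MvPolynomial V K)) :
    P ∈ assPower (G.coverIdeal K) n ↔
      ∃ w, G.CriticalWeight n w ∧ P = Ideal.span (X '' {v | 0 < w v}) := by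
  unfold assPower
  rw [(G.isMonomialIdeal_coverIdeal_pow K n).mem_associatedPrimes_iff]
  simp only [G.monomial_mem_coverIdeal_pow_iff]
  constructor
  · rintro ⟨W, rfl, b, hW, hc⟩
    classical
    -- Outside `W` the exponent may be raised to `n`, which makes the weight vanish there.
    let w : V → ℕ := fun v => if v ∈ W then n - b v else 0
    have hw : ¬ G.WeightColorable n w := by
      have := hc (Finsupp.equivFunOnFinite.symm fun v => if v ∈ W then 0 else n)
        (fun v hv => by simp [hv])
      refine fun h => this (h.mono fun v => ?_)
      by_cases hv : v ∈ W <;> simp [w, hv]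
    have hlow : ∀ v ∈ W, G.WeightColorable n (Function.update w v (w v - 1)) := by
      intro v hv
      refine (hW v hv).mono fun u => ?_
      by_cases huv : u = v
      · subst huv
        simp [w, hv]; omega
      · by_cases hu : u ∈ W <;> simp [w, hu, huv]
    have hsupp : W = {v | 0 < w v} := by
      ext v
      constructor
      · intro hv
        refine Nat.pos_of_ne_zero fun h0 => hw ?_
        have := hlow v hv
        rwa [h0, Nat.zero_sub, ← h0, Function.update_eq_self] at this
      · intro hv
        by_contra hvW
        simp [w, hvW] at hv
    refine ⟨w, ⟨fun v => ?_, hw, fun v hv => hlow v (hsupp ▸ hv)⟩, by rw [← hsupp]⟩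
    by_cases hv : v ∈ W <;> simp [w, hv]
  · rintro ⟨w, hw, rfl⟩
    refine ⟨_, rfl, Finsupp.equivFunOnFinite.symm fun v => n - w v, fun v hv => ?_,
      fun c hc h => ?_⟩
    · refine (hw.lower v hv).mono fun u => ?_
      have hu := hw.le u
      by_cases huv : u = v
      · subst huv
        simp; omega
      · simp [huv]; omega
    · refine hw.not_colorable (h.mono fun v => ?_)
      have hv := hw.le v
      by_cases h0 : 0 < w v
      · have := hc v h0
        simp [this]; omega
      · simp; omega

end SimpleGraph

/-! ### Critical weights -/

namespace SimpleGraph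

variable {V : Type*} {G : SimpleGraph V}

/-- Below every weight that is not colourable there is a critical one. -/
theorem exists_criticalWeight_le [Fintype V] [DecidableEq V] {s : ℕ} {w : V → ℕ}
    (hw : ¬ G.WeightColorable s w) (hs : ∀ v, w v ≤ s) :
    ∃ w' ≤ w, G.CriticalWeight s w' := by
  induction hn : ∑ v, w v using Nat.strong_induction_on generalizing w with
  | _ n ih =>
    by_cases h : ∀ v, 0 < w v → G.WeightColorable s (Function.update w v (w v - 1))
    · exact ⟨w, le_rfl, hs, hw, h⟩
    · push Not at h
      obtain ⟨v, hv, hcol⟩ := h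
      have hle : Function.update w v (w v - 1) ≤ w :=
        update_le_iff.2 ⟨Nat.sub_le _ _, fun _ _ => le_rfl⟩
      have hlt : ∑ u, Function.update w v (w v - 1) u < n := by
        rw [← hn]
        refine Finset.sum_lt_sum (fun u _ => hle u) ⟨v, Finset.mem_univ _, ?_⟩
        simp only [Function.update_self]; omega
      obtain ⟨w', hw', hc⟩ := ih _ hlt hcol (fun u => (hle u).trans (hs u)) rfl
      exact ⟨w', hw'.trans hle, hc⟩

theorem weightColorable_of_sum_le [Fintype V] {s : ℕ} {w : V → ℕ} (h : ∑ v, w v ≤ s) :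
    G.WeightColorable s w := by
  classical
  have hcard : Fintype.card (Σ v, Fin (w v)) ≤ Fintype.card (Fin s) := by simpa using h
  obtain ⟨e⟩ := Function.Embedding.nonempty_of_card_le hcard
  refine ⟨fun v => Finset.univ.image fun k => e ⟨v, k⟩, fun v => ?_, fun u v huv => ?_⟩
  · rw [Finset.card_image_of_injective _ fun k k' hk => by simpa using e.injective hk]
    simp
  · rw [Finset.disjoint_left]
    intro x hx hx'
    obtain ⟨k, -, rfl⟩ := Finset.mem_image.1 hx
    obtain ⟨k', -, hk'⟩ := Finset.mem_image.1 hx'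
    exact huv.ne (congrArg Sigma.fst (e.injective hk')).symm

theorem WeightColorable.sum_le_of_isClique {s : ℕ} {w : V → ℕ} (h : G.WeightColorable s w)
    {T : Finset V} (hT : (T : Set V).Pairwise G.Adj) : ∑ v ∈ T, w v ≤ s := by
  obtain ⟨c, hc, hd⟩ := h
  calc ∑ v ∈ T, w v ≤ ∑ v ∈ T, (c v).card := Finset.sum_le_sum fun v _ => hc v
    _ = (T.biUnion c).card :=
        (Finset.card_biUnion fun u hu v hv huv => hd u v (hT hu hv huv)).symm
    _ ≤ s := by simpa using Finset.card_le_univ (T.biUnion c)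

variable [DecidableEq V] {s : ℕ} {w : V → ℕ}

theorem CriticalWeight.sum_le_of_isClique (hw : G.CriticalWeight s w) {T : Finset V}
    (hT : (T : Set V).Pairwise G.Adj) {u : V} (hu : 0 < w u) (huT : u ∉ T) :
    ∑ v ∈ T, w v ≤ s := by
  refine le_of_eq_of_le (Finset.sum_congr rfl fun v hv => ?_)
    ((hw.lower u hu).sum_le_of_isClique hT)
  rw [Function.update_of_ne]
  rintro rfl
  exact huT hv

/-- If the neighbours of `v` in the support of a critical weight form a clique, then every vertex
of the support is `v` or a neighbour of `v`: otherwise the closed neighbourhood of `v` has total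
weight at most `s`, and a colouring for a lower weight of `v` could be changed at `v` alone. -/
theorem CriticalWeight.adj_of_simplicial [Fintype V] (hw : G.CriticalWeight s w) {v : V}
    (hv : 0 < w v) (hsimp : {u | G.Adj v u ∧ 0 < w u}.Pairwise G.Adj) {u : V} (hu : 0 < w u) :
    u = v ∨ G.Adj v u := by
  classical
  by_contra! hcon
  let N : Finset V := Finset.univ.filter fun u => G.Adj v u ∧ 0 < w u
  have hvN : v ∉ N := by simp [N]
  have hsum : ∑ x ∈ insert v N, w x ≤ s := by
    refine hw.sum_le_of_isClique ?_ hu (by simp [N, hcon])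
    rw [Finset.coe_insert]
    have hN : (N : Set V) = {u | G.Adj v u ∧ 0 < w u} := by ext; simp [N]
    rw [hN]
    exact hsimp.insert fun x hx _ => ⟨hx.1, hx.1.symm⟩
  rw [Finset.sum_insert hvN] at hsum
  obtain ⟨c, hc, hd⟩ := (hw.lower v hv).exists_card_eq
  have hcard : w v ≤ ((N.biUnion c)ᶜ).card := by
    have h1 : (N.biUnion c).card ≤ ∑ x ∈ N, w x := by
      refine Finset.card_biUnion_le.trans (Finset.sum_le_sum fun x hx => ?_)
      rw [hc, Function.update_of_ne (ne_of_mem_of_not_mem hx hvN)]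
    rw [Finset.card_compl, Fintype.card_fin]
    omega
  obtain ⟨D, hD, hDc⟩ := Finset.exists_subset_card_eq hcard
  have hdisj : ∀ x, G.Adj v x → Disjoint D (c x) := by
    intro x hx
    by_cases h0 : 0 < w x
    · exact (disjoint_compl_left (a := N.biUnion c)).mono hD
        (Finset.subset_biUnion_of_mem c (by simp [N, hx, h0]))
    · have : c x = ∅ := by
        rw [← Finset.card_eq_zero, hc, Function.update_of_ne hx.ne']; omega
      simp [this]
  refine hw.not_colorable ⟨Function.update c v D, fun x => ?_, fun x y hxy => ?_⟩
  · by_cases hx : x = v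
    · subst hx; simp [hDc]
    · rw [Function.update_of_ne hx, hc, Function.update_of_ne hx]
  · by_cases hx : x = v
    · subst hx
      rw [Function.update_self, Function.update_of_ne hxy.ne']
      exact hdisj y hxy
    · by_cases hy : y = v
      · subst hy
        rw [Function.update_self, Function.update_of_ne hx]
        exact (hdisj x hxy.symm).symm
      · rw [Function.update_of_ne hx, Function.update_of_ne hy]
        exact hd x y hxy

end SimpleGraph

/-! ### Convex relations between sets of colours -/

section Exchange

variable {α : Type*} [DecidableEq α]

theorem card_sdiff_sdiff_inter_eq {A A' B : Finset α} :
    ((A \ A') ∩ B).card + ((A ∩ A') ∩ B).card = (A ∩ B).card := by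
  rw [← Finset.card_union_of_disjoint]
  · congr 1; ext; simp; tauto
  · rw [Finset.disjoint_left]; intro x; simp; tauto

/-- Of two distinct sets of the same size, one can be moved towards the other by exchanging one
element so that its intersection with a given set `B` also moves towards that of the other. -/
theorem exists_exchange {A A' B : Finset α} (hcard : A.card = A'.card) (hne : A ≠ A') :
    ∃ x ∈ A \ A', ∃ z ∈ A' \ A,
      min (A ∩ B).card (A' ∩ B).card ≤ (insert z (A.erase x) ∩ B).card ∧
      (insert z (A.erase x) ∩ B).card ≤ max (A ∩ B).card (A' ∩ B).card := by
  have hAB := @card_sdiff_sdiff_inter_eq α _ A A' B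
  have hAB' := @card_sdiff_sdiff_inter_eq α _ A' A B
  rw [Finset.inter_comm A' A] at hAB'
  have h1 := Finset.card_sdiff_add_card_inter A A'
  have h2 := Finset.card_sdiff_add_card_inter A' A
  rw [Finset.inter_comm A' A] at h2
  have h3 := Finset.card_sdiff_add_card_inter (A \ A') B
  have h4 := Finset.card_sdiff_add_card_inter (A' \ A) B
  have hpos : 0 < (A \ A').card := by
    rw [Finset.card_pos, Finset.sdiff_nonempty]
    exact fun h => hne (Finset.eq_of_subset_of_card_le h hcard.ge)
  -- The effect of an exchange on the intersection with `B`.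
  have hins : ∀ x ∈ A, ∀ z ∉ A, (insert z (A.erase x) ∩ B).card + (if x ∈ B then 1 else 0)
      = (A ∩ B).card + (if z ∈ B then 1 else 0) := by
    intro x hx z hz
    have hz' : z ∉ A.erase x ∩ B := by simp [hz]
    have e1 : ((A.erase x) ∩ B).card + (if x ∈ B then 1 else 0) = (A ∩ B).card := by
      rw [Finset.erase_inter]
      split_ifs with hxB
      · exact Finset.card_erase_add_one (Finset.mem_inter.2 ⟨hx, hxB⟩)
      · rw [Finset.erase_eq_of_notMem (by simp [hxB]), add_zero]
    by_cases hzB : z ∈ B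
    · rw [Finset.insert_inter_of_mem hzB, Finset.card_insert_of_notMem hz', if_pos hzB]
      omega
    · rw [Finset.insert_inter_of_notMem hzB, if_neg hzB]
      omega
  have fin : ∀ x ∈ A \ A', ∀ z ∈ A' \ A, (x ∈ B → z ∈ B ∨ (A' ∩ B).card < (A ∩ B).card) →
      (z ∈ B → x ∈ B ∨ (A ∩ B).card < (A' ∩ B).card) → 
      ∃ x ∈ A \ A', ∃ z ∈ A' \ A,
      min (A ∩ B).card (A' ∩ B).card ≤ (insert z (A.erase x) ∩ B).card ∧
      (insert z (A.erase x) ∩ B).card ≤ max (A ∩ B).card (A' ∩ B).card := by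
    intro x hx z hz hxz hzx
    refine ⟨x, hx, z, hz, ?_⟩
    have := hins x (Finset.mem_sdiff.1 hx).1 z (Finset.mem_sdiff.1 hz).2
    by_cases hxB : x ∈ B <;> by_cases hzB : z ∈ B <;> simp only [hxB, hzB, if_true, if_false,
      true_imp_iff, false_imp_iff, true_or, false_or] at this hxz hzx <;> omega
  by_cases hlt : (A ∩ B).card < (A' ∩ B).card
  · obtain ⟨z, hz⟩ := Finset.card_pos.1 (show 0 < ((A' \ A) ∩ B).card by omega)
    obtain ⟨x, hx⟩ := Finset.card_pos.1 (show 0 < ((A \ A') \ B).card by omega)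
    rw [Finset.mem_inter] at hz
    rw [Finset.mem_sdiff] at hx
    exact fin x hx.1 z hz.1 (fun h => absurd h hx.2) fun _ => Or.inr hlt
  · by_cases hgt : (A' ∩ B).card < (A ∩ B).card
    · obtain ⟨z, hz⟩ := Finset.card_pos.1 (show 0 < ((A' \ A) \ B).card by omega)
      obtain ⟨x, hx⟩ := Finset.card_pos.1 (show 0 < ((A \ A') ∩ B).card by omega)
      rw [Finset.mem_inter] at hx
      rw [Finset.mem_sdiff] at hz
      exact fin x hx.1 z hz.1 (fun _ => Or.inr hgt) fun h => absurd h hz.2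
    · obtain ⟨x, hx⟩ := Finset.card_pos.1 hpos
      by_cases hxB : x ∈ B
      · have : 0 < ((A \ A') ∩ B).card := Finset.card_pos.2 ⟨x, Finset.mem_inter.2 ⟨hx, hxB⟩⟩
        obtain ⟨z, hz⟩ := Finset.card_pos.1 (show 0 < ((A' \ A) ∩ B).card by omega)
        rw [Finset.mem_inter] at hz
        exact fin x hx z hz.1 (fun _ => Or.inl hz.2) fun _ => Or.inl hxB
      · have : 0 < ((A \ A') \ B).card := Finset.card_pos.2 ⟨x, Finset.mem_sdiff.2 ⟨hx, hxB⟩⟩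
        obtain ⟨z, hz⟩ := Finset.card_pos.1 (show 0 < ((A' \ A) \ B).card by omega)
        rw [Finset.mem_sdiff] at hz
        exact fin x hx z hz.1 (fun h => absurd h hxB) fun h => absurd h hz.2

/-- Discrete intermediate value property: between `A` and `A'` there is a set meeting `C` in any
prescribed intermediate number of elements, whose intersection with `B` is of intermediate size
too. -/
theorem exists_intermediate {A A' B C : Finset α} {k : ℕ} (hcard : A.card = A'.card)
    (h1 : (A ∩ C).card ≤ k) (h2 : k ≤ (A' ∩ C).card) :
    ∃ D : Finset α, D.card = A.card ∧ (D ∩ C).card = k ∧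
      min (A ∩ B).card (A' ∩ B).card ≤ (D ∩ B).card ∧
      (D ∩ B).card ≤ max (A ∩ B).card (A' ∩ B).card := by
  induction hn : (A \ A').card using Nat.strong_induction_on generalizing A with
  | _ n ih =>
    by_cases hk : (A ∩ C).card = k
    · exact ⟨A, rfl, hk, min_le_left _ _, le_max_left _ _⟩
    have hne : A ≠ A' := by rintro rfl; omega
    obtain ⟨x, hx, z, hz, hmin, hmax⟩ := exists_exchange (B := B) hcard hne
    rw [Finset.mem_sdiff] at hx hz
    have hc : (insert z (A.erase x)).card = A.card := by
      rw [Finset.card_insert_of_notMem (by simp [hz.2]), Finset.card_erase_add_one hx.1]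
    have hC : (insert z (A.erase x) ∩ C).card ≤ (A ∩ C).card + 1 := by
      refine (Finset.card_le_card (?_ : _ ⊆ insert z (A ∩ C))).trans (Finset.card_insert_le _ _)
      intro u; simp only [Finset.mem_inter, Finset.mem_insert, Finset.mem_erase]; tauto
    have hlt : (insert z (A.erase x) \ A').card < n := by
      rw [← hn]
      refine Finset.card_lt_card ⟨fun u => ?_, fun h => ?_⟩
      · simp only [Finset.mem_sdiff, Finset.mem_insert, Finset.mem_erase]
        rintro ⟨rfl | h, h'⟩
        · exact absurd hz.1 h'
        · exact ⟨h.2, h'⟩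
      · have := h (Finset.mem_sdiff.2 hx)
        simp only [Finset.mem_sdiff, Finset.mem_insert, Finset.mem_erase] at this
        rcases this.1 with rfl | h'
        · exact hz.2 hx.1
        · exact h'.1 rfl
    obtain ⟨D, hD, hDk, hD1, hD2⟩ := ih _ hlt (hc.trans hcard) (by omega) rfl
    exact ⟨D, hD.trans hc, hDk, by omega, by omega⟩

/-- Two pairs of finite sets with the same sizes and the same size of intersection differ by a
permutation. -/
theorem exists_perm_map_eq [Fintype α] {A B A' B' : Finset α} (hA : A.card = A'.card)
    (hB : B.card = B'.card) (hAB : (A ∩ B).card = (A' ∩ B').card) :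
    ∃ σ : Equiv.Perm α, A.map σ.toEmbedding = A' ∧ B.map σ.toEmbedding = B' := by
  have hfib : ∀ p : Bool × Bool, Fintype.card {x // (decide (x ∈ A), decide (x ∈ B)) = p}
      = Fintype.card {x // (decide (x ∈ A'), decide (x ∈ B')) = p} := by
    have h1 := Finset.card_sdiff_add_card_inter A B
    have h1' := Finset.card_sdiff_add_card_inter A' B'
    have h2 := Finset.card_sdiff_add_card_inter B A
    have h2' := Finset.card_sdiff_add_card_inter B' A'
    rw [Finset.inter_comm B A] at h2
    rw [Finset.inter_comm B' A'] at h2'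
    have h3 := Finset.card_union_add_card_inter A B
    have h3' := Finset.card_union_add_card_inter A' B'
    have h4 := Finset.card_compl_add_card (A ∪ B)
    have h4' := Finset.card_compl_add_card (A' ∪ B')
    rintro ⟨_ | _, _ | _⟩ <;> rw [Fintype.card_subtype, Fintype.card_subtype]
    · have e : ∀ A B : Finset α, (Finset.univ.filter fun x => (decide (x ∈ A), decide (x ∈ B))
          = (false, false)) = (A ∪ B)ᶜ := by intro A B; ext; simp
      rw [e, e]; omega
    · have e : ∀ A B : Finset α, (Finset.univ.filter fun x => (decide (x ∈ A), decide (x ∈ B))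
          = (false, true)) = B \ A := by intro A B; ext; simp [and_comm]
      rw [e, e]; omega
    · have e : ∀ A B : Finset α, (Finset.univ.filter fun x => (decide (x ∈ A), decide (x ∈ B))
          = (true, false)) = A \ B := by intro A B; ext; simp
      rw [e, e]; omega
    · have e : ∀ A B : Finset α, (Finset.univ.filter fun x => (decide (x ∈ A), decide (x ∈ B))
          = (true, true)) = A ∩ B := by intro A B; ext; simp
      rw [e, e]; omega
  let f := fun x => (decide (x ∈ A), decide (x ∈ B))
  let g := fun x => (decide (x ∈ A'), decide (x ∈ B'))
  let σ : Equiv.Perm α := (Equiv.sigmaFiberEquiv f).symm.trans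
    ((Equiv.sigmaCongrRight fun p => Fintype.equivOfCardEq (hfib p)).trans
      (Equiv.sigmaFiberEquiv g))
  have hσ : ∀ x, g (σ x) = f x := fun x =>
    ((Fintype.equivOfCardEq (hfib (f x))) ⟨x, rfl⟩).2
  have hσA : ∀ x, σ x ∈ A' ↔ x ∈ A := fun x => by
    have := congrArg Prod.fst (hσ x); simpa [f, g] using this
  have hσB : ∀ x, σ x ∈ B' ↔ x ∈ B := fun x => by
    have := congrArg Prod.snd (hσ x); simpa [f, g] using this
  refine ⟨σ, ?_, ?_⟩
  · ext y
    obtain ⟨x, rfl⟩ := σ.surjective y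
    simp [hσA]
  · ext y
    obtain ⟨x, rfl⟩ := σ.surjective y
    simp [hσB]

/-- A relation between the `a`-subsets and the `b`-subsets of a finite type is convex if it only
depends on the size of the intersection and holds for an interval of sizes. -/
def ConvexRel (a b : ℕ) (ρ : Finset α → Finset α → Prop) : Prop :=
  ∀ A B A₁ B₁ A₂ B₂, A.card = a → B.card = b → A₁.card = a → B₁.card = b → A₂.card = a →
    B₂.card = b → ρ A₁ B₁ → ρ A₂ B₂ → (A₁ ∩ B₁).card ≤ (A ∩ B).card →
    (A ∩ B).card ≤ (A₂ ∩ B₂).card → ρ A B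

theorem ConvexRel.between {a b : ℕ} {ρ : Finset α → Finset α → Prop} (h : ConvexRel a b ρ)
    {A B A₁ B₁ A₂ B₂ : Finset α} (hA : A.card = a) (hB : B.card = b) (hA₁ : A₁.card = a)
    (hB₁ : B₁.card = b) (hA₂ : A₂.card = a) (hB₂ : B₂.card = b) (h₁ : ρ A₁ B₁) (h₂ : ρ A₂ B₂)
    (hl : min (A₁ ∩ B₁).card (A₂ ∩ B₂).card ≤ (A ∩ B).card)
    (hr : (A ∩ B).card ≤ max (A₁ ∩ B₁).card (A₂ ∩ B₂).card) : ρ A B := by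
  rcases le_total (A₁ ∩ B₁).card (A₂ ∩ B₂).card with hle | hle
  · rw [min_eq_left hle] at hl
    rw [max_eq_right hle] at hr
    exact h A B A₁ B₁ A₂ B₂ hA hB hA₁ hB₁ hA₂ hB₂ h₁ h₂ hl hr
  · rw [min_eq_right hle] at hl
    rw [max_eq_left hle] at hr
    exact h A B A₂ B₂ A₁ B₁ hA hB hA₂ hB₂ hA₁ hB₁ h₂ h₁ hl hr

theorem ConvexRel.map {a b : ℕ} {ρ : Finset α → Finset α → Prop} (h : ConvexRel a b ρ)
    {A B : Finset α} (hA : A.card = a) (hB : B.card = b) (hρ : ρ A B) (σ : Equiv.Perm α) :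
    ρ (A.map σ.toEmbedding) (B.map σ.toEmbedding) := by
  have : (A.map σ.toEmbedding ∩ B.map σ.toEmbedding).card = (A ∩ B).card := by
    rw [← Finset.map_inter, Finset.card_map]
  exact h _ _ A B A B (by simpa) (by simpa) hA hB hA hB hρ hρ this.ge this.le

/-- Convex relations are closed under composition. Two chains `A, B, C` can be moved to have the
same middle set, and then the outer sets can be moved one after the other. -/
theorem ConvexRel.comp [Fintype α] {a b c : ℕ} {ρ τ : Finset α → Finset α → Prop}
    (hρ : ConvexRel a b ρ) (hτ : ConvexRel b c τ) :
    ConvexRel a c fun A C => ∃ B : Finset α, B.card = b ∧ ρ A B ∧ τ B C := by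
  rintro A C A₁ C₁ A₂ C₂ hA hC hA₁ hC₁ hA₂ hC₂ ⟨B, hB, hρ₁, hτ₁⟩ ⟨B₂, hB₂, hρ₂, hτ₂⟩ hl hr
  obtain ⟨σ, hσ, -⟩ := exists_perm_map_eq (A := B₂) (B := B₂) (A' := B) (B' := B)
    (hB₂.trans hB.symm) (hB₂.trans hB.symm) (by rw [Finset.inter_self, Finset.inter_self, hB₂, hB])
  have hρ₂' := hρ.map hA₂ hB₂ hρ₂ σ
  have hτ₂' := hτ.map hB₂ hC₂ hτ₂ σ
  have hr' : (A ∩ C).card ≤ (A₂.map σ.toEmbedding ∩ C₂.map σ.toEmbedding).card := by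
    rwa [← Finset.map_inter, Finset.card_map]
  rw [hσ] at hρ₂' hτ₂'
  have hA₂' : (A₂.map σ.toEmbedding).card = a := by simpa
  have hC₂' : (C₂.map σ.toEmbedding).card = c := by simpa
  generalize A₂.map σ.toEmbedding = A₂' at *
  generalize C₂.map σ.toEmbedding = C₂' at *
  have hmid : ∃ D E : Finset α, D.card = a ∧ E.card = c ∧ ρ D B ∧ τ B E ∧
      (D ∩ E).card = (A ∩ C).card := by
    by_cases hcase : (A ∩ C).card ≤ (A₂' ∩ C₁).card
    · obtain ⟨D, hD, hDk, hD1, hD2⟩ := exists_intermediate (B := B) (hA₁.trans hA₂'.symm) hl hcase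
      exact ⟨D, C₁, hD.trans hA₁, hC₁,
        hρ.between (hD.trans hA₁) hB hA₁ hB hA₂' hB hρ₁ hρ₂' hD1 hD2, hτ₁, hDk⟩
    · have h1 : (C₁ ∩ A₂').card ≤ (A ∩ C).card := by rw [Finset.inter_comm]; omega
      have h2 : (A ∩ C).card ≤ (C₂' ∩ A₂').card := by rwa [Finset.inter_comm C₂']
      obtain ⟨E, hE, hEk, hE1, hE2⟩ := exists_intermediate (B := B) (hC₁.trans hC₂'.symm) h1 h2
      rw [Finset.inter_comm _ B, Finset.inter_comm _ B, Finset.inter_comm _ B] at hE1 hE2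
      exact ⟨A₂', E, hA₂', hE.trans hC₁, hρ₂',
        hτ.between hB (hE.trans hC₁) hB hC₁ hB hC₂' hτ₁ hτ₂' hE1 hE2,
        by rw [Finset.inter_comm, hEk]⟩
  obtain ⟨D, E, hD, hE, hρD, hτE, hDE⟩ := hmid
  obtain ⟨π, hπD, hπE⟩ := exists_perm_map_eq (hD.trans hA.symm) (hE.trans hC.symm) hDE
  refine ⟨B.map π.toEmbedding, by simpa, ?_, ?_⟩
  · rw [← hπD]; exact hρ.map hD hB hρD π
  · rw [← hπE]; exact hτ.map hB hE hτE π

end Exchange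

/-! ### Rings of fans -/

/-- Vertex weights on a fan: a path `l - a - b - r` together with a vertex `y` joined to all of it.
If `long` is false then only the path `l - y - r` is meant to be present (so `a = b = 0`). -/
structure FanWeight where
  /-- weight of the first vertex of the path -/
  l : ℕ
  /-- weight of the second vertex of the path -/
  a : ℕ
  /-- weight of the third vertex of the path -/
  b : ℕ
  /-- weight of the last vertex of the path -/
  r : ℕ
  /-- weight of the apex -/
  y : ℕ
  /-- whether the inner vertices of the path are present -/
  long : Bool

namespace FanWeight

variable {s : ℕ}

/-- The total weight of a fan. -/
def total (β : FanWeight) : ℕ := β.l + β.a + β.b + β.r + β.y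

/-- The number of vertices of a longest induced path from one end of the fan to the other. -/
def size (β : FanWeight) : ℕ := if β.long then 4 else 3

/-- The clique inequalities for weights on a fan, with `s` colours. -/
def CliqueLe (s : ℕ) (β : FanWeight) : Prop :=
  β.l + β.a + β.y ≤ s ∧ β.a + β.b + β.y ≤ s ∧ β.b + β.r + β.y ≤ s ∧
    (β.long = false → β.a = 0 ∧ β.b = 0)

/-- The colour sets `L` and `R` of the ends of the path extend to a weighted colouring of the
fan. -/
def Extends (β : FanWeight) (L R : Finset (Fin s)) : Prop :=
  L.card = β.l ∧ R.card = β.r ∧ ∃ A B Y : Finset (Fin s), A.card = β.a ∧ B.card = β.b ∧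
    Y.card = β.y ∧ Disjoint L A ∧ Disjoint A B ∧ Disjoint B R ∧ Disjoint Y L ∧ Disjoint Y A ∧
    Disjoint Y B ∧ Disjoint Y R

/-- Two finite sets contain disjoint subsets of prescribed sizes as soon as Hall's condition
holds. -/
theorem exists_disjoint_subsets {α : Type*} [DecidableEq α] {P Q : Finset α} {a b : ℕ}
    (ha : a ≤ P.card) (hb : b ≤ Q.card) (hab : a + b ≤ (P ∪ Q).card) :
    ∃ A ⊆ P, ∃ B ⊆ Q, A.card = a ∧ B.card = b ∧ Disjoint A B := by
  by_cases h : a ≤ (P \ Q).card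
  · obtain ⟨A, hA, hAc⟩ := Finset.exists_subset_card_eq h
    obtain ⟨B, hB, hBc⟩ := Finset.exists_subset_card_eq hb
    exact ⟨A, hA.trans Finset.sdiff_subset, B, hB, hAc, hBc,
      Finset.sdiff_disjoint.mono hA hB⟩
  · obtain ⟨A, hA1, hA2, hAc⟩ := Finset.exists_subsuperset_card_eq
      (Finset.sdiff_subset (s := P) (t := Q)) (not_le.1 h).le ha
    have hcard : b ≤ (Q \ A).card := by
      have h1 : P ∪ Q ⊆ A ∪ (Q \ A) := by
        intro x hx
        by_cases hxA : x ∈ A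
        · exact Finset.mem_union_left _ hxA
        · refine Finset.mem_union_right _ (Finset.mem_sdiff.2 ⟨?_, hxA⟩)
          by_contra hxQ
          exact hxA (hA1 (Finset.mem_sdiff.2 ⟨(Finset.mem_union.1 hx).resolve_right hxQ, hxQ⟩))
      have h2 := Finset.card_le_card h1
      have h3 := Finset.card_union_le A (Q \ A)
      omega
    obtain ⟨B, hB, hBc⟩ := Finset.exists_subset_card_eq hcard
    exact ⟨A, hA2, B, hB.trans Finset.sdiff_subset, hAc, hBc,
      Finset.disjoint_sdiff.mono_right hB⟩

/-- Whether a colouring extends from the ends of a fan to the fan depends on the number of colours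
that the two ends share: the apex needs it to be large, and the path needs it to be small. -/
theorem extends_iff (β : FanWeight) (L R : Finset (Fin s)) :
    β.Extends L R ↔ L.card = β.l ∧ R.card = β.r ∧ β.l + β.a + β.y ≤ s ∧ β.a + β.b + β.y ≤ s ∧
      β.b + β.r + β.y ≤ s ∧ β.l + β.r + β.y ≤ s + (L ∩ R).card ∧
      (L ∩ R).card + β.a + β.b + β.y ≤ s := by
  have hle : ∀ T : Finset (Fin s), T.card ≤ s := fun T => by simpa using Finset.card_le_univ T
  have hLR := Finset.card_union_add_card_inter L R
  constructor
  · rintro ⟨hL, hR, A, B, Y, hA, hB, hY, hLA, hAB, hBR, hYL, hYA, hYB, hYR⟩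
    have three : ∀ S T U : Finset (Fin s), Disjoint S T → Disjoint U S → Disjoint U T →
        S.card + T.card + U.card ≤ s := by
      intro S T U h1 h2 h3
      rw [← Finset.card_union_of_disjoint h1, ← Finset.card_union_of_disjoint
        (Finset.disjoint_union_left.2 ⟨h2.symm, h3.symm⟩)]
      exact hle _
    have e1 := three L A Y hLA hYL hYA
    have e2 := three A B Y hAB hYA hYB
    have e3 := three B R Y hBR hYB hYR
    have e4 : (L ∪ R).card + Y.card ≤ s := by
      rw [← Finset.card_union_of_disjoint (Finset.disjoint_union_left.2 ⟨hYL.symm, hYR.symm⟩)]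
      exact hle _
    have e5 := three (L ∩ R) (A ∪ B) Y (Finset.disjoint_union_right.2
      ⟨hLA.mono_left Finset.inter_subset_left, hBR.symm.mono_left Finset.inter_subset_right⟩)
      (hYL.mono_right Finset.inter_subset_left) (Finset.disjoint_union_right.2 ⟨hYA, hYB⟩)
    rw [Finset.card_union_of_disjoint hAB] at e5
    refine ⟨hL, hR, ?_, ?_, ?_, ?_, ?_⟩ <;> omega
  · rintro ⟨hL, hR, h1, h2, h3, h4, h5⟩
    have hc : ∀ T : Finset (Fin s), Tᶜ.card + T.card = s := fun T => by
      simp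
    have c1 := hc (L ∪ R)
    obtain ⟨Y, hYs, hY⟩ := Finset.exists_subset_card_eq (show β.y ≤ (L ∪ R)ᶜ.card by omega)
    have hYLR : Disjoint Y (L ∪ R) := (disjoint_compl_left (a := L ∪ R)).mono_left hYs
    rw [Finset.disjoint_union_right] at hYLR
    have c2 := hc (Y ∪ L)
    have c3 := hc (Y ∪ R)
    rw [Finset.card_union_of_disjoint hYLR.1] at c2
    rw [Finset.card_union_of_disjoint hYLR.2] at c3
    have c4 := hc (Y ∪ (L ∩ R))
    rw [Finset.card_union_of_disjoint (hYLR.1.mono_right Finset.inter_subset_left)] at c4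
    have hU : (Y ∪ L)ᶜ ∪ (Y ∪ R)ᶜ = (Y ∪ (L ∩ R))ᶜ := by
      ext; simp only [Finset.mem_union, Finset.mem_compl, Finset.mem_inter]; tauto
    obtain ⟨A, hA, B, hB, hAc, hBc, hAB⟩ := exists_disjoint_subsets (P := (Y ∪ L)ᶜ)
      (Q := (Y ∪ R)ᶜ) (a := β.a) (b := β.b) (by omega) (by omega) (by rw [hU]; omega)
    have hA' := (disjoint_compl_left (a := Y ∪ L)).mono_left hA
    have hB' := (disjoint_compl_left (a := Y ∪ R)).mono_left hB
    rw [Finset.disjoint_union_right] at hA' hB'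
    exact ⟨hL, hR, A, B, Y, hAc, hBc, hY, hA'.2.symm, hAB, hB'.2, hYLR.1, hA'.1.symm, hB'.1.symm,
      hYLR.2⟩

theorem convexRel_extends (β : FanWeight) :
    ConvexRel β.l β.r (β.Extends : Finset (Fin s) → Finset (Fin s) → Prop) := by
  intro A B A₁ B₁ A₂ B₂ hA hB hA₁ hB₁ hA₂ hB₂ h₁ h₂ hl hr
  rw [extends_iff] at h₁ h₂ ⊢
  omega

/-- A long fan turned into a path, by moving the weight of the apex to the second vertex. -/
def flatten (β : FanWeight) : FanWeight :=
  if β.long then { β with a := β.a + β.y, y := 0 } else β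

/-- A fan with the weight of the second vertex of its path lowered by one. -/
def lower (β : FanWeight) : FanWeight := { β with a := β.a - 1 }

theorem flatten_of_long {β : FanWeight} (h : β.long = true) :
    β.flatten = { β with a := β.a + β.y, y := 0 } := by simp [flatten, h]

theorem flatten_of_apex_eq_zero {β : FanWeight} (h : β.y = 0) : β.flatten = β := by
  unfold flatten
  split_ifs
  · cases β; simp_all
  · rfl

theorem flatten_of_short {β : FanWeight} (h : β.long = false) : β.flatten = β := by
  simp [flatten, h]

theorem Extends.flatten {β : FanWeight} {L R : Finset (Fin s)} (h : β.Extends L R) :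
    β.flatten.Extends L R := by
  by_cases hl : β.long = true
  · rw [extends_iff] at h ⊢
    rw [flatten_of_long hl]
    dsimp only
    have := Finset.card_union_add_card_inter L R
    have h2 : (L ∪ R).card ≤ s := by simpa using Finset.card_le_univ (L ∪ R)
    omega
  · rwa [flatten_of_short (by simpa using hl)]

/-- `links bs Z X`: the colour sets `Z` and `X` extend to a weighted colouring of the chain in which
consecutive fans of the list `bs` are joined by an edge, as are `Z` and the first fan, and the last
fan and `X`. -/
def links : List FanWeight → Finset (Fin s) → Finset (Fin s) → Prop
  | [], Z, X => Disjoint Z X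
  | β :: bs, Z, X => ∃ L R, Disjoint Z L ∧ β.Extends L R ∧ links bs R X

/-- The closed ring of fans `γ, bs` has a weighted colouring with `s` colours. -/
def RingColorable (s : ℕ) (γ : FanWeight) (bs : List FanWeight) : Prop :=
  ∃ L R : Finset (Fin s), γ.Extends L R ∧ links bs R L

theorem links_append_cons (bs₁ bs₂ : List FanWeight) (β : FanWeight) (Z X : Finset (Fin s)) :
    links (bs₁ ++ β :: bs₂) Z X ↔
      ∃ L R, links bs₁ Z L ∧ β.Extends L R ∧ links bs₂ R X := by
  induction bs₁ generalizing Z with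
  | nil => rfl
  | cons γ bs₁ ih =>
    simp only [List.cons_append, links, ih]
    constructor
    · rintro ⟨L, R, h1, h2, L', R', h3, h4, h5⟩
      exact ⟨L', R', ⟨L, R, h1, h2, h3⟩, h4, h5⟩
    · rintro ⟨L', R', ⟨L, R, h1, h2, h3⟩, h4, h5⟩
      exact ⟨L, R, h1, h2, L', R', h3, h4, h5⟩

theorem ringColorable_append_cons (γ β : FanWeight) (bs₁ bs₂ : List FanWeight) :
    RingColorable s γ (bs₁ ++ β :: bs₂) ↔
      ∃ L R : Finset (Fin s), β.Extends L R ∧ links (bs₂ ++ γ :: bs₁) R L := by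
  unfold RingColorable
  simp only [links_append_cons]
  constructor
  · rintro ⟨L, R, h1, L', R', h2, h3, h4⟩
    exact ⟨L', R', h3, L, R, h4, h1, h2⟩
  · rintro ⟨L', R', h3, L, R, h4, h1, h2⟩
    exact ⟨L, R, h1, L', R', h2, h3, h4⟩

theorem convexRel_links (bs : List FanWeight) (a c : ℕ) :
    ConvexRel a c (links bs : Finset (Fin s) → Finset (Fin s) → Prop) := by
  have hdis : ∀ a c, ConvexRel a c
      (Disjoint : Finset (Fin s) → Finset (Fin s) → Prop) := by
    intro a c A B A₁ B₁ A₂ B₂ _ _ _ _ _ _ _ h₂ _ hr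
    rw [Finset.disjoint_iff_inter_eq_empty] at h₂ ⊢
    rw [h₂, Finset.card_empty, Nat.le_zero, Finset.card_eq_zero] at hr
    exact hr
  induction bs generalizing a with
  | nil => exact hdis a c
  | cons β bs ih =>
    have key := (hdis a β.l).comp (β.convexRel_extends.comp (ih β.r))
    have e : (links (β :: bs) : Finset (Fin s) → Finset (Fin s) → Prop) = fun Z X =>
        ∃ L : Finset (Fin s), L.card = β.l ∧ Disjoint Z L ∧
          ∃ R : Finset (Fin s), R.card = β.r ∧ β.Extends L R ∧ links bs R X := by
      funext Z X
      refine propext ⟨?_, ?_⟩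
      · rintro ⟨L, R, h1, h2, h3⟩
        exact ⟨L, h2.1, h1, R, h2.2.1, h2, h3⟩
      · rintro ⟨L, -, h1, R, -, h2, h3⟩
        exact ⟨L, R, h1, h2, h3⟩
    rw [e]
    exact key

theorem links_map_flatten {bs : List FanWeight} {Z X : Finset (Fin s)} (h : links bs Z X) :
    links (bs.map flatten) Z X := by
  induction bs generalizing Z with
  | nil => exact h
  | cons β bs ih =>
    obtain ⟨L, R, h1, h2, h3⟩ := h
    exact ⟨L, R, h1, h2.flatten, ih h3⟩

/-- The exchange step. If a ring of fans becomes colourable both when one fan is flattened and when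
the second vertex of that fan loses one unit of weight, then it is colourable. In the two colourings
the ends of the fan share, respectively, not too many and almost not too many colours; as the rest
of the ring is a convex relation, a colouring with an admissible number in between exists. -/
theorem ringColorable_of_flatten_of_lower {γ β : FanWeight} {bs₁ bs₂ : List FanWeight}
    (hlong : β.long = true) (hβ : β.CliqueLe s)
    (hlow : RingColorable s γ (bs₁ ++ β.lower :: bs₂))
    (hflat : RingColorable s γ (bs₁ ++ β.flatten :: bs₂)) :
    RingColorable s γ (bs₁ ++ β :: bs₂) := by
  rw [ringColorable_append_cons] at hlow hflat ⊢
  obtain ⟨L₁, R₁, hE₁, hk₁⟩ := hflat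
  obtain ⟨L₂, R₂, hE₂, hk₂⟩ := hlow
  rw [extends_iff] at hE₁ hE₂
  rw [flatten_of_long hlong] at hE₁
  simp only [lower] at hE₁ hE₂
  obtain ⟨hc1, hc2, hc3, -⟩ := hβ
  by_cases h1 : β.l + β.r + β.y ≤ s + (L₁ ∩ R₁).card
  · exact ⟨L₁, R₁, (extends_iff _ _ _).2 (by omega), hk₁⟩
  by_cases h2 : (L₂ ∩ R₂).card + β.a + β.b + β.y ≤ s
  · exact ⟨L₂, R₂, (extends_iff _ _ _).2 (by omega), hk₂⟩
  obtain ⟨σ, hσ, -⟩ := exists_perm_map_eq (A := L₂) (B := L₂) (A' := L₁) (B' := L₁)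
    (by omega) (by omega) (by simp only [Finset.inter_self]; omega)
  have hk₂' : (R₂.map σ.toEmbedding ∩ L₁).card = (L₂ ∩ R₂).card := by
    rw [← hσ, ← Finset.map_inter, Finset.card_map, Finset.inter_comm]
  have hk₁' : (R₁ ∩ L₁).card = (L₁ ∩ R₁).card := by rw [Finset.inter_comm]
  obtain ⟨D, hD, hDk, -⟩ := exists_intermediate (A := R₁) (A' := R₂.map σ.toEmbedding) (B := ∅)
    (C := L₁) (k := β.l + β.r + β.y - s) (by rw [Finset.card_map]; omega) (by omega) (by omega)
  have hDk' : (L₁ ∩ D).card = β.l + β.r + β.y - s := by rw [Finset.inter_comm, hDk]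
  refine ⟨L₁, D, (extends_iff _ _ _).2 (by omega), ?_⟩
  refine convexRel_links (bs₂ ++ γ :: bs₁) β.r β.l D L₁ R₁ L₁ R₂ L₂ (by omega) (by omega) (by omega)
    (by omega) (by omega) (by omega) hk₁ hk₂ (by omega) ?_
  rw [Finset.inter_comm R₂]
  omega

/-- If lowering the weight of the second vertex of any long fan with an apex makes a ring
colourable, then the ring is colourable as soon as it is so after flattening all its long fans. -/
theorem ringColorable_of_map_flatten {γ : FanWeight} {bs : List FanWeight}
    (hβ : ∀ β ∈ bs, β.CliqueLe s)
    (hlow : ∀ bs₁ β bs₂, bs = bs₁ ++ β :: bs₂ → β.long = true → 0 < β.y →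
      RingColorable s γ (bs₁ ++ β.lower :: bs₂))
    (hflat : RingColorable s γ (bs.map flatten)) : RingColorable s γ bs := by
  have key : ∀ bs₂ bs₁, bs = bs₁ ++ bs₂ → RingColorable s γ (bs₁ ++ bs₂.map flatten) →
      RingColorable s γ bs := by
    intro bs₂
    induction bs₂ with
    | nil => intro bs₁ h hr; rw [h]; simpa using hr
    | cons β bs₂ ih =>
      intro bs₁ h hr
      refine ih (bs₁ ++ [β]) (by simpa using h) ?_
      rw [List.append_assoc, List.singleton_append]
      rw [List.map_cons] at hr
      rcases Nat.eq_zero_or_pos β.y with hy | hy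
      · rwa [flatten_of_apex_eq_zero hy] at hr
      by_cases hl : β.long = true
      · refine ringColorable_of_flatten_of_lower hl (hβ β (by simp [h])) ?_ hr
        obtain ⟨L, R, h1, h2⟩ := hlow bs₁ β bs₂ h hl hy
        rw [links_append_cons] at h2
        obtain ⟨L', R', h3, h4, h5⟩ := h2
        exact ⟨L, R, h1, (links_append_cons _ _ _ _ _).2 ⟨L', R', h3, h4, links_map_flatten h5⟩⟩
      · rwa [flatten_of_short (by simpa using hl)] at hr
  exact key bs [] rfl hflat

end FanWeight

/-! ### Colouring a weighted cycle by arcs -/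

section Arc

variable {s : ℕ} [NeZero s]

/-- The arc of `k` consecutive colours starting at `p`, for colours arranged in a circle. -/
def colorArc (s : ℕ) [NeZero s] (p k : ℕ) : Finset (Fin s) :=
  (Finset.range k).image fun i => Fin.ofNat s (p + i)

theorem card_colorArc {p k : ℕ} (hk : k ≤ s) : (colorArc s p k).card = k := by
  unfold colorArc
  rw [Finset.card_image_of_injOn, Finset.card_range]
  intro i hi j hj hij
  rw [Finset.coe_range, Set.mem_Iio] at hi hj
  have h : (p + i) % s = (p + j) % s := congrArg Fin.val hij
  have := Nat.ModEq.add_left_cancel' p h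
  exact Nat.ModEq.eq_of_lt_of_lt this (by omega) (by omega)

theorem disjoint_colorArc {p k d k' : ℕ} (h1 : k ≤ d) (h2 : d + k' ≤ s) :
    Disjoint (colorArc s p k) (colorArc s (p + d) k') := by
  rw [Finset.disjoint_left]
  intro x hx hx'
  obtain ⟨i, hi, rfl⟩ := Finset.mem_image.1 hx
  obtain ⟨j, hj, hij⟩ := Finset.mem_image.1 hx'
  rw [Finset.mem_range] at hi hj
  have h : (p + (d + j)) % s = (p + i) % s := by
    rw [← add_assoc]; exact congrArg Fin.val hij
  have h' := Nat.ModEq.eq_of_lt_of_lt (Nat.ModEq.add_left_cancel' p h) (by omega) (by omega)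
  omega

theorem colorArc_add_mul (p k M : ℕ) : colorArc s (p + M * s) k = colorArc s p k := by
  unfold colorArc
  congr 1
  funext i
  apply Fin.ext
  simp only [Fin.ofNat]
  rw [show p + M * s + i = p + i + M * s by ring, Nat.add_mul_mod_self_right]

namespace FanWeight

theorem extends_colorArc {β : FanWeight} (hβ : β.CliqueLe s) (hy : β.long = true → β.y = 0)
    {p d : ℕ} (h1 : β.l + β.a + β.b + β.y ≤ d)
    (h2 : d + (β.a + β.b + β.y + β.r) + s ≤ β.size * s) :
    β.Extends (colorArc s p β.l) (colorArc s (p + d) β.r) := by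
  obtain ⟨c1, c2, c3, c4⟩ := hβ
  by_cases hl : β.long = true
  · have hy := hy hl
    rw [size, if_pos hl] at h2
    obtain ⟨d₁, d₂, d₃, rfl, e1, e2, e3, e4, e5, e6⟩ : ∃ d₁ d₂ d₃, d = d₁ + d₂ + d₃ ∧
        β.l ≤ d₁ ∧ d₁ + β.a ≤ s ∧ β.a ≤ d₂ ∧ d₂ + β.b ≤ s ∧ β.b ≤ d₃ ∧ d₃ + β.r ≤ s := by
      refine ⟨min (s - β.a) (d - β.a - β.b),
        min (s - β.b) (d - min (s - β.a) (d - β.a - β.b) - β.b),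
        d - min (s - β.a) (d - β.a - β.b)
          - min (s - β.b) (d - min (s - β.a) (d - β.a - β.b) - β.b), ?_⟩
      omega
    refine ⟨card_colorArc (by omega), card_colorArc (by omega), colorArc s (p + d₁) β.a,
      colorArc s (p + d₁ + d₂) β.b, ∅, card_colorArc (by omega), card_colorArc (by omega),
      by simp [hy], disjoint_colorArc e1 e2, disjoint_colorArc e3 e4, ?_, by simp, by simp,
      by simp, by simp⟩
    rw [← add_assoc, ← add_assoc]
    exact disjoint_colorArc e5 e6
  · obtain ⟨ha, hb⟩ := c4 (by simpa using hl)
    rw [size, if_neg hl] at h2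
    obtain ⟨d₁, d₂, rfl, e1, e2, e3, e4⟩ : ∃ d₁ d₂, d = d₁ + d₂ ∧
        β.l ≤ d₁ ∧ d₁ + β.y ≤ s ∧ β.y ≤ d₂ ∧ d₂ + β.r ≤ s :=
      ⟨min (s - β.y) (d - β.y), d - min (s - β.y) (d - β.y), by omega⟩
    refine ⟨card_colorArc (by omega), card_colorArc (by omega), ∅, ∅, colorArc s (p + d₁) β.y,
      by simp [ha], by simp [hb], card_colorArc (by omega), by simp, by simp, by simp,
      (disjoint_colorArc e1 e2).symm, by simp, by simp, ?_⟩
    rw [← add_assoc]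
    exact disjoint_colorArc e3 e4

/-- The edge and triangle inequalities along a chain of fans between vertices of weight `z` and
`x`. -/
def ChainLe (s : ℕ) : ℕ → List FanWeight → ℕ → Prop
  | z, [], x => z + x ≤ s
  | z, β :: bs, x => z + β.l ≤ s ∧ β.CliqueLe s ∧ ChainLe s β.r bs x

omit [NeZero s] in
theorem ChainLe.two_mul_total_le {z x : ℕ} {bs : List FanWeight} (h : ChainLe s z bs x) :
    z + x + 2 * (bs.map total).sum ≤ s + (bs.map fun β => β.size * s).sum := by
  induction bs generalizing z with
  | nil => simpa [ChainLe] using h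
  | cons β bs ih =>
    obtain ⟨h1, ⟨c1, c2, c3, c4⟩, h3⟩ := h
    have := ih h3
    simp only [List.map_cons, List.sum_cons, total]
    by_cases hl : β.long = true
    · rw [size, if_pos hl]; omega
    · have := c4 (by simpa using hl)
      rw [size, if_neg hl]; omega

theorem links_colorArc {z x p d : ℕ} {bs : List FanWeight} (h : ChainLe s z bs x)
    (hy : ∀ β ∈ bs, β.long = true → β.y = 0) (h1 : z + (bs.map total).sum ≤ d)
    (h2 : d + x + (bs.map total).sum ≤ s + (bs.map fun β => β.size * s).sum) :
    links bs (colorArc s p z) (colorArc s (p + d) x) := by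
  induction bs generalizing z p d with
  | nil =>
    simp only [List.map_nil, List.sum_nil] at h1 h2
    exact disjoint_colorArc (by omega) (by omega)
  | cons β bs ih =>
    obtain ⟨g1, hβ, g3⟩ := h
    have htot := g3.two_mul_total_le
    simp only [List.map_cons, List.sum_cons, total] at h1 h2
    have hβ' := hβ
    obtain ⟨c1, c2, c3, c4⟩ := hβ'
    have hsize : 2 * (β.a + β.b + β.y) + β.l + β.r + s ≤ β.size * s := by
      by_cases hl : β.long = true
      · rw [size, if_pos hl]; omega
      · have := c4 (by simpa using hl)
        rw [size, if_neg hl]; omega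
    generalize hS : β.size * s = S at *
    generalize (bs.map fun β => β.size * s).sum = U at *
    generalize hT : (bs.map total).sum = T at *
    obtain ⟨d₀, d₁, d₂, rfl, e1, e2, e3, e4, e5, e6⟩ : ∃ d₀ d₁ d₂, d = d₀ + d₁ + d₂ ∧
        z ≤ d₀ ∧ d₀ + β.l ≤ s ∧ β.l + β.a + β.b + β.y ≤ d₁ ∧
        d₁ + (β.a + β.b + β.y + β.r) + s ≤ S ∧ β.r + T ≤ d₂ ∧ d₂ + x + T ≤ s + U := by
      have hd : z + (β.l + β.a + β.b + β.y) + (β.r + T) ≤ d := by omega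
      refine ⟨min (s - β.l) (d - (β.l + β.a + β.b + β.y) - (β.r + T)),
        min (S - s - (β.a + β.b + β.y + β.r))
          (d - min (s - β.l) (d - (β.l + β.a + β.b + β.y) - (β.r + T)) - (β.r + T)),
        d - min (s - β.l) (d - (β.l + β.a + β.b + β.y) - (β.r + T))
          - min (S - s - (β.a + β.b + β.y + β.r))
          (d - min (s - β.l) (d - (β.l + β.a + β.b + β.y) - (β.r + T)) - (β.r + T)), ?_⟩
      omega
    refine ⟨colorArc s (p + d₀) β.l, colorArc s (p + d₀ + d₁) β.r, disjoint_colorArc e1 e2,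
      extends_colorArc hβ (hy β (by simp)) e3 (by rw [hS]; omega), ?_⟩
    rw [← add_assoc, ← add_assoc]
    exact ih g3 (fun β hβ => hy β (by simp [hβ])) e5 e6

/-- Going once round a ring of paths, an arc of colours can be advanced by any amount between the
total weight `W` and `N * s - W`, where `N` is the length of the ring. If this range contains a
multiple of `s` then the colouring closes up. -/
theorem ringColorable_of_arcs {γ : FanWeight} {bs : List FanWeight} (hγ : γ.CliqueLe s)
    (hc : ChainLe s γ.r bs γ.l) (hγy : γ.long = true → γ.y = 0)
    (hy : ∀ β ∈ bs, β.long = true → β.y = 0) (M : ℕ)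
    (h1 : γ.total + (bs.map total).sum ≤ M * s)
    (h2 : M * s + γ.total + (bs.map total).sum ≤
      γ.size * s + (bs.map fun β => β.size * s).sum) : RingColorable s γ bs := by
  have htot := hc.two_mul_total_le
  have hγ' := hγ
  obtain ⟨c1, c2, c3, c4⟩ := hγ'
  have hsize : 2 * (γ.a + γ.b + γ.y) + γ.l + γ.r + s ≤ γ.size * s := by
    by_cases hl : γ.long = true
    · rw [size, if_pos hl]; omega
    · have := c4 (by simpa using hl)
      rw [size, if_neg hl]; omega
  simp only [total] at h1 h2
  generalize hS : γ.size * s = S at *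
  generalize hU : (bs.map fun β => β.size * s).sum = U at *
  generalize hT : (bs.map total).sum = T at *
  -- The advance `M * s` is shared between the fan `γ` and the chain `bs`, taking for `γ` as much as
  -- possible.
  obtain ⟨d₁, d₂, hd, e1, e2, e3, e4⟩ : ∃ d₁ d₂, M * s = d₁ + d₂ ∧
      γ.l + γ.a + γ.b + γ.y ≤ d₁ ∧ d₁ + (γ.a + γ.b + γ.y + γ.r) + s ≤ S ∧
      γ.r + T ≤ d₂ ∧ d₂ + γ.l + T ≤ s + U :=
    ⟨min (S - s - (γ.a + γ.b + γ.y + γ.r)) (M * s - (γ.r + T)),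
      M * s - min (S - s - (γ.a + γ.b + γ.y + γ.r)) (M * s - (γ.r + T)), by omega⟩
  refine ⟨colorArc s 0 γ.l, colorArc s (0 + d₁) γ.r, extends_colorArc hγ hγy e1 (by omega), ?_⟩
  rw [← colorArc_add_mul 0 γ.l M, hd, ← add_assoc]
  exact links_colorArc hc hy (by omega) (by omega)

omit [NeZero s] in
theorem total_flatten (β : FanWeight) : β.flatten.total = β.total := by
  by_cases hl : β.long = true
  · rw [flatten_of_long hl]; simp only [total]; omega
  · rw [flatten_of_short (by simpa using hl)]

omit [NeZero s] in
theorem size_flatten (β : FanWeight) : β.flatten.size = β.size := by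
  by_cases hl : β.long = true
  · rw [flatten_of_long hl]; simp [size]
  · rw [flatten_of_short (by simpa using hl)]

omit [NeZero s] in
theorem ChainLe.map_flatten {z x : ℕ} {bs : List FanWeight} (h : ChainLe s z bs x) :
    ChainLe s z (bs.map flatten) x := by
  induction bs generalizing z with
  | nil => exact h
  | cons β bs ih =>
    obtain ⟨h1, h2, h3⟩ := h
    by_cases hl : β.long = true
    · rw [List.map_cons, flatten_of_long hl]
      obtain ⟨c1, c2, c3, c4⟩ := h2
      exact ⟨h1, ⟨by dsimp only; omega, by dsimp only; omega, by dsimp only; omega,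
        fun h => by simp [hl] at h⟩, ih h3⟩
    · rw [List.map_cons, flatten_of_short (by simpa using hl)]
      exact ⟨h1, h2, ih h3⟩

omit [NeZero s] in
theorem ChainLe.cliqueLe {z x : ℕ} {bs : List FanWeight} (h : ChainLe s z bs x) :
    ∀ β ∈ bs, β.CliqueLe s := by
  induction bs generalizing z with
  | nil => simp
  | cons β bs ih =>
    intro β' hβ'
    rcases List.mem_cons.1 hβ' with rfl | hm
    · exact h.2.1
    · exact ih h.2.2 β' hm

omit [NeZero s] in
theorem sum_size_mul (γ : FanWeight) (bs : List FanWeight) :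
    γ.size * s + (bs.map fun β => β.size * s).sum = (γ.size + (bs.map size).sum) * s := by
  rw [add_mul, List.sum_map_mul_right]

omit [NeZero s] in
/-- Adding up the edge inequalities around a ring bounds its total weight. -/
theorem two_mul_total_le_of_ring {γ : FanWeight} {bs : List FanWeight}
    (hγ : γ.CliqueLe s) (hγl : γ.long = false) (hc : ChainLe s γ.r bs γ.l) :
    2 * (γ.total + (bs.map total).sum) ≤ (γ.size + (bs.map size).sum) * s := by
  have htot := hc.two_mul_total_le
  rw [← sum_size_mul]
  obtain ⟨c1, c2, c3, c4⟩ := hγ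
  have := c4 hγl
  rw [size, hγl, total]
  simp only [Bool.false_eq_true, if_false]
  omega

/-- If a ring of fans satisfying the clique inequalities is not colourable, but lowering the second
vertex of any long fan with an apex makes it so, then it is odd and violates the odd cycle
inequality, for the cycle through the paths of its long fans, in which the apices are included with
coefficient one. -/
theorem odd_and_lt_total_of_not_ringColorable {γ : FanWeight} {bs : List FanWeight}
    (hγ : γ.CliqueLe s) (hγl : γ.long = false) (hc : ChainLe s γ.r bs γ.l)
    (hlow : ∀ bs₁ β bs₂, bs = bs₁ ++ β :: bs₂ → β.long = true → 0 < β.y →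
      RingColorable s γ (bs₁ ++ β.lower :: bs₂))
    (hnot : ¬ RingColorable s γ bs) :
    Odd (γ.size + (bs.map size).sum) ∧
      (γ.size + (bs.map size).sum) / 2 * s < γ.total + (bs.map total).sum := by
  have hcap := sum_size_mul (s := s) γ bs
  have htot' := two_mul_total_le_of_ring hγ hγl hc
  have e1 : ((bs.map flatten).map total) = bs.map total := by
    rw [List.map_map]; exact List.map_congr_left fun β _ => total_flatten β
  have e2 : ((bs.map flatten).map fun β => β.size * s) = bs.map fun β => β.size * s := by
    rw [List.map_map]; exact List.map_congr_left fun β _ => by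
      simp only [Function.comp_apply, size_flatten]
  have hM : ∀ M, γ.total + (bs.map total).sum ≤ M * s →
      M * s + γ.total + (bs.map total).sum ≤ (γ.size + (bs.map size).sum) * s → False := by
    intro M h1 h2
    refine hnot (ringColorable_of_map_flatten hc.cliqueLe hlow ?_)
    refine ringColorable_of_arcs hγ hc.map_flatten (by simp [hγl]) ?_ M (by rwa [e1])
      (by rw [e1, e2, hcap]; exact h2)
    intro β hβ hl
    obtain ⟨β', -, rfl⟩ := List.mem_map.1 hβ
    by_cases hl' : β'.long = true
    · rw [flatten_of_long hl']
    · rw [flatten_of_short (by simpa using hl')] at hl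
      exact absurd hl hl'
  generalize γ.size + (bs.map size).sum = N at *
  generalize (bs.map total).sum = T at *
  constructor
  · by_contra hN
    obtain ⟨M, rfl⟩ := Nat.not_odd_iff_even.1 hN
    rw [add_mul] at htot' hM
    exact hM M (by omega) (by omega)
  · by_contra! hle
    refine hM (N / 2) hle ?_
    have h1 : (N / 2 + N / 2) * s ≤ N * s := Nat.mul_le_mul_right s (by omega)
    rw [add_mul] at h1
    omega

end FanWeight

end Arc

open FanWeight

/-! ### The graph `H_t` as a ring of fans -/

section Coordinates

variable {t : ℕ} {α : Type*}

/-- The value of a function on the vertices of `H_t` at the cycle vertex number `j`, counted from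
`0`; it is a default value if there is no such vertex. -/
def xValue [Inhabited α] (f : Fin (hCycleLength t) ⊕ Fin t → α) (j : ℕ) : α :=
  if h : j < hCycleLength t then f (Sum.inl ⟨j, h⟩) else default

/-- The value of a function on the vertices of `H_t` at the vertex `y` number `i`, counted from
`0`; it is a default value if there is no such vertex. -/
def yValue [Inhabited α] (f : Fin (hCycleLength t) ⊕ Fin t → α) (i : ℕ) : α :=
  if h : i < t then f (Sum.inr ⟨i, h⟩) else default

theorem xValue_of_lt [Inhabited α] (f : Fin (hCycleLength t) ⊕ Fin t → α) {j : ℕ}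
    (h : j < hCycleLength t) : xValue f j = f (Sum.inl ⟨j, h⟩) := dif_pos h

theorem yValue_of_lt [Inhabited α] (f : Fin (hCycleLength t) ⊕ Fin t → α) {i : ℕ}
    (h : i < t) : yValue f i = f (Sum.inr ⟨i, h⟩) := dif_pos h

theorem hCycleLength_one : hCycleLength 1 = 5 := rfl

theorem hCycleLength_add_two (m : ℕ) : hCycleLength (m + 2) = 4 * m + 7 := by
  simp only [hCycleLength]; rw [if_neg (by omega)]; omega

theorem five_le_hCycleLength (ht : 1 ≤ t) : 5 ≤ hCycleLength t := by
  unfold hCycleLength; split_ifs <;> omega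

theorem hJoined_iff (i j : ℕ) : HJoined (i + 1) (j + 1) ↔
    (i = 0 ∧ j ≤ 2) ∨ (1 ≤ i ∧ 4 * i ≤ j + 1 ∧ j ≤ 4 * i + 2) := by
  unfold HJoined; omega

theorem graphH_adj_inl_inl (ht : 1 ≤ t) {j k : ℕ} (hj : j < hCycleLength t)
    (hk : k < hCycleLength t) : (graphH t).Adj (Sum.inl ⟨j, hj⟩) (Sum.inl ⟨k, hk⟩) ↔
      j + 1 = k ∨ k + 1 = j ∨ (j = 0 ∧ k + 1 = hCycleLength t) ∨
        (k = 0 ∧ j + 1 = hCycleLength t) := by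
  change (SimpleGraph.cycleGraph (hCycleLength t)).Adj _ _ ↔ _
  have h5 := five_le_hCycleLength ht
  rw [SimpleGraph.cycleGraph_adj']
  rw [Fin.val_sub, Fin.val_sub]
  dsimp only
  have key : ∀ j k, j < hCycleLength t → k < hCycleLength t →
      ((hCycleLength t - k + j) % hCycleLength t = 1 ↔
        k + 1 = j ∨ (j = 0 ∧ k + 1 = hCycleLength t)) := by
    intro j k hj hk
    by_cases h : k ≤ j
    · rw [show hCycleLength t - k + j = (j - k) + hCycleLength t by omega, Nat.add_mod_right,
        Nat.mod_eq_of_lt (by omega)]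
      omega
    · rw [Nat.mod_eq_of_lt (by omega)]
      omega
  rw [key j k hj hk, key k j hk hj]
  tauto

theorem graphH_adj_inr_inl {i j : ℕ} (hi : i < t) (hj : j < hCycleLength t) :
    (graphH t).Adj (Sum.inr ⟨i, hi⟩) (Sum.inl ⟨j, hj⟩) ↔
      (i = 0 ∧ j ≤ 2) ∨ (1 ≤ i ∧ 4 * i ≤ j + 1 ∧ j ≤ 4 * i + 2) := hJoined_iff i j

theorem graphH_not_adj_inr_inr (i j : Fin t) : ¬ (graphH t).Adj (Sum.inr i) (Sum.inr j) := id

/-- Weighted colourability of `H_t` in coordinates. -/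
theorem weightColorable_graphH_iff (ht : 1 ≤ t) {s : ℕ}
    (w : Fin (hCycleLength t) ⊕ Fin t → ℕ) :
    (graphH t).WeightColorable s w ↔ ∃ CX CY : ℕ → Finset (Fin s),
      (∀ j < hCycleLength t, (CX j).card = xValue w j) ∧ (∀ i < t, (CY i).card = yValue w i) ∧
      (∀ j, j + 1 < hCycleLength t → Disjoint (CX j) (CX (j + 1))) ∧
      Disjoint (CX (hCycleLength t - 1)) (CX 0) ∧
      (∀ j ≤ 2, Disjoint (CY 0) (CX j)) ∧
      (∀ i j, i + 1 < t → j < 4 → Disjoint (CY (i + 1)) (CX (4 * i + 3 + j))) := by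
  have h5 := five_le_hCycleLength ht
  constructor
  · intro h
    obtain ⟨c, hc, hd⟩ := h.exists_card_eq
    have hx : ∀ j (h : j < hCycleLength t), xValue c j = c (Sum.inl ⟨j, h⟩) :=
      fun j h => xValue_of_lt c h
    have hy : ∀ i (h : i < t), yValue c i = c (Sum.inr ⟨i, h⟩) := fun i h => yValue_of_lt c h
    refine ⟨xValue c, yValue c, fun j h => ?_, fun i h => ?_, fun j h => ?_, ?_, fun j h => ?_,
      fun i j hi hj => ?_⟩
    · rw [hx j h, hc, xValue_of_lt w h]
    · rw [hy i h, hc, yValue_of_lt w h]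
    · rw [hx j (by omega), hx (j + 1) h]
      exact hd _ _ ((graphH_adj_inl_inl ht _ _).2 (by omega))
    · rw [hx _ (by omega), hx 0 (by omega)]
      exact hd _ _ ((graphH_adj_inl_inl ht _ _).2 (by omega))
    · rw [hy 0 (by omega), hx j (by omega)]
      exact hd _ _ ((graphH_adj_inr_inl _ _).2 (by omega))
    · obtain ⟨m, rfl⟩ : ∃ m, t = m + 2 := ⟨t - 2, by omega⟩
      have := hCycleLength_add_two m
      rw [hy (i + 1) hi, hx _ (by omega)]
      exact hd _ _ ((graphH_adj_inr_inl _ _).2 (by omega))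
  · rintro ⟨CX, CY, hx, hy, h1, h2, h3, h4⟩
    have hxx : ∀ j k, j < hCycleLength t → k < hCycleLength t →
        (j + 1 = k ∨ (k = 0 ∧ j + 1 = hCycleLength t)) → Disjoint (CX j) (CX k) := by
      rintro j k hj hk (rfl | ⟨rfl, h⟩)
      · exact h1 j hk
      · obtain rfl : j = hCycleLength t - 1 := by omega
        exact h2
    have hyx : ∀ i j, i < t → j < hCycleLength t → ((i = 0 ∧ j ≤ 2) ∨
        (1 ≤ i ∧ 4 * i ≤ j + 1 ∧ j ≤ 4 * i + 2)) → Disjoint (CY i) (CX j) := by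
      rintro i j hi hj (⟨rfl, h⟩ | ⟨h, h', h''⟩)
      · exact h3 j h
      · obtain ⟨i, rfl⟩ : ∃ k, i = k + 1 := ⟨i - 1, by omega⟩
        have := h4 i (j - (4 * i + 3)) hi (by omega)
        rwa [Nat.add_sub_cancel' (by omega)] at this
    refine ⟨Sum.elim (fun j => CX j) (fun i => CY i), ?_, ?_⟩
    · rintro (⟨j, hj⟩ | ⟨i, hi⟩)
      · simp only [Sum.elim_inl, hx j hj, xValue_of_lt w hj, le_refl]
      · simp only [Sum.elim_inr, hy i hi, yValue_of_lt w hi, le_refl]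
    · rintro (⟨j, hj⟩ | ⟨i, hi⟩) (⟨k, hk⟩ | ⟨i', hi'⟩) hadj
      · rw [graphH_adj_inl_inl ht] at hadj
        simp only [Sum.elim_inl]
        rcases hadj with h | h | h | h
        · exact hxx j k hj hk (Or.inl h)
        · exact (hxx k j hk hj (Or.inl h)).symm
        · exact (hxx k j hk hj (Or.inr h)).symm
        · exact hxx j k hj hk (Or.inr h)
      · exact (hyx i' j hi' hj ((graphH_adj_inr_inl hi' hj).1 hadj.symm)).symm
      · exact hyx i k hi hk ((graphH_adj_inr_inl hi hk).1 hadj)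
      · exact absurd hadj (graphH_not_adj_inr_inr _ _)

end Coordinates

section Ring

variable {t s : ℕ}

/-- The fan of `H_t` on `x_1, x_2, x_3, y_1`. Here `x_2` and `y_1` have the same closed
neighbourhood, so they act as one vertex carrying the sum of their weights. -/
def headFan (w : Fin (hCycleLength t) ⊕ Fin t → ℕ) : FanWeight :=
  ⟨xValue w 0, 0, 0, xValue w 2, xValue w 1 + yValue w 0, false⟩

/-- The fan of `H_t` formed by `y_{k+2}` and its neighbours. -/
def fanAt (lg : ℕ → Bool) (w : Fin (hCycleLength t) ⊕ Fin t → ℕ) (k : ℕ) : FanWeight :=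
  ⟨xValue w (4 * k + 3), xValue w (4 * k + 4), xValue w (4 * k + 5), xValue w (4 * k + 6),
    yValue w (k + 1), lg k⟩

/-- The fans of `H_t` after the first one. In `H_1` the edge `x_4 x_5` plays the role of a fan: with
`s` colours, inner vertices of weights `s - w x_4` and `w x_4` force the colour sets of the ends to
be disjoint. -/
def tailFans (lg : ℕ → Bool) (s : ℕ) (w : Fin (hCycleLength t) ⊕ Fin t → ℕ) : List FanWeight :=
  if t = 1 then [⟨xValue w 3, s - xValue w 3, xValue w 3, xValue w 4, 0, true⟩]
  else (List.range' 0 (t - 1)).map (fanAt lg w)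

theorem extends_headFan_iff (w : Fin (hCycleLength t) ⊕ Fin t → ℕ) (L R : Finset (Fin s)) :
    (headFan w).Extends L R ↔ L.card = xValue w 0 ∧ R.card = xValue w 2 ∧
      ∃ A Y : Finset (Fin s), A.card = xValue w 1 ∧ Y.card = yValue w 0 ∧ Disjoint L A ∧
        Disjoint A R ∧ Disjoint Y L ∧ Disjoint Y A ∧ Disjoint Y R := by
  constructor
  · rintro ⟨hL, hR, -, -, Y, -, -, hY, -, -, -, hYL, -, -, hYR⟩
    obtain ⟨A, hA, hAc⟩ := Finset.exists_subset_card_eq (s := Y) (n := xValue w 1)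
      (by rw [hY]; exact Nat.le_add_right _ _)
    refine ⟨hL, hR, A, Y \ A, hAc, ?_, (hYL.mono_left hA).symm, hYR.mono_left hA,
      hYL.mono_left Finset.sdiff_subset, Finset.sdiff_disjoint, hYR.mono_left Finset.sdiff_subset⟩
    rw [Finset.card_sdiff_of_subset hA, hY, hAc]
    exact Nat.add_sub_cancel_left _ _
  · rintro ⟨hL, hR, A, Y, hA, hY, hLA, hAR, hYL, hYA, hYR⟩
    refine ⟨hL, hR, ∅, ∅, A ∪ Y, rfl, rfl, ?_, by simp, by simp, by simp,
      Finset.disjoint_union_left.2 ⟨hLA.symm, hYL⟩, by simp, by simp,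
      Finset.disjoint_union_left.2 ⟨hAR, hYR⟩⟩
    rw [Finset.card_union_of_disjoint hYA.symm, hA, hY]; rfl

/-- The colour sets `CX`, `CY` properly colour the `k`-th fan and the edge leading to it. -/
def FanColored (w : Fin (hCycleLength t) ⊕ Fin t → ℕ) (CX CY : ℕ → Finset (Fin s)) (k : ℕ) :
    Prop :=
  (∀ j < 4, (CX (4 * k + 3 + j)).card = xValue w (4 * k + 3 + j)) ∧
    (CY (k + 1)).card = yValue w (k + 1) ∧
    (∀ j < 4, Disjoint (CX (4 * k + 2 + j)) (CX (4 * k + 2 + j + 1))) ∧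
    ∀ j < 4, Disjoint (CY (k + 1)) (CX (4 * k + 3 + j))

theorem links_fanAt {w : Fin (hCycleLength t) ⊕ Fin t → ℕ} (lg : ℕ → Bool)
    {CX CY : ℕ → Finset (Fin s)} {X : Finset (Fin s)} {m i : ℕ}
    (h : ∀ k, i ≤ k → k < i + m → FanColored w CX CY k)
    (hX : Disjoint (CX (4 * (i + m) + 2)) X) :
    links ((List.range' i m).map (fanAt lg w)) (CX (4 * i + 2)) X := by
  induction m generalizing i with
  | zero => exact hX
  | succ m ih =>
    rw [List.range'_succ, List.map_cons]
    obtain ⟨h1, h2, h3, h4⟩ := h i le_rfl (by omega)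
    refine ⟨CX (4 * i + 3), CX (4 * i + 6), h3 0 (by omega), ⟨h1 0 (by omega), h1 3 (by omega),
      CX (4 * i + 4), CX (4 * i + 5), CY (i + 1), h1 1 (by omega), h1 2 (by omega), h2,
      h3 1 (by omega), h3 2 (by omega), h3 3 (by omega), h4 0 (by omega), h4 1 (by omega),
      h4 2 (by omega), h4 3 (by omega)⟩, ?_⟩
    have := ih (i := i + 1) (fun k h1 h2 => h k (by omega) (by omega))
      (by rwa [show i + 1 + m = i + (m + 1) by omega])
    rwa [show 4 * (i + 1) + 2 = 4 * i + 6 by omega] at this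

theorem exists_fanColored_of_links {w : Fin (hCycleLength t) ⊕ Fin t → ℕ} {lg : ℕ → Bool}
    {Z X : Finset (Fin s)} {m i : ℕ}
    (h : links ((List.range' i m).map (fanAt lg w)) Z X) :
    ∃ CX CY : ℕ → Finset (Fin s), CX (4 * i + 2) = Z ∧ Disjoint (CX (4 * (i + m) + 2)) X ∧
      ∀ k, i ≤ k → k < i + m → FanColored w CX CY k := by
  induction m generalizing i Z with
  | zero => exact ⟨fun _ => Z, fun _ => ∅, rfl, h, fun k h1 h2 => by omega⟩
  | succ m ih =>
    rw [List.range'_succ, List.map_cons] at h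
    obtain ⟨L, R, hZL, ⟨hL, hR, A, B, Y, hA, hB, hY, hLA, hAB, hBR, hYL, hYA, hYB, hYR⟩, h⟩ := h
    obtain ⟨CX, CY, hZ, hX, hk⟩ := ih h
    rw [show 4 * (i + 1) + 2 = 4 * i + 6 by omega] at hZ
    let CX' : ℕ → Finset (Fin s) := fun j => if 4 * i + 6 ≤ j then CX j else
      if j = 4 * i + 2 then Z else if j = 4 * i + 3 then L else if j = 4 * i + 4 then A else B
    let CY' : ℕ → Finset (Fin s) := fun j => if i + 2 ≤ j then CY j else Y
    have e2 : CX' (4 * i + 2) = Z := by simp [CX']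
    have e3 : CX' (4 * i + 3) = L := by simp [CX']
    have e4 : CX' (4 * i + 4) = A := by simp [CX']
    have e5 : CX' (4 * i + 5) = B := by simp [CX']
    have e6 : CX' (4 * i + 6) = R := by simp [CX', hZ]
    have eY : CY' (i + 1) = Y := by simp [CY']
    have ege : ∀ j, 4 * i + 6 ≤ j → CX' j = CX j := fun j hj => if_pos hj
    refine ⟨CX', CY', e2, ?_, fun k h1 h2 => ?_⟩
    · rw [ege _ (by omega), show i + (m + 1) = i + 1 + m by omega]
      exact hX
    · rcases Nat.eq_or_lt_of_le h1 with rfl | hlt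
      · refine ⟨fun j hj => ?_, by rw [eY]; exact hY, fun j hj => ?_, fun j hj => ?_⟩
        · interval_cases j
          · exact (congrArg Finset.card e3).trans hL
          · exact (congrArg Finset.card e4).trans hA
          · exact (congrArg Finset.card e5).trans hB
          · exact (congrArg Finset.card e6).trans hR
        · interval_cases j
          · exact (e2.symm ▸ e3.symm ▸ hZL : Disjoint (CX' (4 * i + 2)) (CX' (4 * i + 3)))
          · exact (e3.symm ▸ e4.symm ▸ hLA : Disjoint (CX' (4 * i + 3)) (CX' (4 * i + 4)))
          · exact (e4.symm ▸ e5.symm ▸ hAB : Disjoint (CX' (4 * i + 4)) (CX' (4 * i + 5)))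
          · exact (e5.symm ▸ e6.symm ▸ hBR : Disjoint (CX' (4 * i + 5)) (CX' (4 * i + 6)))
        · rw [eY]
          interval_cases j
          · exact (e3.symm ▸ hYL : Disjoint Y (CX' (4 * i + 3)))
          · exact (e4.symm ▸ hYA : Disjoint Y (CX' (4 * i + 4)))
          · exact (e5.symm ▸ hYB : Disjoint Y (CX' (4 * i + 5)))
          · exact (e6.symm ▸ hYR : Disjoint Y (CX' (4 * i + 6)))
      · obtain ⟨g1, g2, g3, g4⟩ := hk k hlt (by omega)
        have eYk : CY' (k + 1) = CY (k + 1) := if_pos (by omega)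
        refine ⟨fun j hj => ?_, by rw [eYk]; exact g2, fun j hj => ?_, fun j hj => ?_⟩
        · rw [ege _ (by omega)]; exact g1 j hj
        · rw [ege _ (by omega), ege _ (by omega)]; exact g3 j hj
        · rw [eYk, ege _ (by omega)]; exact g4 j hj

theorem weightColorable_graphH_one_iff (lg : ℕ → Bool) (w : Fin (hCycleLength 1) ⊕ Fin 1 → ℕ) :
    (graphH 1).WeightColorable s w ↔ RingColorable s (headFan w) (tailFans lg s w) := by
  rw [weightColorable_graphH_iff le_rfl, hCycleLength_one]
  unfold RingColorable tailFans
  rw [if_pos rfl]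
  simp only [extends_headFan_iff]
  constructor
  · rintro ⟨CX, CY, hx, hy, h1, h2, h3, h4⟩
    refine ⟨CX 0, CX 2, ⟨hx 0 (by omega), hx 2 (by omega), CX 1, CY 0, hx 1 (by omega),
      hy 0 (by omega), h1 0 (by omega), h1 1 (by omega), h3 0 (by omega), h3 1 (by omega),
      h3 2 (by omega)⟩, CX 3, CX 4, h1 2 (by omega), ?_, h2⟩
    have hd : Disjoint (CX 3) (CX 4) := h1 3 (by omega)
    have c3 := hx 3 (by omega)
    have c4 := hx 4 (by omega)
    have hle : (CX 3 ∪ CX 4).card ≤ s := by simpa using Finset.card_le_univ (CX 3 ∪ CX 4)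
    rw [Finset.card_union_of_disjoint hd] at hle
    rw [extends_iff, Finset.disjoint_iff_inter_eq_empty.1 hd, Finset.card_empty]
    dsimp only
    omega
  · rintro ⟨L, R, ⟨hL, hR, A, Y, hA, hY, hLA, hAR, hYL, hYA, hYR⟩, L', R', hRL', hE, hR'L⟩
    rw [extends_iff] at hE
    obtain ⟨hL', hR', g1, g2, g3, g4, g5⟩ := hE
    dsimp only at hL' hR' g1 g5
    have hd : Disjoint L' R' := by
      rw [Finset.disjoint_iff_inter_eq_empty, ← Finset.card_eq_zero]
      omega
    refine ⟨fun j => if j = 0 then L else if j = 1 then A else if j = 2 then R else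
      if j = 3 then L' else R', fun _ => Y, fun j hj => ?_, fun i hi => ?_, fun j hj => ?_, ?_,
      fun j hj => ?_, fun i j hi hj => by omega⟩
    · interval_cases j <;> simpa
    · obtain rfl : i = 0 := by omega
      exact hY
    · obtain hj : j < 4 := by omega
      interval_cases j <;> simpa
    · simpa
    · interval_cases j <;> simpa

/-- `H_t` is a ring of fans: a weight on it is colourable exactly when the ring of fans is. -/
theorem weightColorable_graphH_iff_ring (ht : 1 ≤ t) (lg : ℕ → Bool)
    (w : Fin (hCycleLength t) ⊕ Fin t → ℕ) :
    (graphH t).WeightColorable s w ↔ RingColorable s (headFan w) (tailFans lg s w) := by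
  obtain rfl | ⟨m, rfl⟩ : t = 1 ∨ ∃ m, t = m + 2 := by
    by_cases h : t = 1
    · exact Or.inl h
    · exact Or.inr ⟨t - 2, by omega⟩
  · exact weightColorable_graphH_one_iff lg w
  have hn := hCycleLength_add_two m
  rw [weightColorable_graphH_iff ht]
  unfold RingColorable tailFans
  rw [if_neg (by omega), show m + 2 - 1 = m + 1 by omega]
  simp only [extends_headFan_iff]
  constructor
  · rintro ⟨CX, CY, hx, hy, h1, h2, h3, h4⟩
    refine ⟨CX 0, CX 2, ⟨hx 0 (by omega), hx 2 (by omega), CX 1, CY 0, hx 1 (by omega),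
      hy 0 (by omega), h1 0 (by omega), h1 1 (by omega), h3 0 (by omega), h3 1 (by omega),
      h3 2 (by omega)⟩, ?_⟩
    refine links_fanAt (CY := CY) (i := 0) lg (fun k _ hk => ⟨fun j hj => hx _ (by omega),
      hy _ (by omega), fun j hj => h1 _ (by omega), fun j hj => h4 k j (by omega) hj⟩) ?_
    rwa [show 4 * (0 + (m + 1)) + 2 = hCycleLength (m + 2) - 1 by omega]
  · rintro ⟨L, R, ⟨hL, hR, A, Y, hA, hY, hLA, hAR, hYL, hYA, hYR⟩, hl⟩
    obtain ⟨CX, CY, hZ, hX, hk⟩ := exists_fanColored_of_links hl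
    let CX' : ℕ → Finset (Fin s) := fun j => if 3 ≤ j then CX j else
      if j = 0 then L else if j = 1 then A else R
    let CY' : ℕ → Finset (Fin s) := fun j => if 1 ≤ j then CY j else Y
    have e0 : CX' 0 = L := by simp [CX']
    have e1 : CX' 1 = A := by simp [CX']
    have e2 : CX' 2 = R := by simp [CX']
    have eY : CY' 0 = Y := by simp [CY']
    have ege : ∀ j, 2 ≤ j → CX' j = CX j := by
      intro j hj
      rcases Nat.eq_or_lt_of_le hj with rfl | hj
      · rw [e2, ← hZ]
      · exact if_pos hj
    have eYge : ∀ j, CY' (j + 1) = CY (j + 1) := fun j => if_pos (by omega)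
    refine ⟨CX', CY', fun j hj => ?_, fun i hi => ?_, fun j hj => ?_, ?_, fun j hj => ?_,
      fun i j hi hj => ?_⟩
    · by_cases h3 : j < 3
      · interval_cases j
        · rwa [e0]
        · rwa [e1]
        · rwa [e2]
      · rw [ege j (by omega)]
        have := (hk ((j - 3) / 4) (by omega) (by omega)).1 ((j - 3) % 4) (by omega)
        rwa [show 4 * ((j - 3) / 4) + 3 + (j - 3) % 4 = j by omega] at this
    · rcases Nat.eq_zero_or_pos i with rfl | hi0
      · rwa [eY]
      · obtain ⟨i, rfl⟩ : ∃ k, i = k + 1 := ⟨i - 1, by omega⟩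
        rw [eYge]
        exact (hk i (by omega) (by omega)).2.1
    · by_cases h2 : j < 2
      · interval_cases j
        · rwa [e0, e1]
        · rwa [e1, e2]
      · rw [ege j (by omega), ege (j + 1) (by omega)]
        have := (hk ((j - 2) / 4) (by omega) (by omega)).2.2.1 ((j - 2) % 4) (by omega)
        rwa [show 4 * ((j - 2) / 4) + 2 + (j - 2) % 4 = j by omega] at this
    · rw [ege _ (by omega), e0, show hCycleLength (m + 2) - 1 = 4 * (0 + (m + 1)) + 2 by omega]
      exact hX
    · rw [eY]
      interval_cases j
      · rwa [e0]
      · rwa [e1]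
      · rwa [e2]
    · rw [eYge, ege _ (by omega)]
      exact (hk i (by omega) (by omega)).2.2.2 j hj

end Ring

/-! ### Supports of critical weights on `H_t` -/

namespace SimpleGraph

variable {V : Type*} {G : SimpleGraph V} [Fintype V] [DecidableEq V] {s : ℕ} {w : V → ℕ}

theorem CriticalWeight.exists_pos (hw : G.CriticalWeight s w) : ∃ v, 0 < w v := by
  by_contra! h
  refine hw.not_colorable (weightColorable_of_sum_le ?_)
  rw [Finset.sum_eq_zero fun v _ => Nat.le_zero.1 (h v)]
  exact Nat.zero_le s

theorem CriticalWeight.pairwise_of_simplicial (hw : G.CriticalWeight s w) {v : V} (hv : 0 < w v)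
    (hsimp : {u | G.Adj v u ∧ 0 < w u}.Pairwise G.Adj) : {u | 0 < w u}.Pairwise G.Adj := by
  intro u hu u' hu' huu'
  rcases hw.adj_of_simplicial hv hsimp hu with rfl | h
  · rcases hw.adj_of_simplicial hv hsimp hu' with rfl | h'
    · exact absurd rfl huu'
    · exact h'
  · rcases hw.adj_of_simplicial hv hsimp hu' with rfl | h'
    · exact h.symm
    · exact hsimp ⟨h, hu⟩ ⟨h', hu'⟩ huu'

/-- If the support of a critical weight has a perfect elimination order then it is a clique, as the
first vertex in the order is simplicial. -/
theorem CriticalWeight.pairwise_of_elimination (hw : G.CriticalWeight s w) (κ : V → ℕ)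
    (hκ : ∀ v u u', 0 < w v → 0 < w u → 0 < w u' → G.Adj v u → G.Adj v u' → κ v ≤ κ u →
      κ v ≤ κ u' → u ≠ u' → G.Adj u u') : {u | 0 < w u}.Pairwise G.Adj := by
  obtain ⟨v₀, hv₀⟩ := hw.exists_pos
  obtain ⟨v, hv, hmin⟩ := Finset.exists_min_image (Finset.univ.filter fun v => 0 < w v) κ
    ⟨v₀, by simpa using hv₀⟩
  rw [Finset.mem_filter] at hv
  refine hw.pairwise_of_simplicial hv.2 fun u hu u' hu' huu' => ?_
  exact hκ v u u' hv.2 hu.2 hu'.2 hu.1 hu'.1 (hmin u (by simpa using hu.2))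
    (hmin u' (by simpa using hu'.2)) huu'

end SimpleGraph

section Structure

variable {t s : ℕ} {w : Fin (hCycleLength t) ⊕ Fin t → ℕ}

/-- A linear order of the vertices of `H_t`: along the cycle, with each `y` just before the last
of its neighbours. -/
def linearRank (t : ℕ) : Fin (hCycleLength t) ⊕ Fin t → ℕ
  | Sum.inl j => 2 * j
  | Sum.inr i => 8 * i + 3

/-- The order `linearRank`, rotated so as to begin at the cycle vertex number `q`. -/
def rotatedRank (t q : ℕ) (v : Fin (hCycleLength t) ⊕ Fin t) : ℕ :=
  if linearRank t v < 2 * q then linearRank t v + 2 * hCycleLength t else linearRank t v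

theorem rotatedRank_cases (t q : ℕ) (v : Fin (hCycleLength t) ⊕ Fin t) :
    (linearRank t v < 2 * q ∧ rotatedRank t q v = linearRank t v + 2 * hCycleLength t) ∨
      (2 * q ≤ linearRank t v ∧ rotatedRank t q v = linearRank t v) := by
  unfold rotatedRank
  split_ifs with h
  · exact Or.inl ⟨h, rfl⟩
  · exact Or.inr ⟨not_lt.1 h, rfl⟩

/-- If the support of a critical weight misses the cycle vertex number `q`, and no apex in the
support has that vertex as an inner vertex of its fan, then the support is a clique: cutting the
ring open at this vertex gives a perfect elimination order. -/
theorem pairwise_of_gap (ht : 1 ≤ t) (hw : (graphH t).CriticalWeight s w) {q : ℕ}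
    (hqn : q < hCycleLength t) (hq : w (Sum.inl ⟨q, hqn⟩) = 0)
    (hy : ∀ i (hi : i < t), 0 < w (Sum.inr ⟨i, hi⟩) →
      (i = 0 ∧ q ≠ 1) ∨ (1 ≤ i ∧ q ≠ 4 * i ∧ q ≠ 4 * i + 1)) :
    {v | 0 < w v}.Pairwise (graphH t).Adj := by
  have hn : hCycleLength t = 4 * t - 1 ∨ (t = 1 ∧ hCycleLength t = 5) := by
    unfold hCycleLength; split_ifs <;> omega
  have hqj : ∀ j (hj : j < hCycleLength t), 0 < w (Sum.inl ⟨j, hj⟩) → j ≠ q := by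
    rintro j hj h rfl; omega
  refine hw.pairwise_of_elimination (rotatedRank t q) ?_
  intro v u u' hv hu hu' hvu hvu' h1 h2 hne
  have c₁ := rotatedRank_cases t q v
  have c₂ := rotatedRank_cases t q u
  have c₃ := rotatedRank_cases t q u'
  generalize rotatedRank t q v = ρ₁ at *
  generalize rotatedRank t q u = ρ₂ at *
  generalize rotatedRank t q u' = ρ₃ at *
  rcases v with ⟨j, hj⟩ | ⟨i, hi⟩ <;> rcases u with ⟨k, hk⟩ | ⟨i', hi'⟩ <;>
    rcases u' with ⟨k', hk'⟩ | ⟨i'', hi''⟩ <;> simp only [linearRank] at c₁ c₂ c₃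
  · have hkk : k ≠ k' := fun h => hne (by subst h; rfl)
    rw [graphH_adj_inl_inl ht] at hvu hvu' ⊢
    have := hqj j hj hv
    have := hqj k hk hu
    have := hqj k' hk' hu'
    omega
  · rw [SimpleGraph.adj_comm, graphH_adj_inr_inl] at hvu' ⊢
    rw [graphH_adj_inl_inl ht] at hvu
    have := hqj j hj hv
    have := hqj k hk hu
    have := hy i'' hi'' hu'
    omega
  · rw [SimpleGraph.adj_comm, graphH_adj_inr_inl] at hvu
    rw [graphH_adj_inr_inl]
    rw [graphH_adj_inl_inl ht] at hvu'
    have := hqj j hj hv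
    have := hqj k' hk' hu'
    have := hy i' hi' hu
    omega
  · rw [SimpleGraph.adj_comm, graphH_adj_inr_inl] at hvu hvu'
    exact absurd (by congr 2; omega) hne
  · have hkk : k ≠ k' := fun h => hne (by subst h; rfl)
    rw [graphH_adj_inr_inl] at hvu hvu'
    rw [graphH_adj_inl_inl ht]
    have := hqj k hk hu
    have := hqj k' hk' hu'
    have := hy i hi hv
    omega
  · exact absurd hvu' (graphH_not_adj_inr_inr _ _)
  · exact absurd hvu (graphH_not_adj_inr_inr _ _)
  · exact absurd hvu (graphH_not_adj_inr_inr _ _)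

/-- The support of the weight `w` goes round the ring `H_t`, and the inner vertices of a fan are
either all present, or all absent and then the apex is present. -/
structure RingSupport (w : Fin (hCycleLength t) ⊕ Fin t → ℕ) : Prop where
  rim : ∀ j < hCycleLength t, j ≠ 1 → (∀ k, k + 1 < t → j ≠ 4 * k + 4 ∧ j ≠ 4 * k + 5) →
    0 < xValue w j
  head : 0 < xValue w 1 + yValue w 0
  fan : ∀ k, k + 1 < t → (0 < xValue w (4 * k + 4) ∧ 0 < xValue w (4 * k + 5)) ∨
    (xValue w (4 * k + 4) = 0 ∧ xValue w (4 * k + 5) = 0 ∧ 0 < yValue w (k + 1))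

theorem ringSupport_of_criticalWeight (ht : 1 ≤ t) (hw : (graphH t).CriticalWeight s w)
    (hcl : ¬ {v | 0 < w v}.Pairwise (graphH t).Adj) : RingSupport w := by
  have h5 := five_le_hCycleLength ht
  have hgap : ∀ q (hqn : q < hCycleLength t), xValue w q = 0 → ∃ i, i < t ∧ 0 < yValue w i ∧
      ((i = 0 ∧ q = 1) ∨ (1 ≤ i ∧ (q = 4 * i ∨ q = 4 * i + 1))) := by
    intro q hqn hq
    by_contra! hcon
    refine hcl (pairwise_of_gap ht hw hqn (by rwa [xValue_of_lt w hqn] at hq) ?_)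
    intro i hi hpos
    have := hcon i hi (by rwa [yValue_of_lt w hi])
    omega
  refine ⟨fun j hj h1 h2 => ?_, ?_, fun k hk => ?_⟩
  · rw [Nat.pos_iff_ne_zero]
    intro h0
    obtain ⟨i, hi, -, h⟩ := hgap j hj h0
    have := h2 (i - 1)
    omega
  · rw [Nat.pos_iff_ne_zero]
    intro h0
    obtain ⟨i, hi, hpos, h⟩ := hgap 1 (by omega) (by omega)
    obtain rfl : i = 0 := by omega
    omega
  · obtain ⟨m, rfl⟩ : ∃ m, t = m + 2 := ⟨t - 2, by omega⟩
    have hn := hCycleLength_add_two m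
    have ha : 4 * k + 4 < hCycleLength (m + 2) := by omega
    have hb : 4 * k + 5 < hCycleLength (m + 2) := by omega
    have key : ∀ q, q = 4 * k + 4 ∨ q = 4 * k + 5 → xValue w q = 0 → 0 < yValue w (k + 1) := by
      intro q hq h0
      obtain ⟨i, hi, hpos, h⟩ := hgap q (by omega) h0
      obtain rfl : i = k + 1 := by omega
      exact hpos
    -- If just one of the two inner vertices is present, then it is simplicial in the support.
    have hsimp : ∀ q q', (q = 4 * k + 4 ∧ q' = 4 * k + 5) ∨ (q = 4 * k + 5 ∧ q' = 4 * k + 4) →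
        0 < xValue w q → xValue w q' = 0 → False := by
      intro q q' hqq hq hq'
      have hqn : q < hCycleLength (m + 2) := by omega
      rw [xValue_of_lt w hqn] at hq
      have hq'j : ∀ j (hj : j < hCycleLength (m + 2)), 0 < w (Sum.inl ⟨j, hj⟩) → j ≠ q' := by
        rintro j hj h rfl
        rw [xValue_of_lt w hj] at hq'
        omega
      refine hcl (hw.pairwise_of_simplicial hq ?_)
      rintro (⟨j, hj⟩ | ⟨i, hi⟩) ⟨hu, hu0⟩ (⟨j', hj'⟩ | ⟨i', hi'⟩) ⟨hu', hu0'⟩ hne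
      · have hjj : j ≠ j' := fun h => hne (by subst h; rfl)
        rw [graphH_adj_inl_inl ht] at hu hu'
        have := hq'j j hj hu0
        have := hq'j j' hj' hu0'
        omega
      · rw [SimpleGraph.adj_comm, graphH_adj_inr_inl] at hu' ⊢
        rw [graphH_adj_inl_inl ht] at hu
        have := hq'j j hj hu0
        omega
      · rw [graphH_adj_inr_inl]
        rw [SimpleGraph.adj_comm, graphH_adj_inr_inl] at hu
        rw [graphH_adj_inl_inl ht] at hu'
        have := hq'j j' hj' hu0'
        omega
      · rw [SimpleGraph.adj_comm, graphH_adj_inr_inl] at hu hu'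
        exact absurd (by congr 2; omega) hne
    by_cases ha0 : xValue w (4 * k + 4) = 0 <;> by_cases hb0 : xValue w (4 * k + 5) = 0
    · exact Or.inr ⟨ha0, hb0, key _ (Or.inl rfl) ha0⟩
    · exact (hsimp _ _ (Or.inr ⟨rfl, rfl⟩) (Nat.pos_of_ne_zero hb0) ha0).elim
    · exact (hsimp _ _ (Or.inl ⟨rfl, rfl⟩) (Nat.pos_of_ne_zero ha0) hb0).elim
    · exact Or.inl ⟨Nat.pos_of_ne_zero ha0, Nat.pos_of_ne_zero hb0⟩

end Structure

/-! ### The odd cycle inequality for critical weights on `H_t` -/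

section Count

variable {t s : ℕ} {w : Fin (hCycleLength t) ⊕ Fin t → ℕ}

/-- Whether the inner vertices of the fan number `k` belong to the support of `w`. -/
def longAt (w : Fin (hCycleLength t) ⊕ Fin t → ℕ) (k : ℕ) : Bool :=
  decide (0 < xValue w (4 * k + 5))

/-- The length of the cycle through the support of `w` that follows the paths of its long fans. For
`t = 1` it includes the two auxiliary vertices of `tailFans`. -/
def ringLength (w : Fin (hCycleLength t) ⊕ Fin t → ℕ) : ℕ :=
  3 + if t = 1 then 4 else ∑ k ∈ Finset.range (t - 1), if longAt w k then 4 else 3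

/-- The total weight of the ring of fans of `H_t`. For `t = 1` it includes the weight `s` of the
auxiliary vertices of `tailFans`. -/
def ringTotal (s : ℕ) (w : Fin (hCycleLength t) ⊕ Fin t → ℕ) : ℕ :=
  ∑ v, w v + if t = 1 then s else 0

theorem sum_map_range' (f : ℕ → ℕ) (m : ℕ) :
    ((List.range' 0 m).map f).sum = ∑ k ∈ Finset.range m, f k := by
  rw [← List.range_eq_range']; rfl

theorem sum_range_four_mul_add_three (f : ℕ → ℕ) (m : ℕ) :
    ∑ j ∈ Finset.range (4 * m + 3), f j = f 0 + f 1 + f 2 + ∑ k ∈ Finset.range m,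
      (f (4 * k + 3) + f (4 * k + 4) + f (4 * k + 5) + f (4 * k + 6)) := by
  induction m with
  | zero => simp [Finset.sum_range_succ]
  | succ m ih =>
    rw [show 4 * (m + 1) + 3 = 4 * m + 3 + 1 + 1 + 1 + 1 by ring]
    simp only [Finset.sum_range_succ _ (4 * m + 3 + 1 + 1 + 1),
      Finset.sum_range_succ _ (4 * m + 3 + 1 + 1),
      Finset.sum_range_succ _ (4 * m + 3 + 1), Finset.sum_range_succ _ (4 * m + 3), ih,
      Finset.sum_range_succ _ m]
    ring

theorem sum_eq_sum_xValue_add (w : Fin (hCycleLength t) ⊕ Fin t → ℕ) :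
    ∑ v, w v = ∑ j ∈ Finset.range (hCycleLength t), xValue w j
      + ∑ i ∈ Finset.range t, yValue w i := by
  rw [Fintype.sum_sum_type, Finset.sum_range, Finset.sum_range]
  congr 1
  · exact Finset.sum_congr rfl fun j _ => (xValue_of_lt w j.2).symm
  · exact Finset.sum_congr rfl fun i _ => (yValue_of_lt w i.2).symm

theorem sum_eq_of_one (w : Fin (hCycleLength 1) ⊕ Fin 1 → ℕ) : ∑ v, w v =
    xValue w 0 + xValue w 1 + xValue w 2 + xValue w 3 + xValue w 4 + yValue w 0 := by
  rw [sum_eq_sum_xValue_add, hCycleLength_one]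
  simp [Finset.sum_range_succ]

theorem sum_eq_of_ne_one (ht : 1 ≤ t) (ht1 : t ≠ 1) (lg : ℕ → Bool)
    (w : Fin (hCycleLength t) ⊕ Fin t → ℕ) : ∑ v, w v =
      xValue w 0 + xValue w 1 + xValue w 2 + yValue w 0
        + ∑ k ∈ Finset.range (t - 1), (fanAt lg w k).total := by
  obtain ⟨m, rfl⟩ : ∃ m, t = m + 2 := ⟨t - 2, by omega⟩
  rw [sum_eq_sum_xValue_add, hCycleLength_add_two, show 4 * m + 7 = 4 * (m + 1) + 3 by ring,
    sum_range_four_mul_add_three, show m + 2 - 1 = m + 1 by omega, Finset.sum_range_succ' _ (m + 1)]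
  simp only [fanAt, total, Finset.sum_add_distrib]
  ring

theorem head_add_tail_total (ht : 1 ≤ t) (lg : ℕ → Bool)
    (hle : t = 1 → xValue w 3 ≤ s) :
    (headFan w).total + ((tailFans lg s w).map total).sum = ringTotal s w := by
  unfold ringTotal tailFans
  by_cases h : t = 1
  · subst h
    have := hle rfl
    simp only [if_true, sum_eq_of_one, headFan, total, List.map_cons, List.map_nil, List.sum_cons,
      List.sum_nil]
    omega
  · rw [if_neg h, if_neg h, List.map_map, sum_map_range', sum_eq_of_ne_one ht h lg]
    simp only [headFan, Function.comp_apply, total]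
    ring

theorem head_add_tail_size (w : Fin (hCycleLength t) ⊕ Fin t → ℕ)
    (w' : Fin (hCycleLength t) ⊕ Fin t → ℕ) :
    (headFan w').size + ((tailFans (longAt w) s w').map size).sum = ringLength w := by
  unfold ringLength tailFans
  by_cases h : t = 1
  · rw [if_pos h, if_pos h]; simp [headFan, size]
  · rw [if_neg h, if_neg h, List.map_map, sum_map_range']
    simp only [headFan, size, fanAt, Function.comp_def, Bool.false_eq_true, if_false]
    rfl

/-- Clique inequalities for `H_t`, in the form needed for its ring of fans. -/
theorem chainLe_tailFans (ht : 1 ≤ t) {lg : ℕ → Bool}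
    (hcl : ∀ T : Finset (Fin (hCycleLength t) ⊕ Fin t),
      (T : Set (Fin (hCycleLength t) ⊕ Fin t)).Pairwise (graphH t).Adj → ∑ v ∈ T, w v ≤ s)
    (hlg : ∀ k, k + 1 < t → lg k = false → xValue w (4 * k + 4) = 0 ∧ xValue w (4 * k + 5) = 0) :
    (headFan w).CliqueLe s ∧ ChainLe s (xValue w 2) (tailFans lg s w) (xValue w 0) := by
  classical
  have h5 := five_le_hCycleLength ht
  have edge : ∀ j k, j < hCycleLength t → k < hCycleLength t →
      (j + 1 = k ∨ (k = 0 ∧ j + 1 = hCycleLength t)) → xValue w j + xValue w k ≤ s := by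
    intro j k hj hk hjk
    have hadj : (graphH t).Adj (Sum.inl ⟨j, hj⟩) (Sum.inl ⟨k, hk⟩) :=
      (graphH_adj_inl_inl ht _ _).2 (by omega)
    have := hcl {Sum.inl ⟨j, hj⟩, Sum.inl ⟨k, hk⟩} (by
      rw [Finset.coe_pair, Set.pairwise_pair]
      exact fun _ => ⟨hadj, hadj.symm⟩)
    rwa [Finset.sum_pair hadj.ne, ← xValue_of_lt w, ← xValue_of_lt w] at this
  have triangle : ∀ j i, j + 1 < hCycleLength t → i < t →
      ((i = 0 ∧ j ≤ 1) ∨ (1 ≤ i ∧ 4 * i ≤ j + 1 ∧ j ≤ 4 * i + 1)) →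
      xValue w j + xValue w (j + 1) + yValue w i ≤ s := by
    intro j i hj hi hji
    have hj' : j < hCycleLength t := by omega
    have hadj : (graphH t).Adj (Sum.inl ⟨j, hj'⟩) (Sum.inl ⟨j + 1, hj⟩) :=
      (graphH_adj_inl_inl ht _ _).2 (by omega)
    have hadj1 : (graphH t).Adj (Sum.inr ⟨i, hi⟩) (Sum.inl ⟨j, hj'⟩) :=
      (graphH_adj_inr_inl _ _).2 (by omega)
    have hadj2 : (graphH t).Adj (Sum.inr ⟨i, hi⟩) (Sum.inl ⟨j + 1, hj⟩) :=
      (graphH_adj_inr_inl _ _).2 (by omega)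
    have := hcl {Sum.inr ⟨i, hi⟩, Sum.inl ⟨j, hj'⟩, Sum.inl ⟨j + 1, hj⟩} (by
      intro u hu v hv huv
      simp only [Finset.coe_insert, Finset.coe_singleton, Set.mem_insert_iff,
        Set.mem_singleton_iff] at hu hv
      rcases hu with rfl | rfl | rfl <;> rcases hv with rfl | rfl | rfl <;>
        first
        | exact absurd rfl huv
        | assumption
        | exact SimpleGraph.Adj.symm (by assumption))
    rw [Finset.sum_insert (by simp), Finset.sum_pair hadj.ne, ← xValue_of_lt w, ← xValue_of_lt w,
      ← yValue_of_lt w] at this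
    omega
  refine ⟨⟨?_, ?_, ?_, fun _ => ⟨rfl, rfl⟩⟩, ?_⟩
  · have : xValue w 0 + xValue w 1 + yValue w 0 ≤ s := triangle 0 0 (by omega) (by omega) (by omega)
    simp only [headFan]; omega
  · have : xValue w 0 + xValue w 1 + yValue w 0 ≤ s := triangle 0 0 (by omega) (by omega) (by omega)
    simp only [headFan]; omega
  · have : xValue w 1 + xValue w 2 + yValue w 0 ≤ s := triangle 1 0 (by omega) (by omega) (by omega)
    simp only [headFan]; omega
  · unfold tailFans
    by_cases h1 : t = 1
    · subst h1
      rw [if_pos rfl]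
      rw [hCycleLength_one] at edge
      have e1 := edge 2 3 (by omega) (by omega) (by omega)
      have e2 := edge 3 4 (by omega) (by omega) (by omega)
      have e3 := edge 4 0 (by omega) (by omega) (by omega)
      refine ⟨e1, ⟨?_, ?_, ?_, by simp⟩, e3⟩ <;> dsimp only <;> omega
    · rw [if_neg h1]
      obtain ⟨m, rfl⟩ : ∃ m, t = m + 2 := ⟨t - 2, by omega⟩
      have hn := hCycleLength_add_two m
      have key : ∀ d i, i + d = m + 1 → ChainLe s (xValue w (4 * i + 2))
          ((List.range' i d).map (fanAt lg w)) (xValue w 0) := by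
        intro d
        induction d with
        | zero =>
          intro i hi
          exact edge (4 * i + 2) 0 (by omega) (by omega) (by omega)
        | succ d ih =>
          intro i hi
          rw [List.range'_succ, List.map_cons]
          refine ⟨edge (4 * i + 2) (4 * i + 3) (by omega) (by omega) (by omega),
            ⟨?_, ?_, ?_, fun h => hlg i (by omega) h⟩, ?_⟩
          · exact triangle (4 * i + 3) (i + 1) (by omega) (by omega) (by omega)
          · exact triangle (4 * i + 4) (i + 1) (by omega) (by omega) (by omega)
          · exact triangle (4 * i + 5) (i + 1) (by omega) (by omega) (by omega)
          · have := ih (i + 1) (by omega)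
            rwa [show 4 * (i + 1) + 2 = 4 * i + 6 by ring] at this
      have := key (m + 1) 0 (by omega)
      simpa using this

theorem xValue_update (w : Fin (hCycleLength t) ⊕ Fin t → ℕ) {q : ℕ} (hq : q < hCycleLength t)
    (c j : ℕ) :
    xValue (Function.update w (Sum.inl ⟨q, hq⟩) c) j = if j = q then c else xValue w j := by
  by_cases hj : j < hCycleLength t
  · rw [xValue_of_lt _ hj, xValue_of_lt _ hj, Function.update_apply]
    simp [Fin.ext_iff]
  · rw [if_neg (by omega)]
    unfold xValue
    rw [dif_neg hj, dif_neg hj]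

theorem yValue_update (w : Fin (hCycleLength t) ⊕ Fin t → ℕ) {q : ℕ} (hq : q < hCycleLength t)
    (c i : ℕ) : yValue (Function.update w (Sum.inl ⟨q, hq⟩) c) i = yValue w i := by
  unfold yValue
  simp

theorem not_pairwise_le_sum (hw : (graphH t).CriticalWeight s w)
    (hcl : ¬ {v | 0 < w v}.Pairwise (graphH t).Adj) (T : Finset (Fin (hCycleLength t) ⊕ Fin t))
    (hT : (T : Set (Fin (hCycleLength t) ⊕ Fin t)).Pairwise (graphH t).Adj) :
    ∑ v ∈ T, w v ≤ s := by
  obtain ⟨u, hu, huT⟩ : ∃ u, 0 < w u ∧ u ∉ T := by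
    by_contra! h
    exact hcl (hT.mono fun u hu => h u hu)
  exact hw.sum_le_of_isClique hT hu huT

/-- A critical weight of `H_t` whose support is not a clique lives on an odd ring, and violates the
odd cycle inequality. -/
theorem odd_and_lt_ringTotal (ht : 1 ≤ t) (hw : (graphH t).CriticalWeight s w)
    (hcl : ¬ {v | 0 < w v}.Pairwise (graphH t).Adj) :
    Odd (ringLength w) ∧ ringLength w / 2 * s < ringTotal s w := by
  have hring := ringSupport_of_criticalWeight ht hw hcl
  have hlg : ∀ k, k + 1 < t → longAt w k = false →
      xValue w (4 * k + 4) = 0 ∧ xValue w (4 * k + 5) = 0 := by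
    intro k hk h
    have := hring.fan k hk
    simp only [longAt, decide_eq_false_iff_not] at h
    omega
  obtain ⟨hγ, hc⟩ := chainLe_tailFans ht (not_pairwise_le_sum hw hcl) hlg
  have hs : NeZero s := by
    obtain ⟨v, hv⟩ := hw.exists_pos
    exact ⟨by have := hw.le v; omega⟩
  have key := odd_and_lt_total_of_not_ringColorable (s := s) hγ rfl hc ?_
    (fun h => hw.not_colorable ((weightColorable_graphH_iff_ring ht (longAt w) w).2 h))
  · rw [head_add_tail_size] at key
    have := head_add_tail_total (w := w) (s := s) ht (longAt w) (by
      rintro rfl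
      rw [xValue_of_lt w (by simp [hCycleLength_one])]
      exact hw.le _)
    exact ⟨key.1, by omega⟩
  · intro bs₁ β bs₂ hbs hβ hy
    unfold tailFans at hbs
    by_cases h1 : t = 1
    · rw [if_pos h1, eq_comm, List.append_eq_singleton_iff] at hbs
      rcases hbs with ⟨-, h⟩ | ⟨-, h⟩
      · rw [List.cons_eq_cons] at h
        rw [h.1] at hy
        exact absurd hy (lt_irrefl 0)
      · exact absurd h (List.cons_ne_nil _ _)
    · obtain ⟨m, rfl⟩ : ∃ m, t = m + 2 := ⟨t - 2, by omega⟩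
      have hn := hCycleLength_add_two m
      rw [if_neg h1, show m + 2 - 1 = m + 1 by omega] at hbs
      obtain ⟨l₁, l', hr, rfl, hl'⟩ := List.map_eq_append_iff.1 hbs
      obtain ⟨k, l₂, rfl, rfl, rfl⟩ := List.map_eq_cons_iff.1 hl'
      have hnd : (l₁ ++ k :: l₂).Nodup := hr ▸ List.nodup_range'
      have hk : k < m + 1 := by
        have : k ∈ List.range' 0 (m + 1) := by rw [hr]; simp
        simpa using this
      have hkn : 4 * k + 4 < hCycleLength (m + 2) := by omega
      have ha : 0 < xValue w (4 * k + 4) := by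
        have := hring.fan k (by omega)
        have h' : longAt w k = true := hβ
        simp only [longAt, decide_eq_true_eq] at h'
        omega
      have hlow := hw.lower (Sum.inl ⟨4 * k + 4, hkn⟩) (by rwa [xValue_of_lt w hkn] at ha)
      rw [weightColorable_graphH_iff_ring ht (longAt w)] at hlow
      unfold tailFans at hlow
      rw [if_neg h1, show m + 2 - 1 = m + 1 by omega, hr, List.map_append, List.map_cons] at hlow
      have hne : ∀ i, i ≠ k → fanAt (longAt w)
          (Function.update w (Sum.inl ⟨4 * k + 4, hkn⟩) (w (Sum.inl ⟨4 * k + 4, hkn⟩) - 1)) i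
          = fanAt (longAt w) w i := by
        intro i hi
        simp only [fanAt, xValue_update, yValue_update]
        rw [if_neg (by omega), if_neg (by omega), if_neg (by omega), if_neg (by omega)]
      have heq : fanAt (longAt w)
          (Function.update w (Sum.inl ⟨4 * k + 4, hkn⟩) (w (Sum.inl ⟨4 * k + 4, hkn⟩) - 1)) k
          = (fanAt (longAt w) w k).lower := by
        simp only [fanAt, xValue_update, yValue_update, FanWeight.lower]
        rw [if_neg (by omega), if_pos trivial, if_neg (by omega), if_neg (by omega),
          xValue_of_lt w hkn]
      have hhead : headFan
          (Function.update w (Sum.inl ⟨4 * k + 4, hkn⟩) (w (Sum.inl ⟨4 * k + 4, hkn⟩) - 1))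
          = headFan w := by
        simp only [headFan, xValue_update, yValue_update]
        rw [if_neg (by omega), if_neg (by omega), if_neg (by omega)]
      rw [List.nodup_append, List.nodup_cons] at hnd
      rw [hhead, heq, List.map_congr_left fun i hi => hne i ?_,
        List.map_congr_left (l := l₂) fun i hi => hne i ?_] at hlow
      · exact hlow
      · rintro rfl
        exact hnd.2.1.1 hi
      · rintro rfl
        exact hnd.2.2 i hi i (by simp) rfl

theorem ringLength_of_full (ht : 1 ≤ t) (hw : ∀ v, 0 < w v) :
    ringLength w = 4 * t - 1 + if t = 1 then 4 else 0 := by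
  unfold ringLength
  by_cases h : t = 1
  · rw [if_pos h, if_pos h]; omega
  · obtain ⟨m, rfl⟩ : ∃ m, t = m + 2 := ⟨t - 2, by omega⟩
    have hn := hCycleLength_add_two m
    rw [if_neg h, if_neg h, Finset.sum_congr rfl fun k hk => if_pos ?_]
    · simp only [Finset.sum_const, Finset.card_range, smul_eq_mul]; omega
    · rw [Finset.mem_range] at hk
      simp only [longAt, decide_eq_true_eq]
      rw [xValue_of_lt w (by omega)]
      exact hw _

end Count

/-! ### Consequences of the odd cycle inequality, and cliques of `H_t` -/

section Bounds

variable {t s : ℕ} {w : Fin (hCycleLength t) ⊕ Fin t → ℕ}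

theorem not_pairwise_of_full (ht : 1 ≤ t) (hw : ∀ v, 0 < w v) :
    ¬ {v | 0 < w v}.Pairwise (graphH t).Adj := by
  have h5 := five_le_hCycleLength ht
  intro h
  have := h (hw (Sum.inl ⟨0, by omega⟩)) (hw (Sum.inl ⟨3, by omega⟩)) (by simp)
  rw [graphH_adj_inl_inl ht] at this
  omega

/-- A critical weight of full support needs at least `t + 2` colours: the odd cycle inequality and
the triangle inequalities force the weight of `x_3` to be at least `t`. -/
theorem add_two_le_of_full (ht : 1 ≤ t) (hw : (graphH t).CriticalWeight s w)
    (hpos : ∀ v, 0 < w v) : t + 2 ≤ s := by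
  have hcl := not_pairwise_of_full ht hpos
  have hlt := (odd_and_lt_ringTotal ht hw hcl).2
  rw [ringLength_of_full ht hpos, show (4 * t - 1 + if t = 1 then 4 else 0) / 2 =
    2 * t - 1 + if t = 1 then 2 else 0 by split_ifs <;> omega] at hlt
  have h5 := five_le_hCycleLength ht
  have hx : ∀ j < hCycleLength t, 0 < xValue w j := fun j hj => by
    rw [xValue_of_lt w hj]; exact hpos _
  have hy : ∀ i < t, 0 < yValue w i := fun i hi => by
    rw [yValue_of_lt w hi]; exact hpos _
  obtain ⟨hγ, hc⟩ := chainLe_tailFans (lg := fun _ => true) ht (not_pairwise_le_sum hw hcl)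
    (fun _ _ h => by simp at h)
  have htot := head_add_tail_total (w := w) (s := s) ht (fun _ => true) (by
      rintro rfl
      rw [xValue_of_lt w (by simp [hCycleLength_one])]
      exact hw.le _)
  have hβ := hc.cliqueLe
  obtain ⟨c1, c2, c3, -⟩ := hγ
  simp only [headFan] at c1 c2 c3
  have hx1 := hx 1 (by omega)
  have hy0 := hy 0 (by omega)
  unfold tailFans at htot hβ
  by_cases h1 : t = 1
  · subst h1
    simp only [if_true, List.map_cons, List.map_nil, List.sum_cons, List.sum_nil, headFan,
      total, List.mem_singleton, forall_eq, CliqueLe] at htot hlt hβ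
    omega
  · obtain ⟨m, rfl⟩ : ∃ m, t = m + 2 := ⟨t - 2, by omega⟩
    rw [if_neg h1, show m + 2 - 1 = m + 1 by omega] at htot hβ
    rw [List.map_map, sum_map_range'] at htot
    have hsum : ∑ k ∈ Finset.range (m + 1), (total ∘ fanAt (fun _ => true) w) k + (m + 1)
        ≤ (m + 1) * (2 * s) := by
      have h : ∀ k ∈ Finset.range (m + 1),
          (total ∘ fanAt (fun _ => true) w) k + 1 ≤ 2 * s := by
        intro k hk
        rw [Finset.mem_range] at hk
        obtain ⟨d1, d2, d3, -⟩ := hβ (fanAt (fun _ => true) w k) (List.mem_map_of_mem (by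
          rw [List.mem_range'_1]; omega))
        have := hy (k + 1) (by omega)
        simp only [Function.comp_apply, total, fanAt] at d1 d3 ⊢
        omega
      have := Finset.sum_le_sum h
      simpa [Finset.sum_add_distrib] using this
    rw [if_neg h1, show 2 * (m + 2) - 1 + 0 = 2 * m + 3 by omega] at hlt
    simp only [headFan, total] at htot
    have e1 : (2 * m + 3) * s = 2 * (m * s) + 3 * s := by ring
    have e2 : (m + 1) * (2 * s) = 2 * (m * s) + 2 * s := by ring
    omega

/-- The odd cycle inequality is valid for colourable weights supported on an odd ring, since it
bounds the size of independent sets. -/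
theorem not_weightColorable_of_lt_ringTotal (ht : 1 ≤ t) (hring : RingSupport w)
    (hlt : ringLength w / 2 * s < ringTotal s w) : ¬ (graphH t).WeightColorable s w := by
  intro hcol
  obtain ⟨c, hc, hd⟩ := hcol.exists_card_eq
  let χ : Fin s → Fin (hCycleLength t) ⊕ Fin t → ℕ := fun k v => if k ∈ c v then 1 else 0
  have hχ : ∀ k, (graphH t).WeightColorable 1 (χ k) := fun k =>
    ⟨fun v => if k ∈ c v then Finset.univ else ∅, fun v => by
      by_cases h : k ∈ c v <;> simp [χ, h], fun u v huv => by
      dsimp only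
      by_cases h : k ∈ c u
      · rw [if_neg (Finset.disjoint_left.1 (hd u v huv) h)]; simp
      · rw [if_neg h]; simp⟩
  have hzero : ∀ k v, w v = 0 → χ k v = 0 := by
    intro k v h
    rw [← hc, Finset.card_eq_zero] at h
    simp [χ, h]
  have hxzero : ∀ k j, xValue w j = 0 → xValue (χ k) j = 0 := by
    intro k j h
    by_cases hj : j < hCycleLength t
    · rw [xValue_of_lt _ hj] at h ⊢
      exact hzero k _ h
    · exact dif_neg hj
  have hle : ∀ k, ringTotal 1 (χ k) ≤ ringLength w / 2 := by
    intro k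
    obtain ⟨hγ, hch⟩ := chainLe_tailFans (lg := longAt w) ht
      (fun T hT => (hχ k).sum_le_of_isClique hT) (by
        intro i hi h
        have := hring.fan i hi
        simp only [longAt, decide_eq_false_iff_not] at h
        exact ⟨hxzero k _ (by omega), hxzero k _ (by omega)⟩)
    have h2 := two_mul_total_le_of_ring hγ rfl hch
    rw [head_add_tail_size, head_add_tail_total ht (longAt w)] at h2
    · omega
    · rintro rfl
      rw [xValue_of_lt _ (by simp [hCycleLength_one])]
      simp only [χ]
      split_ifs <;> omega
  have hsum : ∑ k, ringTotal 1 (χ k) = ringTotal s w := by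
    unfold ringTotal
    rw [Finset.sum_add_distrib, Finset.sum_comm]
    congr 1
    · refine Finset.sum_congr rfl fun v _ => ?_
      rw [← hc v]
      simp [χ]
    · split_ifs <;> simp
  have : ∑ k : Fin s, ringTotal 1 (χ k) ≤ ∑ _k : Fin s, ringLength w / 2 :=
    Finset.sum_le_sum fun k _ => hle k
  rw [hsum, Finset.sum_const, Finset.card_univ, Fintype.card_fin, smul_eq_mul, mul_comm] at this
  omega

/-- The cliques of `H_t` lie in edges of the cycle or in triangles with an apex. -/
theorem clique_cases (ht : 1 ≤ t) {T : Set (Fin (hCycleLength t) ⊕ Fin t)}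
    (hT : T.Pairwise (graphH t).Adj) :
    (∃ j k, ∃ (hj : j < hCycleLength t) (hk : k < hCycleLength t),
      (j + 1 = k ∨ (k = 0 ∧ j + 1 = hCycleLength t)) ∧
      T ⊆ {Sum.inl ⟨j, hj⟩, Sum.inl ⟨k, hk⟩}) ∨
    (∃ j i, ∃ (hj : j < hCycleLength t) (hj' : j + 1 < hCycleLength t) (hi : i < t),
      ((i = 0 ∧ j ≤ 1) ∨ (1 ≤ i ∧ 4 * i ≤ j + 1 ∧ j ≤ 4 * i + 1)) ∧
      T ⊆ {Sum.inr ⟨i, hi⟩, Sum.inl ⟨j, hj⟩, Sum.inl ⟨j + 1, hj'⟩}) := by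
  classical
  have hn5 := five_le_hCycleLength ht
  have hn : hCycleLength t = 4 * t - 1 ∨ (t = 1 ∧ hCycleLength t = 5) := by
    unfold hCycleLength; split_ifs <;> omega
  have hxx : ∀ j k (hj : j < hCycleLength t) (hk : k < hCycleLength t), Sum.inl ⟨j, hj⟩ ∈ T →
      Sum.inl ⟨k, hk⟩ ∈ T → j = k ∨ (j + 1 = k ∨ k + 1 = j ∨ (j = 0 ∧ k + 1 = hCycleLength t) ∨
        (k = 0 ∧ j + 1 = hCycleLength t)) := by
    intro j k hj hk hjT hkT
    by_cases h : j = k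
    · exact Or.inl h
    · exact Or.inr ((graphH_adj_inl_inl ht hj hk).1 (hT hjT hkT (by simpa using h)))
  -- `m` is the first vertex of the cycle in `T`, if there is one.
  have hmin : (∀ j (hj : j < hCycleLength t), Sum.inl ⟨j, hj⟩ ∉ T) ∨
      ∃ m, ∃ hm : m < hCycleLength t, Sum.inl ⟨m, hm⟩ ∈ T ∧
        ∀ j (hj : j < hCycleLength t), Sum.inl ⟨j, hj⟩ ∈ T → m ≤ j := by
    by_cases h : ∃ j, ∃ hj : j < hCycleLength t, Sum.inl ⟨j, hj⟩ ∈ T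
    · obtain ⟨hm, hmT⟩ := Nat.find_spec h
      exact Or.inr ⟨Nat.find h, hm, hmT, fun j hj hjT => Nat.find_min' h ⟨hj, hjT⟩⟩
    · push Not at h
      exact Or.inl h
  by_cases hy : ∃ i, ∃ hi : i < t, Sum.inr ⟨i, hi⟩ ∈ T
  · obtain ⟨i, hi, hiT⟩ := hy
    right
    have hyx : ∀ j (hj : j < hCycleLength t), Sum.inl ⟨j, hj⟩ ∈ T →
        (i = 0 ∧ j ≤ 2) ∨ (1 ≤ i ∧ 4 * i ≤ j + 1 ∧ j ≤ 4 * i + 2) := fun j hj hjT =>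
      (graphH_adj_inr_inl hi hj).1 (hT hiT hjT (by simp))
    have hyy : ∀ i' (hi' : i' < t), Sum.inr ⟨i', hi'⟩ ∈ T → i' = i := by
      intro i' hi' h
      by_contra hne
      exact graphH_not_adj_inr_inr _ _ (hT h hiT (by simpa using hne))
    obtain ⟨m, hmi, hmT⟩ : ∃ m, ((i = 0 ∧ m ≤ 1) ∨ (1 ≤ i ∧ 4 * i ≤ m + 1 ∧ m ≤ 4 * i + 1)) ∧
        ∀ j (hj : j < hCycleLength t), Sum.inl ⟨j, hj⟩ ∈ T → j = m ∨ j = m + 1 := by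
      rcases hmin with h | ⟨m, hm, hmT, hmin⟩
      · exact ⟨4 * i - 1, by omega, fun j hj hjT => absurd hjT (h j hj)⟩
      · have h1 := hyx m hm hmT
        have h5 : ∀ j (hj : j < hCycleLength t), Sum.inl ⟨j, hj⟩ ∈ T → j = m ∨ j = m + 1 := by
          intro j hj hjT
          have h2 := hyx j hj hjT
          have h3 := hxx m j hm hj hmT hjT
          have h4 := hmin j hj hjT
          rcases h3 with h | h | h | h | h <;> omega
        by_cases hlast : (i = 0 ∧ m = 2) ∨ (1 ≤ i ∧ m = 4 * i + 2)
        · refine ⟨m - 1, by omega, fun j hj hjT => ?_⟩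
          have h2 := hyx j hj hjT
          rcases h5 j hj hjT with h | h <;> omega
        · exact ⟨m, by omega, h5⟩
    have hm' : m + 1 < hCycleLength t := by omega
    refine ⟨m, i, by omega, hm', hi, hmi, ?_⟩
    rintro (⟨j, hj⟩ | ⟨i', hi'⟩) h
    · rcases hmT j hj h with rfl | rfl <;> simp
    · obtain rfl := hyy i' hi' h
      simp
  · push Not at hy
    left
    have hsub : ∀ j k (hj : j < hCycleLength t) (hk : k < hCycleLength t),
        (∀ l (hl : l < hCycleLength t), Sum.inl ⟨l, hl⟩ ∈ T → l = j ∨ l = k) →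
        T ⊆ {Sum.inl ⟨j, hj⟩, Sum.inl ⟨k, hk⟩} := by
      rintro j k hj hk h (⟨l, hl⟩ | ⟨i, hi⟩) hT
      · rcases h l hl hT with rfl | rfl <;> simp
      · exact absurd hT (hy i hi)
    rcases hmin with h | ⟨m, hm, hmT, hmin⟩
    · exact ⟨0, 1, by omega, by omega, Or.inl rfl, hsub _ _ _ _ fun l hl hT => absurd hT (h l hl)⟩
    · by_cases hlast : ∃ hl : hCycleLength t - 1 < hCycleLength t,
        Sum.inl ⟨hCycleLength t - 1, hl⟩ ∈ T ∧ m ≠ hCycleLength t - 2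
      · obtain ⟨hl, hlT, hm2⟩ := hlast
        refine ⟨hCycleLength t - 1, 0, hl, by omega, Or.inr ⟨rfl, by omega⟩, hsub _ _ _ _ ?_⟩
        intro l hl' hlT'
        have h1 := hxx m l hm hl' hmT hlT'
        have h2 := hmin l hl' hlT'
        have h3 := hxx m _ hm hl hmT hlT
        have h4 := hxx l _ hl' hl hlT' hlT
        have hm0 : m = 0 ∨ m = hCycleLength t - 1 := by
          rcases h3 with h | h | h | h | h <;> omega
        rcases h1 with h | h | h | h | h <;> rcases h4 with h' | h' | h' | h' | h' <;> omega
      · have hlast' : m + 1 < hCycleLength t := by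
          by_contra hcon
          obtain rfl : m = hCycleLength t - 1 := by omega
          exact hlast ⟨hm, hmT, by omega⟩
        refine ⟨m, m + 1, hm, hlast', Or.inl rfl, hsub _ _ _ _ fun l hl hlT => ?_⟩
        have h1 := hxx m l hm hl hmT hlT
        have h2 := hmin l hl hlT
        by_cases hl2 : l = hCycleLength t - 1
        · subst hl2
          by_cases hm2 : m = hCycleLength t - 2
          · omega
          · exact absurd ⟨hl, hlT, hm2⟩ hlast
        · omega

theorem card_le_three_of_clique (ht : 1 ≤ t) {T : Finset (Fin (hCycleLength t) ⊕ Fin t)}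
    (hT : (T : Set (Fin (hCycleLength t) ⊕ Fin t)).Pairwise (graphH t).Adj) : T.card ≤ 3 := by
  classical
  rcases clique_cases ht hT with ⟨j, k, hj, hk, -, h⟩ | ⟨j, i, hj, hj', hi, -, h⟩
  · have : T ⊆ {Sum.inl ⟨j, hj⟩, Sum.inl ⟨k, hk⟩} := fun v hv => by simpa using h hv
    exact (Finset.card_le_card this).trans (Finset.card_le_two.trans (by omega))
  · have : T ⊆ {Sum.inr ⟨i, hi⟩, Sum.inl ⟨j, hj⟩, Sum.inl ⟨j + 1, hj'⟩} := fun v hv => by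
      simpa using h hv
    exact (Finset.card_le_card this).trans Finset.card_le_three

theorem sum_le_of_edges_of_triangles (ht : 1 ≤ t)
    (hedge : ∀ j k, j < hCycleLength t → k < hCycleLength t →
      (j + 1 = k ∨ (k = 0 ∧ j + 1 = hCycleLength t)) → xValue w j + xValue w k ≤ s)
    (htri : ∀ j i, j + 1 < hCycleLength t → i < t →
      ((i = 0 ∧ j ≤ 1) ∨ (1 ≤ i ∧ 4 * i ≤ j + 1 ∧ j ≤ 4 * i + 1)) →
      xValue w j + xValue w (j + 1) + yValue w i ≤ s)
    {T : Finset (Fin (hCycleLength t) ⊕ Fin t)}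
    (hT : (T : Set (Fin (hCycleLength t) ⊕ Fin t)).Pairwise (graphH t).Adj) :
    ∑ v ∈ T, w v ≤ s := by
  classical
  rcases clique_cases ht hT with ⟨j, k, hj, hk, hjk, h⟩ | ⟨j, i, hj, hj', hi, hji, h⟩
  · have hsub : T ⊆ {Sum.inl ⟨j, hj⟩, Sum.inl ⟨k, hk⟩} := fun v hv => by simpa using h hv
    refine (Finset.sum_le_sum_of_subset hsub).trans ?_
    have hne : j ≠ k := by have := five_le_hCycleLength ht; omega
    rw [Finset.sum_pair (by simpa using hne), ← xValue_of_lt w, ← xValue_of_lt w]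
    exact hedge j k hj hk hjk
  · have hsub : T ⊆ {Sum.inr ⟨i, hi⟩, Sum.inl ⟨j, hj⟩, Sum.inl ⟨j + 1, hj'⟩} := fun v hv => by
      simpa using h hv
    refine (Finset.sum_le_sum_of_subset hsub).trans ?_
    rw [Finset.sum_insert (by simp), Finset.sum_pair (by simp), ← xValue_of_lt w,
      ← xValue_of_lt w, ← yValue_of_lt w]
    have := htri j i hj' hi hji
    omega

end Bounds

/-! ### Tight weights -/

section States

/-- The states `S k` describe a chain of fans in which every clique inequality along the chain is
tight. A fan without inner vertices reflects the state, and a fan with inner vertices keeps it,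
unless its apex has positive weight, when the state drops by one. The numbers `e` and `o` count the
drops after an even and after an odd number of reflections; hence how far the state moves down and
up in the frame of the starting state. -/
theorem exists_states (s m : ℕ) : ∀ lg ap : ℕ → Bool, ∃ e o,
    e + o = ∑ k ∈ Finset.range m, (if lg k && ap k then 1 else 0) ∧
    ∀ σ, 1 + e ≤ σ → σ + 1 + o ≤ s → ∃ S : ℕ → ℕ, S 0 = σ ∧
      (∀ k < m, (lg k = true → ap k = true → S (k + 1) + 1 = S k) ∧
        (lg k = true → ap k = false → S (k + 1) = S k) ∧
        (lg k = false → S (k + 1) + S k = s)) ∧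
      (∀ k ≤ m, 1 ≤ S k ∧ S k + 1 ≤ s) ∧
      (Even (∑ k ∈ Finset.range m, if lg k then 0 else 1) → S m + e = σ + o) ∧
      (¬ Even (∑ k ∈ Finset.range m, if lg k then 0 else 1) → S m + σ + o = s + e) := by
  induction m with
  | zero =>
    refine fun lg ap => ⟨0, 0, by simp, fun σ h1 h2 =>
      ⟨fun _ => σ, rfl, by simp, ?_, by simp, by simp⟩⟩
    intro k _
    exact ⟨by omega, by omega⟩
  | succ m ih =>
    intro lg ap
    obtain ⟨e, o, heo, h⟩ := ih (fun k => lg (k + 1)) (fun k => ap (k + 1))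
    -- Prepending a state `σ` to a sequence of states.
    have cons : ∀ (σ σ' : ℕ) (S : ℕ → ℕ), S 0 = σ' → 1 ≤ σ → σ + 1 ≤ s →
        ((lg 0 = true → ap 0 = true → σ' + 1 = σ) ∧ (lg 0 = true → ap 0 = false → σ' = σ) ∧
          (lg 0 = false → σ' + σ = s)) →
        (∀ k < m, (lg (k + 1) = true → ap (k + 1) = true → S (k + 1) + 1 = S k) ∧
          (lg (k + 1) = true → ap (k + 1) = false → S (k + 1) = S k) ∧
          (lg (k + 1) = false → S (k + 1) + S k = s)) →
        (∀ k ≤ m, 1 ≤ S k ∧ S k + 1 ≤ s) →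
        ∃ S' : ℕ → ℕ, S' 0 = σ ∧ S' (m + 1) = S m ∧
          (∀ k < m + 1, (lg k = true → ap k = true → S' (k + 1) + 1 = S' k) ∧
            (lg k = true → ap k = false → S' (k + 1) = S' k) ∧
            (lg k = false → S' (k + 1) + S' k = s)) ∧
          (∀ k ≤ m + 1, 1 ≤ S' k ∧ S' k + 1 ≤ s) := by
      intro σ σ' S h0 h1 h2 h3 h4 h5
      refine ⟨fun k => Nat.casesOn k σ S, rfl, rfl, ?_, ?_⟩
      · rintro (_ | k) hk
        · subst h0
          exact h3
        · exact h4 k (by omega)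
      · rintro (_ | k) hk
        · exact ⟨h1, h2⟩
        · exact h5 k (by omega)
    rw [Finset.sum_range_succ', Finset.sum_range_succ', ← heo]
    by_cases hl : lg 0 = true
    · by_cases ha : ap 0 = true
      · refine ⟨e + 1, o, by simp [hl, ha]; omega, fun σ h1 h2 => ?_⟩
        obtain ⟨S, hS0, hS1, hS2, hS3, hS4⟩ := h (σ - 1) (by omega) (by omega)
        obtain ⟨S', a, b, c, d⟩ := cons σ (σ - 1) S hS0 (by omega) (by omega)
          (by simp [hl, ha]; omega) hS1 hS2
        refine ⟨S', a, c, d, ?_, ?_⟩ <;> rw [b] <;> simp only [hl, if_true, add_zero] <;> intro hq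
        · have := hS3 hq
          omega
        · have := hS4 hq
          omega
      · refine ⟨e, o, by simp [hl, ha], fun σ h1 h2 => ?_⟩
        obtain ⟨S, hS0, hS1, hS2, hS3, hS4⟩ := h σ (by omega) (by omega)
        obtain ⟨S', a, b, c, d⟩ := cons σ σ S hS0 (by omega) (by omega)
          (by simp [hl, ha]) hS1 hS2
        refine ⟨S', a, c, d, ?_, ?_⟩ <;> rw [b] <;> simp only [hl, if_true, add_zero] <;> intro hq
        · exact hS3 hq
        · exact hS4 hq
    · refine ⟨o, e, by simp [hl]; omega, fun σ h1 h2 => ?_⟩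
      obtain ⟨S, hS0, hS1, hS2, hS3, hS4⟩ := h (s - σ) (by omega) (by omega)
      obtain ⟨S', a, b, c, d⟩ := cons σ (s - σ) S hS0 (by omega) (by omega)
        (by simp [hl]; omega) hS1 hS2
      refine ⟨S', a, c, d, ?_, ?_⟩ <;> rw [b] <;> simp only [hl] <;> intro hq <;>
        simp only [Bool.false_eq_true, if_false, Nat.even_add_one, not_not] at hq
      · have := hS4 hq
        omega
      · have := hS3 hq
        omega

end States

section Construction

variable {t s : ℕ}

theorem exists_add_eq {p q : Prop} (h : p ∨ q) {T : ℕ} (hT : 2 ≤ T) :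
    ∃ a b : ℕ, a + b = T ∧ (0 < a ↔ p) ∧ (0 < b ↔ q) := by
  by_cases hp : p <;> by_cases hq : q
  · exact ⟨1, T - 1, by omega, by simp [hp], by simp [hq]; omega⟩
  · exact ⟨T, 0, by omega, by simp [hp]; omega, by simp [hq]⟩
  · exact ⟨0, T, by omega, by simp [hp], by simp [hq]; omega⟩
  · tauto

/-- A function given on the first three vertices of the cycle and on the blocks of four vertices
that follow them. -/
theorem exists_eq_of_blocks (a b c : ℕ) (L A B R : ℕ → ℕ) : ∃ g : ℕ → ℕ, g 0 = a ∧ g 1 = b ∧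
    g 2 = c ∧ (∀ k, g (4 * k + 3) = L k) ∧ (∀ k, g (4 * k + 4) = A k) ∧
    (∀ k, g (4 * k + 5) = B k) ∧ (∀ k, g (4 * k + 6) = R k) := by
  refine ⟨fun j => if j = 0 then a else if j = 1 then b else if j = 2 then c else
    if j % 4 = 3 then L ((j - 3) / 4) else if j % 4 = 0 then A ((j - 3) / 4) else
    if j % 4 = 1 then B ((j - 3) / 4) else R ((j - 3) / 4), by simp, by simp, by simp,
    ?_, ?_, ?_, ?_⟩ <;>
  · intro k
    dsimp only
    rw [if_neg (by omega), if_neg (by omega), if_neg (by omega)]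
    first
    | rw [if_pos (by omega), show (4 * k + 3 - 3) / 4 = k by omega]
    | rw [if_neg (by omega), if_pos (by omega), show (4 * k + 4 - 3) / 4 = k by omega]
    | rw [if_neg (by omega), if_neg (by omega), if_pos (by omega),
        show (4 * k + 5 - 3) / 4 = k by omega]
    | rw [if_neg (by omega), if_neg (by omega), if_neg (by omega),
        show (4 * k + 6 - 3) / 4 = k by omega]

theorem xValue_sumElim (gx gy : ℕ → ℕ) {j : ℕ} (hj : j < hCycleLength t) :
    xValue (t := t) (Sum.elim (fun j => gx j) (fun i => gy i)) j = gx j := xValue_of_lt _ hj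

theorem yValue_sumElim (gx gy : ℕ → ℕ) {i : ℕ} (hi : i < t) :
    yValue (t := t) (Sum.elim (fun j => gx j) (fun i => gy i)) i = gy i := yValue_of_lt _ hi

/-- A weight on `H_t` is tight for `s` colours if it satisfies all clique inequalities and violates
the odd cycle inequality of its ring by exactly one, and if in each fan of which the inner vertices
and the apex are all present, the inner vertices carry more than `s / 2`. -/
structure TightWeight (t s : ℕ) (w : Fin (hCycleLength t) ⊕ Fin t → ℕ) : Prop where
  clique_le : ∀ T : Finset (Fin (hCycleLength t) ⊕ Fin t),
    (T : Set (Fin (hCycleLength t) ⊕ Fin t)).Pairwise (graphH t).Adj → ∑ v ∈ T, w v ≤ s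
  total_eq : ringLength w / 2 * s + 1 = ringTotal s w
  inner : ∀ k, k + 1 < t → 0 < xValue w (4 * k + 5) → 0 < yValue w (k + 1) →
    s < 2 * (xValue w (4 * k + 4) + xValue w (4 * k + 5))

theorem pos_iff_of_values {w w₀ : Fin (hCycleLength t) ⊕ Fin t → ℕ}
    (hx : ∀ j < hCycleLength t, 0 < xValue w j ↔ 0 < xValue w₀ j)
    (hy : ∀ i < t, 0 < yValue w i ↔ 0 < yValue w₀ i) : ∀ v, 0 < w v ↔ 0 < w₀ v := by
  rintro (⟨j, hj⟩ | ⟨i, hi⟩)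
  · have := hx j hj
    rwa [xValue_of_lt _ hj, xValue_of_lt _ hj] at this
  · have := hy i hi
    rwa [yValue_of_lt _ hi, yValue_of_lt _ hi] at this

theorem exists_tightWeight_one {w₀ : Fin (hCycleLength 1) ⊕ Fin 1 → ℕ} (h₀ : RingSupport w₀)
    (hs : 3 ≤ s) : ∃ w : Fin (hCycleLength 1) ⊕ Fin 1 → ℕ,
      (∀ v, 0 < w v ↔ 0 < w₀ v) ∧ TightWeight 1 s w := by
  obtain ⟨a, b, hab, ha, hb⟩ := exists_add_eq (p := 0 < xValue w₀ 1) (q := 0 < yValue w₀ 0)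
    (by have := h₀.head; omega) (T := s - 1) (by omega)
  have hn := hCycleLength_one
  obtain ⟨gx, g0, g1, g2, g3, g4, -, -⟩ := exists_eq_of_blocks 1 a 1 (fun _ => s - 1) (fun _ => 1)
    (fun _ => 0) (fun _ => 0)
  replace g3 := g3 0
  replace g4 := g4 0
  simp only [mul_zero, zero_add] at g3 g4
  have X : ∀ j < 5, xValue (t := 1) (Sum.elim (fun j => gx j) (fun _ => b)) j = gx j :=
    fun j hj => xValue_sumElim gx (fun _ => b) (by omega)
  have Y : yValue (t := 1) (Sum.elim (fun j => gx j) (fun _ => b)) 0 = b :=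
    yValue_sumElim gx (fun _ => b) (by omega)
  refine ⟨Sum.elim (fun j => gx j) (fun _ => b), pos_iff_of_values ?_ ?_, ?_, ?_, ?_⟩
  · intro j hj
    rw [X j (by omega)]
    by_cases h : j = 1
    · subst h; rw [g1]; exact ha
    · have := h₀.rim j hj h (by omega)
      have hj5 : j < 5 := by omega
      interval_cases j <;> omega
  · intro i hi
    obtain rfl : i = 0 := by omega
    rw [Y]; exact hb
  · intro T hT
    refine sum_le_of_edges_of_triangles le_rfl ?_ ?_ hT
    · intro j k hj hk hjk
      rw [X j (by omega), X k (by omega)]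
      have hj5 : j < 5 := by omega
      have hk5 : k < 5 := by omega
      rw [hn] at hjk
      interval_cases j <;> interval_cases k <;> omega
    · intro j i hj hi hji
      obtain rfl : i = 0 := by omega
      rw [X j (by omega), X (j + 1) (by omega), Y]
      have hj2 : j < 2 := by omega
      interval_cases j <;> simp only [zero_add, one_add_one_eq_two] <;> omega
  · unfold ringLength ringTotal
    rw [sum_eq_of_one]
    simp only [X 0 (by omega), X 1 (by omega), X 2 (by omega), X 3 (by omega), X 4 (by omega), Y,
      if_true]
    omega
  · intro k hk
    omega

theorem ringLength_congr {w w₀ : Fin (hCycleLength t) ⊕ Fin t → ℕ}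
    (h : ∀ v, 0 < w v ↔ 0 < w₀ v) : ringLength w = ringLength w₀ := by
  have hx : ∀ j, 0 < xValue w j ↔ 0 < xValue w₀ j := by
    intro j
    unfold xValue
    split_ifs
    · exact h _
    · rfl
  have : longAt w = longAt w₀ := funext fun k => by
    unfold longAt
    rw [decide_eq_decide]
    exact hx _
  unfold ringLength
  rw [this]

/-- The tight weight is read off from a sequence of states: the ends of the edge leading to the fan
number `k` have weights `S k` and `s - S k`. The number of reflections is even, so the last state
leaves room for the weight of `x_1`. -/
theorem exists_tightWeight_add_two {m : ℕ} {w₀ : Fin (hCycleLength (m + 2)) ⊕ Fin (m + 2) → ℕ}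
    (h₀ : RingSupport w₀) (hodd : Odd (ringLength w₀)) (hs : m + 4 ≤ s) :
    ∃ w : Fin (hCycleLength (m + 2)) ⊕ Fin (m + 2) → ℕ,
      (∀ v, 0 < w v ↔ 0 < w₀ v) ∧ TightWeight (m + 2) s w := by
  set lg : ℕ → Bool := longAt w₀ with hlg
  set ap : ℕ → Bool := fun k => decide (0 < yValue w₀ (k + 1)) with hap
  obtain ⟨e, o, heo, hS⟩ := exists_states s (m + 1) lg ap
  have hf : e + o ≤ m + 1 := by
    rw [heo]
    refine (Finset.sum_le_card_nsmul _ _ 1 fun k _ => ?_).trans (by simp)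
    split_ifs <;> omega
  -- `1 + e` is the least start for which the states stay positive; as `e + o < t`, the bound
  -- `t + 2 ≤ s` is what keeps them below `s`.
  obtain ⟨S, S0, hstep, hbd, heven, -⟩ := hS (1 + e) (by omega) (by omega)
  obtain ⟨a, b, hab, ha, hb⟩ := exists_add_eq (p := 0 < xValue w₀ 1) (q := 0 < yValue w₀ 0)
    (by have := h₀.head; omega) (T := s - (1 + e)) (by omega)
  have hn := hCycleLength_add_two m
  -- The four cycle vertices and the apex of the fan number `k`.
  set A : ℕ → ℕ := fun k => if lg k then (if ap k then S k - 1 else S k) else 0 with hA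
  set B : ℕ → ℕ := fun k => if lg k then s - S k else 0 with hB
  set Y : ℕ → ℕ := fun k => if lg k then (if ap k then 1 else 0) else S k with hY
  obtain ⟨gx, g0, g1, g2, g3, g4, g5, g6⟩ := exists_eq_of_blocks (1 + e) a (1 + e)
    (fun k => s - S k) A B (fun k => S (k + 1))
  set gy : ℕ → ℕ := fun i => if i = 0 then b else Y (i - 1) with hgy
  have gy0 : gy 0 = b := rfl
  have gy1 : ∀ k, gy (k + 1) = Y k := fun k => rfl
  have fan : ∀ k < m + 1,
      (lg k = true ∧ ap k = true ∧ S (k + 1) + 1 = S k ∧ A k = S k - 1 ∧ B k = s - S k ∧ Y k = 1) ∨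
      (lg k = true ∧ ap k = false ∧ S (k + 1) = S k ∧ A k = S k ∧ B k = s - S k ∧ Y k = 0) ∨
      (lg k = false ∧ S (k + 1) + S k = s ∧ A k = 0 ∧ B k = 0 ∧ Y k = S k) := by
    intro k hk
    obtain ⟨h1, h2, h3⟩ := hstep k hk
    rcases hl : lg k with _ | _
    · exact Or.inr (Or.inr ⟨rfl, h3 hl, by simp [hA, hl], by simp [hB, hl], by simp [hY, hl]⟩)
    · rcases ha' : ap k with _ | _
      · exact Or.inr (Or.inl ⟨rfl, rfl, h2 hl ha', by simp [hA, hl, ha'], by simp [hB, hl],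
          by simp [hY, hl, ha']⟩)
      · exact Or.inl ⟨rfl, rfl, h1 hl ha', by simp [hA, hl, ha'], by simp [hB, hl],
          by simp [hY, hl, ha']⟩
  have block : ∀ j, j < hCycleLength (m + 2) → j = 0 ∨ j = 1 ∨ j = 2 ∨ ∃ k < m + 1,
      j = 4 * k + 3 ∨ j = 4 * k + 4 ∨ j = 4 * k + 5 ∨ j = 4 * k + 6 := by
    intro j hj
    by_cases h : j < 3
    · omega
    · exact Or.inr (Or.inr (Or.inr ⟨(j - 3) / 4, by omega, by omega⟩))
  have X : ∀ j < hCycleLength (m + 2),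
      xValue (t := m + 2) (Sum.elim (fun j => gx j) (fun i => gy i)) j = gx j :=
    fun j hj => xValue_sumElim gx gy hj
  have YV : ∀ i < m + 2,
      yValue (t := m + 2) (Sum.elim (fun j => gx j) (fun i => gy i)) i = gy i :=
    fun i hi => yValue_sumElim gx gy hi
  have hlong : ∀ k, lg k = true ↔ 0 < xValue w₀ (4 * k + 5) := fun k => by simp [hlg, longAt]
  have hapex : ∀ k, ap k = true ↔ 0 < yValue w₀ (k + 1) := fun k => by simp [hap]
  have hpos : ∀ v, 0 < (Sum.elim (fun j => gx j) (fun i => gy i) :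
      Fin (hCycleLength (m + 2)) ⊕ Fin (m + 2) → ℕ) v ↔ 0 < w₀ v := by
    refine pos_iff_of_values ?_ ?_
    · intro j hj
      rw [X j hj]
      rcases block j hj with rfl | rfl | rfl | ⟨k, hk, h⟩
      · have := h₀.rim 0 hj (by omega) (by omega)
        omega
      · rw [g1]; exact ha
      · have := h₀.rim 2 hj (by omega) (by omega)
        omega
      · have b0 := hbd k (by omega)
        have b1 := hbd (k + 1) (by omega)
        have hk' := h₀.fan k (by omega)
        rcases h with rfl | rfl | rfl | rfl
        · have := h₀.rim _ hj (by omega) (by omega)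
          rw [g3]; omega
        · rw [g4]
          rcases fan k hk with ⟨h1, -, h2, h3, -⟩ | ⟨h1, -, h2, h3, -⟩ | ⟨h1, h2, h3, -⟩
          · rw [hlong] at h1; omega
          · rw [hlong] at h1; omega
          · rw [← Bool.not_eq_true, hlong] at h1; omega
        · rw [g5]
          rcases fan k hk with ⟨h1, -, h2, -, h3, -⟩ | ⟨h1, -, h2, -, h3, -⟩ | ⟨h1, h2, -, h3, -⟩
          · rw [hlong] at h1; omega
          · rw [hlong] at h1; omega
          · rw [← Bool.not_eq_true, hlong] at h1; omega
        · have := h₀.rim _ hj (by omega) (by omega)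
          rw [g6]; omega
    · rintro (_ | k) hi
      · rw [YV 0 hi, gy0]; exact hb
      · rw [YV _ hi, gy1]
        have b0 := hbd k (by omega)
        have hk' := h₀.fan k (by omega)
        rcases fan k (by omega) with ⟨-, h1, -, -, -, h2⟩ | ⟨-, h1, -, -, -, h2⟩ |
          ⟨h1, -, -, -, h2⟩
        · rw [hapex] at h1; omega
        · rw [← Bool.not_eq_true, hapex] at h1; omega
        · rw [← Bool.not_eq_true, hlong] at h1; omega
  have hlen : ringLength w₀ = 3 + ∑ k ∈ Finset.range (m + 1), if lg k then 4 else 3 := by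
    unfold ringLength
    rw [if_neg (by omega), show m + 2 - 1 = m + 1 by omega]
  rw [hlen] at hodd
  have hq : Even (∑ k ∈ Finset.range (m + 1), if lg k then 0 else 1) := by
    have h1 : ∑ k ∈ Finset.range (m + 1), (if lg k then 4 else 3)
        + ∑ k ∈ Finset.range (m + 1), (if lg k then 0 else 1) = (m + 1) * 4 := by
      rw [← Finset.sum_add_distrib, Finset.sum_congr rfl (g := fun _ => 4) (fun k _ => by
        split_ifs <;> rfl)]
      simp
    rw [Nat.odd_iff] at hodd
    rw [Nat.even_iff]
    omega
  have hend := heven hq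
  refine ⟨Sum.elim (fun j => gx j) (fun i => gy i), hpos, ?_, ?_, ?_⟩
  · intro T hT
    refine sum_le_of_edges_of_triangles (by omega) ?_ ?_ hT
    · intro j k hj hk hjk
      rw [X j hj, X k hk]
      rcases hjk with rfl | ⟨rfl, hjk⟩
      · rcases block j hj with rfl | rfl | rfl | ⟨k, hk', h⟩
        · simp only [zero_add]; omega
        · simp only [one_add_one_eq_two]; omega
        · have := g3 0
          simp only [mul_zero, zero_add, S0] at this
          simp only [show 2 + 1 = 3 from rfl]
          omega
        · have b0 := hbd k (by omega)
          have b1 := hbd (k + 1) (by omega)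
          rcases h with rfl | rfl | rfl | rfl
          · rw [g3, g4]
            rcases fan k hk' with h | h | h <;> omega
          · rw [g4, g5]
            rcases fan k hk' with h | h | h <;> omega
          · rw [g5, g6]
            rcases fan k hk' with h | h | h <;> omega
          · rw [g6, show 4 * k + 6 + 1 = 4 * (k + 1) + 3 by ring, g3]
            omega
      · obtain rfl : j = 4 * m + 6 := by omega
        rw [g6, g0]
        omega
    · intro j i hj hi hji
      rw [X j (by omega), X (j + 1) hj, YV i hi]
      rcases hji with ⟨rfl, hj1⟩ | ⟨hi1, hij, hji⟩
      · rw [gy0]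
        interval_cases j <;> simp only [zero_add, one_add_one_eq_two] <;> omega
      · obtain ⟨k, rfl⟩ : ∃ k, i = k + 1 := ⟨i - 1, by omega⟩
        rw [gy1]
        have b0 := hbd k (by omega)
        have b1 := hbd (k + 1) (by omega)
        have hj3 : j = 4 * k + 3 ∨ j = 4 * k + 4 ∨ j = 4 * k + 5 := by omega
        rcases hj3 with rfl | rfl | rfl
        · rw [g3, g4]
          rcases fan k (by omega) with h | h | h <;> omega
        · rw [g4, g5]
          rcases fan k (by omega) with h | h | h <;> omega
        · rw [g5, g6]
          rcases fan k (by omega) with h | h | h <;> omega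
  · rw [ringLength_congr hpos, hlen]
    unfold ringTotal
    rw [sum_eq_of_ne_one (by omega) (by omega) lg, if_neg (by omega),
      show m + 2 - 1 = m + 1 by omega, X 0 (by omega), X 1 (by omega), X 2 (by omega),
      YV 0 (by omega), g0, g1, g2, gy0]
    -- Adding up the tight edge inequalities, twice the total telescopes to a difference of states.
    have htel : ∀ M ≤ m + 1, 2 * ∑ k ∈ Finset.range M,
        (fanAt lg (Sum.elim (fun j => gx j) (fun i => gy i) :
          Fin (hCycleLength (m + 2)) ⊕ Fin (m + 2) → ℕ) k).total + S 0
        + ∑ k ∈ Finset.range M, (if lg k && ap k then 1 else 0)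
        = (∑ k ∈ Finset.range M, if lg k then 4 else 3) * s + S M := by
      intro M
      induction M with
      | zero => simp
      | succ k ih =>
        intro hk
        have ih := ih (by omega)
        rw [Finset.sum_range_succ, Finset.sum_range_succ, Finset.sum_range_succ, mul_add, add_mul]
        have b0 := hbd k (by omega)
        simp only [total, fanAt] at ih ⊢
        rw [X _ (by omega), X _ (by omega), X _ (by omega), X _ (by omega), YV _ (by omega), g3, g4,
          g5, g6, gy1]
        rcases fan k (by omega) with ⟨h1, h2, h⟩ | ⟨h1, h2, h⟩ | ⟨h1, h⟩
        · simp only [h1, h2, Bool.and_self, if_true]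
          omega
        · simp only [h1, h2, Bool.and_false, Bool.false_eq_true, if_true, if_false]
          omega
        · simp only [h1, Bool.false_and, Bool.false_eq_true, if_false]
          omega
    have := htel (m + 1) le_rfl
    rw [← heo] at this
    obtain ⟨N, hN⟩ := hodd
    rw [hN, show (2 * N + 1) / 2 = N by omega]
    have hN' : (∑ k ∈ Finset.range (m + 1), if lg k then 4 else 3) * s + 2 * s = 2 * (N * s) := by
      rw [← add_mul, ← mul_assoc]
      congr 1
      omega
    omega
  · intro k hk h1 h2
    rw [X _ (by omega)] at h1 ⊢
    rw [X _ (by omega)]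
    rw [YV _ (by omega), gy1] at h2
    rw [g4, g5] at *
    have b0 := hbd k (by omega)
    rcases fan k (by omega) with h | h | h <;> omega

/-- A set of vertices that forms an odd ring is the support of a tight weight with `s` colours, as
soon as `t + 2 ≤ s`. -/
theorem exists_tightWeight (ht : 1 ≤ t) {w₀ : Fin (hCycleLength t) ⊕ Fin t → ℕ}
    (h₀ : RingSupport w₀) (hodd : Odd (ringLength w₀)) (hs : t + 2 ≤ s) :
    ∃ w : Fin (hCycleLength t) ⊕ Fin t → ℕ, (∀ v, 0 < w v ↔ 0 < w₀ v) ∧ TightWeight t s w := by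
  obtain rfl | ⟨m, rfl⟩ : t = 1 ∨ ∃ m, t = m + 2 := by
    rcases Nat.lt_or_ge 1 t with h | h
    · exact Or.inr ⟨t - 2, by omega⟩
    · exact Or.inl (by omega)
  · exact exists_tightWeight_one h₀ hs
  · exact exists_tightWeight_add_two h₀ hodd (by omega)

end Construction

/-! ### The critical supports of `H_t` -/

section Cliques

variable {V : Type*} [Fintype V] [DecidableEq V] {G : SimpleGraph V} {s : ℕ}

/-- A clique with at least two and at most `s + 1` vertices is the support of a weight that is
critical for `s` colours: its total is `s + 1`. -/
theorem SimpleGraph.exists_criticalWeight_of_isClique {T : Finset V}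
    (hT : (T : Set V).Pairwise G.Adj) (h2 : 2 ≤ T.card) (hs : T.card ≤ s + 1) :
    ∃ w, G.CriticalWeight s w ∧ {v | 0 < w v} = (T : Set V) := by
  obtain ⟨u, hu⟩ : T.Nonempty := Finset.card_pos.1 (by omega)
  set w : V → ℕ := fun v => if v ∈ T then (if v = u then s + 2 - T.card else 1) else 0 with hw
  have hwu : w u = s + 2 - T.card := by simp [hw, hu]
  have hw1 : ∀ v ∈ T, v ≠ u → w v = 1 := fun v h h' => by simp [hw, h, h']
  have hw0 : ∀ v ∉ T, w v = 0 := fun v h => by simp [hw, h]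
  have hwT : ∀ v, (0 < w v ↔ v ∈ T) ∧ w v ≤ s := by
    intro v
    by_cases h : v ∈ T
    · by_cases h' : v = u
      · subst h'
        simp only [h, hwu, iff_true]
        omega
      · simp only [h, hw1 v h h', iff_true]
        omega
    · simp [h, hw0 v h]
  have hsT : ∑ v ∈ T, w v = s + 1 := by
    rw [← Finset.add_sum_erase T w hu, Finset.sum_congr rfl (g := fun _ => 1) fun v hv => by
      rw [Finset.mem_erase] at hv
      exact hw1 v hv.2 hv.1]
    simp only [hwu, Finset.sum_const, Finset.card_erase_of_mem hu, smul_eq_mul]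
    omega
  have hsum : ∑ v, w v = s + 1 := by
    rw [← hsT]
    exact (Finset.sum_subset (Finset.subset_univ T) fun v _ hv => hw0 v hv).symm
  refine ⟨w, ⟨fun v => (hwT v).2, fun h => ?_, fun v hv => weightColorable_of_sum_le ?_⟩, ?_⟩
  · have := h.sum_le_of_isClique hT
    omega
  · rw [Finset.sum_update_of_mem (Finset.mem_univ v)]
    have := Finset.add_sum_erase Finset.univ w (Finset.mem_univ v)
    rw [← Finset.sdiff_singleton_eq_erase] at this
    omega
  · ext v
    exact (hwT v).1

theorem SimpleGraph.CriticalWeight.support_nontrivial {w : V → ℕ} (hw : G.CriticalWeight s w) :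
    {v | 0 < w v}.Nontrivial := by
  by_contra h
  rw [Set.not_nontrivial_iff] at h
  obtain ⟨v, hv⟩ := hw.exists_pos
  refine hw.not_colorable (weightColorable_of_sum_le ?_)
  rw [Finset.sum_eq_single v (fun u _ huv => ?_) (by simp)]
  · exact hw.le v
  · by_contra hu
    exact huv (h (Nat.pos_of_ne_zero hu) hv)

end Cliques

section Supports

variable {t s : ℕ} {w w' : Fin (hCycleLength t) ⊕ Fin t → ℕ}

theorem RingSupport.congr (h : ∀ v, 0 < w v ↔ 0 < w' v) (hw' : RingSupport w') :
    RingSupport w := by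
  have hx : ∀ j, 0 < xValue w j ↔ 0 < xValue w' j := by
    intro j
    unfold xValue
    split_ifs
    · exact h _
    · rfl
  have hy : ∀ i, 0 < yValue w i ↔ 0 < yValue w' i := by
    intro i
    unfold yValue
    split_ifs
    · exact h _
    · rfl
  refine ⟨fun j hj h1 h2 => (hx j).2 (hw'.rim j hj h1 h2), ?_, fun k hk => ?_⟩
  · have := hw'.head
    have := hx 1
    have := hy 0
    omega
  · have := hw'.fan k hk
    have := hx (4 * k + 4)
    have := hx (4 * k + 5)
    have := hy (k + 1)
    omega

theorem xValue_le (h : w' ≤ w) (j : ℕ) : xValue w' j ≤ xValue w j := by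
  unfold xValue
  split_ifs
  · exact h _
  · exact le_rfl

theorem yValue_le (h : w' ≤ w) (i : ℕ) : yValue w' i ≤ yValue w i := by
  unfold yValue
  split_ifs
  · exact h _
  · exact le_rfl

theorem ringLength_le (h : w' ≤ w) : ringLength w' ≤ ringLength w := by
  unfold ringLength
  split_ifs
  · exact le_rfl
  · refine Nat.add_le_add_left (Finset.sum_le_sum fun k _ => ?_) _
    have := xValue_le h (4 * k + 5)
    simp only [longAt, decide_eq_true_eq]
    split_ifs <;> omega

/-- Passing from a tight weight to a smaller weight whose support is still a ring, each fan that
loses its inner vertices costs more than half of `s`. -/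
theorem TightWeight.two_mul_ringTotal_le (ht : 1 ≤ t) (hw : TightWeight t s w)
    (h : w' ≤ w) (hw' : RingSupport w') :
    2 * ringTotal s w' + (s + 1) * ringLength w ≤ 2 * ringTotal s w + (s + 1) * ringLength w' := by
  by_cases h1 : t = 1
  · have hN : ringLength w = ringLength w' := by
      unfold ringLength
      rw [if_pos h1, if_pos h1]
    have : ∑ v, w' v ≤ ∑ v, w v := Finset.sum_le_sum fun v _ => h v
    rw [hN]
    unfold ringTotal
    omega
  · have key : ∀ k ∈ Finset.range (t - 1),
        2 * (fanAt (longAt w) w' k).total + (s + 1) * (if longAt w k then 4 else 3) ≤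
          2 * (fanAt (longAt w) w k).total + (s + 1) * (if longAt w' k then 4 else 3) := by
      intro k hk
      rw [Finset.mem_range] at hk
      have e0 := xValue_le h (4 * k + 3)
      have e1 := xValue_le h (4 * k + 4)
      have e2 := xValue_le h (4 * k + 5)
      have e3 := xValue_le h (4 * k + 6)
      have e4 := yValue_le h (k + 1)
      have hfan := hw'.fan k (by omega)
      have hin := hw.inner k (by omega)
      simp only [longAt, decide_eq_true_eq, total, fanAt]
      split_ifs <;> omega
    have key := Finset.sum_le_sum key
    simp only [Finset.sum_add_distrib, ← Finset.mul_sum] at key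
    unfold ringTotal ringLength
    rw [if_neg h1, if_neg h1, if_neg h1, sum_eq_of_ne_one ht h1 (longAt w) w,
      sum_eq_of_ne_one ht h1 (longAt w) w']
    have e0 := xValue_le h 0
    have e1 := xValue_le h 1
    have e2 := xValue_le h 2
    have e4 := yValue_le h 0
    rw [mul_add (s + 1), mul_add (s + 1)]
    omega

/-- Tight weights are critical: a critical weight below a tight weight violates its own odd cycle
inequality, and this leaves no room for being smaller. -/
theorem TightWeight.criticalWeight (ht : 1 ≤ t) (hw : TightWeight t s w)
    (hring : RingSupport w) (hodd : Odd (ringLength w)) : (graphH t).CriticalWeight s w := by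
  classical
  have hle : ∀ v, w v ≤ s := fun v => by simpa using hw.clique_le {v} (by simp)
  have htot := hw.total_eq
  obtain ⟨w', hw'w, hw'⟩ := SimpleGraph.exists_criticalWeight_le
    (not_weightColorable_of_lt_ringTotal ht hring (s := s) (by omega)) hle
  have hcl : ¬ {v | 0 < w' v}.Pairwise (graphH t).Adj := by
    intro hp
    refine hw'.not_colorable (SimpleGraph.weightColorable_of_sum_le ?_)
    have h1 := hw.clique_le (Finset.univ.filter fun v => 0 < w' v) (by simpa using hp)
    refine le_trans ?_ h1
    rw [← Finset.sum_filter_add_sum_filter_not Finset.univ (fun v => 0 < w' v) w',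
      Finset.sum_eq_zero (s := Finset.univ.filter fun v => ¬ 0 < w' v) fun v hv => by
        simpa using hv, add_zero]
    exact Finset.sum_le_sum fun v _ => hw'w v
  obtain ⟨hodd', hlt'⟩ := odd_and_lt_ringTotal ht hw' hcl
  have h1 := hw.two_mul_ringTotal_le ht hw'w (ringSupport_of_criticalWeight ht hw' hcl)
  have hN : ringLength w = ringLength w' := by
    refine le_antisymm ?_ (ringLength_le hw'w)
    obtain ⟨M, hM⟩ := hodd
    obtain ⟨M', hM'⟩ := hodd'
    rw [hM, hM'] at h1 ⊢
    rw [hM, show (2 * M + 1) / 2 = M by omega] at htot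
    rw [hM', show (2 * M' + 1) / 2 = M' by omega] at hlt'
    have : M ≤ M' := by nlinarith
    omega
  have hsum : ∑ v, w' v = ∑ v, w v := by
    refine le_antisymm (Finset.sum_le_sum fun v _ => hw'w v) ?_
    rw [hN] at htot
    unfold ringTotal at htot hlt'
    omega
  obtain rfl : w' = w := funext fun v =>
    (Finset.sum_eq_sum_iff_of_le fun v _ => hw'w v).1 hsum v (Finset.mem_univ v)
  exact hw'

/-- For `s ≥ t + 2` the supports of the weights on `H_t` that are critical for `s` colours do not
depend on `s`. -/
theorem exists_criticalWeight_iff (ht : 1 ≤ t) (hs : t + 2 ≤ s)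
    (W : Set (Fin (hCycleLength t) ⊕ Fin t)) :
    (∃ w, (graphH t).CriticalWeight s w ∧ {v | 0 < w v} = W) ↔
      (W.Pairwise (graphH t).Adj ∧ W.Nontrivial) ∨
      ∃ w₀ : Fin (hCycleLength t) ⊕ Fin t → ℕ,
        RingSupport w₀ ∧ Odd (ringLength w₀) ∧ {v | 0 < w₀ v} = W := by
  classical
  constructor
  · rintro ⟨w, hw, rfl⟩
    by_cases hcl : {v | 0 < w v}.Pairwise (graphH t).Adj
    · exact Or.inl ⟨hcl, hw.support_nontrivial⟩
    · exact Or.inr ⟨w, ringSupport_of_criticalWeight ht hw hcl,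
        (odd_and_lt_ringTotal ht hw hcl).1, rfl⟩
  · rintro (⟨hW, hnt⟩ | ⟨w₀, h₀, hodd, rfl⟩)
    · have hT : ((W.toFinset : Finset _) : Set _) = W := Set.coe_toFinset W
      rw [← hT] at hW hnt ⊢
      have h3 := card_le_three_of_clique ht hW
      exact SimpleGraph.exists_criticalWeight_of_isClique hW
        (Finset.one_lt_card_iff_nontrivial.2 hnt) (by omega)
    · obtain ⟨w, hw, htw⟩ := exists_tightWeight ht h₀ hodd hs
      refine ⟨w, htw.criticalWeight ht (h₀.congr hw) ?_, by simp only [hw]⟩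
      rwa [ringLength_congr hw]

theorem exists_criticalWeight_full (ht : 1 ≤ t) (hs : t + 2 ≤ s) :
    ∃ w, (graphH t).CriticalWeight s w ∧ {v | 0 < w v} = Set.univ := by
  rw [exists_criticalWeight_iff ht hs]
  have h5 := five_le_hCycleLength ht
  have hx : ∀ j < hCycleLength t,
      0 < xValue (fun _ : Fin (hCycleLength t) ⊕ Fin t => 1) j := fun j hj => by
    rw [xValue_of_lt _ hj]; exact one_pos
  refine Or.inr ⟨fun _ => 1, ⟨fun j hj _ _ => hx j hj, ?_, fun k hk => Or.inl ?_⟩, ?_, by simp⟩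
  · have := hx 1 (by omega)
    omega
  · obtain ⟨m, rfl⟩ : ∃ m, t = m + 2 := ⟨t - 2, by omega⟩
    have := hCycleLength_add_two m
    exact ⟨hx _ (by omega), hx _ (by omega)⟩
  · rw [ringLength_of_full ht fun _ => one_pos, Nat.odd_iff]
    split_ifs <;> omega

theorem chromaticNumber_graphH (ht : 1 ≤ t) : (graphH t).chromaticNumber = 3 := by
  classical
  have h5 := five_le_hCycleLength ht
  have hn : hCycleLength t = 4 * t - 1 ∨ (t = 1 ∧ hCycleLength t = 5) := by
    unfold hCycleLength; split_ifs <;> omega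
  refine le_antisymm ?_ ?_
  · -- The neighbours of `y_1` have colours `2, 0, 2`, and the other cycle vertices alternate.
    let xc : ℕ → ℕ := fun j => if j = 0 ∨ j = 2 then 2 else if j % 2 = 1 then 0 else 1
    let yc : ℕ → ℕ := fun i => if i = 0 then 1 else 2
    have hxc : ∀ j, xc j < 3 := fun j => by dsimp only [xc]; split_ifs <;> omega
    have hyc : ∀ i, yc i < 3 := fun i => by dsimp only [yc]; split_ifs <;> omega
    have hxx : ∀ j k, j < hCycleLength t → k < hCycleLength t →
        (j + 1 = k ∨ (k = 0 ∧ j + 1 = hCycleLength t)) → xc j ≠ xc k := by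
      intro j k hj hk hjk
      dsimp only [xc]
      split_ifs <;> omega
    have hyx : ∀ i j, (i = 0 ∧ j ≤ 2) ∨ (1 ≤ i ∧ 4 * i ≤ j + 1 ∧ j ≤ 4 * i + 2) →
        yc i ≠ xc j := by
      intro i j hij
      dsimp only [xc, yc]
      split_ifs <;> omega
    have hcol : (graphH t).Colorable 3 := by
      refine ⟨SimpleGraph.Coloring.mk
        (Sum.elim (fun j => ⟨xc j, hxc j⟩) (fun i => ⟨yc i, hyc i⟩)) ?_⟩
      rintro (⟨j, hj⟩ | ⟨i, hi⟩) (⟨k, hk⟩ | ⟨i', hi'⟩) hadj <;>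
        simp only [Sum.elim_inl, Sum.elim_inr, ne_eq, Fin.mk.injEq]
      · rcases (graphH_adj_inl_inl ht hj hk).1 hadj with h | h | h | h
        · exact hxx j k hj hk (Or.inl h)
        · exact (hxx k j hk hj (Or.inl h)).symm
        · exact (hxx k j hk hj (Or.inr h)).symm
        · exact hxx j k hj hk (Or.inr h)
      · exact (hyx i' j ((graphH_adj_inr_inl hi' hj).1 hadj.symm)).symm
      · exact hyx i k ((graphH_adj_inr_inl hi hk).1 hadj)
      · exact absurd hadj (graphH_not_adj_inr_inr _ _)
    exact_mod_cast hcol.chromaticNumber_le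
  · have h0 : 0 < hCycleLength t := by omega
    have h1 : 1 < hCycleLength t := by omega
    have hcl : (graphH t).IsClique
        ({Sum.inr ⟨0, ht⟩, Sum.inl ⟨0, h0⟩, Sum.inl ⟨1, h1⟩} :
          Finset (Fin (hCycleLength t) ⊕ Fin t)) := by
      have e1 : (graphH t).Adj (Sum.inr ⟨0, ht⟩) (Sum.inl ⟨0, h0⟩) :=
        (graphH_adj_inr_inl _ _).2 (by omega)
      have e2 : (graphH t).Adj (Sum.inr ⟨0, ht⟩) (Sum.inl ⟨1, h1⟩) :=
        (graphH_adj_inr_inl _ _).2 (by omega)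
      have e3 : (graphH t).Adj (Sum.inl ⟨0, h0⟩) (Sum.inl ⟨1, h1⟩) :=
        (graphH_adj_inl_inl ht _ _).2 (by omega)
      exact (SimpleGraph.is3Clique_triple_iff.2 ⟨e1, e2, e3⟩).isClique
    by_contra hlt
    have h2 : (graphH t).chromaticNumber ≤ (2 : ℕ) := by
      rw [not_le] at hlt
      exact Order.le_of_lt_add_one (hlt.trans_le (by norm_num))
    have := hcl.card_le_of_colorable (SimpleGraph.chromaticNumber_le_iff_colorable.1 h2)
    rw [Finset.card_insert_of_notMem (by simp), Finset.card_pair (by simp)] at this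
    omega

end Supports

theorem theorem4p1 (K : Type*) [Field K] (t : ℕ) (ht : 1 ≤ t) :
    (graphH t).chromaticNumber = 3 ∧
    (∃ s : ℕ, (s : ℕ∞) = ((graphH t).chromaticNumber - 1) + (t : ℕ∞) ∧ s = 2 + t ∧
      AssStabilizesAt ((graphH t).coverIdeal K) s) ∧
    (∀ n : ℕ,
      Ideal.span (Set.range
          (MvPolynomial.X : Fin (hCycleLength t) ⊕ Fin t →
            MvPolynomial (Fin (hCycleLength t) ⊕ Fin t) K)) ∈
        assPower ((graphH t).coverIdeal K) n ↔ t + 2 ≤ n) := by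
  have hmax : ∀ n : ℕ, Ideal.span (Set.range
      (MvPolynomial.X : Fin (hCycleLength t) ⊕ Fin t →
        MvPolynomial (Fin (hCycleLength t) ⊕ Fin t) K)) ∈
        assPower ((graphH t).coverIdeal K) n ↔ t + 2 ≤ n := by
    intro n
    rw [SimpleGraph.mem_assPower_coverIdeal_iff]
    constructor
    · rintro ⟨w, hw, hP⟩
      refine add_two_le_of_full ht hw fun v => ?_
      have hv : (X v : MvPolynomial _ K) ∈ Ideal.span (X '' {v | 0 < w v}) :=
        hP ▸ Ideal.subset_span ⟨v, rfl⟩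
      rw [mem_ideal_span_X_image] at hv
      obtain ⟨u, hu, huv⟩ := hv (Finsupp.single v 1) (by simp [X])
      rw [Finsupp.single_apply] at huv
      obtain rfl : v = u := by
        by_contra h
        simp [h] at huv
      exact hu
    · intro hn
      obtain ⟨w, hw, hW⟩ := exists_criticalWeight_full ht hn
      exact ⟨w, hw, by rw [hW, Set.image_univ]⟩
  refine ⟨chromaticNumber_graphH ht, ⟨2 + t, ?_, rfl, ⟨by omega, fun n hn => ?_⟩, ?_⟩, hmax⟩
  · rw [chromaticNumber_graphH ht, show (3 : ℕ∞) - 1 = 2 from rfl]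
    push_cast
    rfl
  · ext P
    have h : ∀ s, t + 2 ≤ s → (P ∈ assPower ((graphH t).coverIdeal K) s ↔
        ∃ W, (∃ w, (graphH t).CriticalWeight s w ∧ {v | 0 < w v} = W) ∧
          P = Ideal.span (X '' W)) := by
      intro s _
      rw [SimpleGraph.mem_assPower_coverIdeal_iff]
      constructor
      · rintro ⟨w, hw, hP⟩
        exact ⟨_, ⟨w, hw, rfl⟩, hP⟩
      · rintro ⟨_, ⟨w, hw, rfl⟩, hP⟩
        exact ⟨w, hw, hP⟩
    rw [h n (by omega), h (2 + t) (by omega)]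
    simp only [exists_criticalWeight_iff ht (show t + 2 ≤ n by omega),
      exists_criticalWeight_iff ht (show t + 2 ≤ 2 + t by omega)]
  · rintro s ⟨-, hs⟩
    by_contra hlt
    have := (hmax (t + 2)).2 le_rfl
    rw [hs (t + 2) (by omega), hmax] at this
    omega
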